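/- **Setting.** Let $\Delta\subset\mathbb R^{n_x}\times\mathbb R^{n_y}$ be a measurable data space, $s(x,y,q)\in\mathbb R^{n_s}$ a score that is measurable in $(x,y)$ and, for every $(x,y)\in\Delta$, convex in $q\in\mathbb R^{n_q}$ (componentwise), $n_q\ge 1$, and $J:\mathbb R^{n_q}\to\mathbb R$ a convex cost. Let $(x^{(m)},y^{(m)})$, $m=1,\dots,n_{cal}+1$, be random points of $\Delta$; the first $n_{cal}$ are the calibration data $\mathcal M_{cal}$ (a family: equal points count separately), the last one is the test point $(x,y)$. Let $\varepsilon\in(0,1)$ and assume that $$\rho=\Bigl\lfloor \tfrac{\varepsilon(n_{cal}+1)}{n_q}\Bigr\rfloor-1\ \ge 0 .$$ For a finite family $\mathcal M$ of points of $\Delta$ let $q^*(\mathcal M)$ be the unique minimizer of $J(q)$ subject to $s(x,y,q)\le\mathbf 0$ for all $(x,y)\in\mathcal M$ (componentwise), and let $\mathrm{supp}(\mathcal M)$ be the set of those members of $\mathcal M$ without which $q^*(\mathcal M)$ is no longer the unique minimizer. RemMCP, started on $\mathcal M$, discards $\mathcal R_0=\emptyset$ and $$\mathcal R_{k}=\mathcal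 R_{k-1}\cup \mathrm{supp}(\mathcal M\setminus\mathcal R_{k-1})\cup\mathcal Z_{k-1},$$ where $\mathcal Z_{k-1}$ consists of the first $n_q-|\mathrm{supp}(\mathcal M\setminus\mathcal R_{k-1})|$ of the other remaining members in a fixed tie-breaking order: a measurable total preorder of the data points (for instance the lexicographic order), with points that it does not separate ordered by their index. Write $q_k^*=q^*(\mathcal M_{cal}\setminus\mathcal R_k)$ for the parameters obtained from $\mathcal M=\mathcal M_{cal}$, and $q^*=q^*_\rho$. The prediction set is $\mathcal Y(x,q^*)=\{y\in\mathbb R^{n_y}: s(x,y,q^*)\le\mathbf 0\}$, and the coverage is the random variable $\eta(q^*)=\mathbb P\bigl(y\in\mathcal Y(x,q^*)\mid\mathcal M_{cal}\bigr)$. **Assumptions.** 1. (Uniqueness) For every nonempty finite family $\mathcal M$ of points of $\Delta$ the program has exactly one minimizer. 2. (Nondegeneracy) For each $k=0,\dots,\rho$, with probability one, $q_k^*$ is also the unique minimizer of the program whose only constraints are those of $\mathrm{supp}(\mathcal M_{cal}\setminus\mathcal R_k)$. **Theorem 1 (Probabilistic guarantees of RemMCP).** Let these two assumptions hold. (a)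 If the $n_{cal}+1$ data points are exchangeable, then $\mathbb E[\eta(q^*)]\ge 1-\varepsilon$. (b) If the $n_{cal}+1$ data points are i.i.d., then $\mathbb P\bigl(\eta(q^*)\ge 1-\varepsilon\bigr)\ge 1-\beta$ with $$\beta=\sum_{j=0}^{n_q(\rho+1)-1}\binom{n_{cal}}{j}\varepsilon^j(1-\varepsilon)^{n_{cal}-j}.$$ This $\beta$ is the value at $1-\varepsilon$ of the distribution function of $\mathrm{Beta}\bigl(n_{cal}-n_q(\rho+1)+1,\;n_q(\rho+1)\bigr)$. (c) Suppose that the $n_{cal}+1$ data points are i.i.d. with law $P$ and that, in addition, 3. (Full support) for every $N>n_q$, the set $\mathrm{supp}(\mathcal M)$ of a family $\mathcal M$ of $N$ independent samples from $P$ has $n_q$ elements with probability one; 4. (Violation condition) for every $N$ and $N$ independent samples from $P$, with probability one: for every subfamily $\tilde{\mathcal M}$ of the samples, with supports $\tilde S_0,\tilde S_1,\dots$ of the successive stages of the procedure started on $\tilde{\mathcal M}$, every $k\in\{0,\dots,\rho\}$, every $\delta\in\tilde S_k$ and every $\mathcal M\subset\tilde{\mathcal M}\setminus\bigl(\bigcup_{j<k}\tilde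 S_j\cup\{\delta\}\bigr)$ with $|\mathcal M|=n_q$, the constraint $s(\delta,q^*(\mathcal M))\le\mathbf 0$ fails. Then $\eta(q^*)\sim\mathrm{Beta}\bigl(n_{cal}-n_q(\rho+1)+1,\;n_q(\rho+1)\bigr)$. -/

import Mathlib

open MeasureTheory ProbabilityTheory

namespace RemMCP

/-- A data point `(x, y)` with input `x ∈ ℝ^nx` and output `y ∈ ℝ^ny`. -/
abbrev Sample (nx ny : ℕ) : Type := (Fin nx → ℝ) × (Fin ny → ℝ)

/-- A vector-valued score `s(x, y, q) ∈ ℝ^ns` with parameter `q ∈ ℝ^nq`. -/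
abbrev Score (nx ny nq ns : ℕ) : Type :=
  (Fin nx → ℝ) → (Fin ny → ℝ) → (Fin nq → ℝ) → (Fin ns → ℝ)

/-- A priority order on the data points, for breaking ties: a measurable total preorder. The
lexicographic order on `ℝ^nx × ℝ^ny` is one; the relation that always holds is another one. -/
structure TieBreak (nx ny : ℕ) where
  le : Sample nx ny → Sample nx ny → Prop
  total : ∀ a b, le a b ∨ le b a
  trans : ∀ a b c, le a b → le b c → le a c
  measurableSet_le : MeasurableSet {p : Sample nx ny × Sample nx ny | le p.1 p.2}

section Program

variable {nx ny nq ns N : ℕ}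

/-- The prediction set `{y | s(x, y, q) ≤ 0}`. -/
def predictionSet (s : Score nx ny nq ns) (x : Fin nx → ℝ) (q : Fin nq → ℝ) :
    Set (Fin ny → ℝ) :=
  {y | s x y q ≤ 0}

/-- The parameter `q` satisfies the constraints of the samples of `d` with index in `A`. -/
def IsFeasible (s : Score nx ny nq ns) (d : Fin N → Sample nx ny) (A : Finset (Fin N))
    (q : Fin nq → ℝ) : Prop :=
  ∀ m ∈ A, s (d m).1 (d m).2 q ≤ 0

/-- `q` is the optimal solution, and the only one, of the program: minimize `J` subject to the
constraints of the samples with index in `A`. -/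
def IsSolution (s : Score nx ny nq ns) (J : (Fin nq → ℝ) → ℝ) (d : Fin N → Sample nx ny)
    (A : Finset (Fin N)) (q : Fin nq → ℝ) : Prop :=
  IsFeasible s d A q ∧ ∀ q', IsFeasible s d A q' → q' ≠ q → J q < J q'

open Classical in
/-- The optimizer of the program over the samples with index in `A` (a default value if there is
no unique optimal solution). -/
noncomputable def optimizer (s : Score nx ny nq ns) (J : (Fin nq → ℝ) → ℝ)
    (d : Fin N → Sample nx ny) (A : Finset (Fin N)) : Fin nq → ℝ :=
  if h : ∃ q, IsSolution s J d A q then h.choose else 0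

open Classical in
/-- The support set: the samples in `A` whose removal changes the optimizer, that is, without
which the optimizer over `A` is no longer the solution. -/
noncomputable def support (s : Score nx ny nq ns) (J : (Fin nq → ℝ) → ℝ)
    (d : Fin N → Sample nx ny) (A : Finset (Fin N)) : Finset (Fin N) :=
  A.filter fun m => ¬ IsSolution s J d (A.erase m) (optimizer s J d A)

/-- Sample `i` comes before sample `j` in the tie-breaking order; samples that the order of the
data points does not separate (equal ones, say) are ordered by their index. -/
def TieBreak.Before (tb : TieBreak nx ny) (d : Fin N → Sample nx ny) (i j : Fin N) : Prop :=
  tb.le (d i) (d j) ∧ (tb.le (d j) (d i) → i < j)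

open Classical in
/-- The first `c` samples of `A` in the tie-breaking order. -/
noncomputable def TieBreak.first (tb : TieBreak nx ny) (d : Fin N → Sample nx ny)
    (A : Finset (Fin N)) (c : ℕ) : Finset (Fin N) :=
  A.filter fun i => (A.filter fun j => tb.Before d j i).card < c

/-- The set of discarded samples after `k` stages, when the procedure is started on the samples
with index in `A`: each stage discards the support set of the current optimizer, together with
further samples, chosen by the tie-breaking rule, so that `nq` samples are discarded in all. -/
noncomputable def discarded (s : Score nx ny nq ns) (J : (Fin nq → ℝ) → ℝ) (tb : TieBreak nx ny)
    (d : Fin N → Sample nx ny) (A : Finset (Fin N)) : ℕ → Finset (Fin N)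
  | 0 => ∅
  | k + 1 =>
    let R := discarded s J tb d A k
    let S := support s J d (A \ R)
    R ∪ S ∪ tb.first d (A \ (R ∪ S)) (nq - S.card)

/-- The samples that remain at stage `k`. -/
noncomputable def remaining (s : Score nx ny nq ns) (J : (Fin nq → ℝ) → ℝ) (tb : TieBreak nx ny)
    (d : Fin N → Sample nx ny) (A : Finset (Fin N)) (k : ℕ) : Finset (Fin N) :=
  A \ discarded s J tb d A k

/-- The support set of the optimizer at stage `k`. -/
noncomputable def stageSupport (s : Score nx ny nq ns) (J : (Fin nq → ℝ) → ℝ)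
    (tb : TieBreak nx ny) (d : Fin N → Sample nx ny) (A : Finset (Fin N)) (k : ℕ) :
    Finset (Fin N) :=
  support s J d (remaining s J tb d A k)

/-- The parameter `q_k^*` computed at stage `k` from the whole data set `d`. -/
noncomputable def stageParam (s : Score nx ny nq ns) (J : (Fin nq → ℝ) → ℝ)
    (tb : TieBreak nx ny) (k : ℕ) (d : Fin N → Sample nx ny) : Fin nq → ℝ :=
  optimizer s J d (remaining s J tb d Finset.univ k)

/-- For every nonempty finite family of samples from `Δ`, the program with the constraints of
these samples has exactly one optimal solution. -/
def ExistsUniqueSolution (s : Score nx ny nq ns) (J : (Fin nq → ℝ) → ℝ)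
    (Δ : Set (Sample nx ny)) : Prop :=
  ∀ N : ℕ, 1 ≤ N → ∀ d : Fin N → Sample nx ny, (∀ m, d m ∈ Δ) →
    ∃ q, IsSolution s J d Finset.univ q

/-- The program at stage `k` is nondegenerate: the samples in the support set alone already
determine its solution. -/
def Nondegenerate (s : Score nx ny nq ns) (J : (Fin nq → ℝ) → ℝ) (tb : TieBreak nx ny)
    (d : Fin N → Sample nx ny) (k : ℕ) : Prop :=
  IsSolution s J d (stageSupport s J tb d Finset.univ k) (stageParam s J tb k d)

/-- Full support: for every `N > nq`, the support set of the optimizer over `N` independent samples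
from `P` has `nq` elements with probability one. -/
def FullySupported (s : Score nx ny nq ns) (J : (Fin nq → ℝ) → ℝ)
    (P : Measure (Sample nx ny)) : Prop :=
  ∀ N : ℕ, nq < N → ∀ᵐ d ∂(Measure.pi fun _ : Fin N => P),
    (support s J d Finset.univ).card = nq

/-- The violation condition, for independent samples from `P` and with probability one: when the
procedure is run on a subset `A` of the samples, a sample `i` of the support set of a stage
`k ≤ ρ` is violated by the optimizer over any `nq` samples of `A` that avoid `i` and the support
sets of the earlier stages. -/
def ViolationCondition (s : Score nx ny nq ns) (J : (Fin nq → ℝ) → ℝ) (tb : TieBreak nx ny)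
    (ρ : ℕ) (P : Measure (Sample nx ny)) : Prop :=
  ∀ N : ℕ, ∀ᵐ d ∂(Measure.pi fun _ : Fin N => P),
    ∀ A : Finset (Fin N), ∀ k ≤ ρ, ∀ i ∈ stageSupport s J tb d A k,
      ∀ B ⊆ A, i ∉ B → (∀ j < k, Disjoint B (stageSupport s J tb d A j)) → B.card = nq →
        ¬ s (d i).1 (d i).2 (optimizer s J d B) ≤ 0

end Program

section Probability

variable {Ω : Type*} [MeasurableSpace Ω] {nx ny nq ns n : ℕ}

/-- Exchangeability: the joint law is invariant under permutations. -/
def Exchangeable {N : ℕ} (Z : Fin N → Ω → Sample nx ny) (μ : Measure Ω) : Prop :=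
  ∀ σ : Equiv.Perm (Fin N), μ.map (fun ω i => Z (σ i) ω) = μ.map (fun ω i => Z i ω)

/-- Independent and identically distributed. -/
def IsIID {N : ℕ} (Z : Fin N → Ω → Sample nx ny) (μ : Measure Ω) : Prop :=
  iIndepFun Z μ ∧ ∀ i j, IdentDistrib (Z i) (Z j) μ μ

/-- The calibration data: the first `n` of the `n + 1` data points. The last one is the test
point. -/
def calibration (Z : Fin (n + 1) → Ω → Sample nx ny) (ω : Ω) : Fin n → Sample nx ny :=
  fun m => Z m.castSucc ω

/-- The coverage `η(q^*)` of the parameter `q^* = q_ρ^*`: the conditional probability, given the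
calibration data, that the prediction set for the input of the test point contains its output. -/
noncomputable def coverage (s : Score nx ny nq ns) (J : (Fin nq → ℝ) → ℝ) (tb : TieBreak nx ny)
    (ρ : ℕ) (μ : Measure Ω) [IsFiniteMeasure μ] (Z : Fin (n + 1) → Ω → Sample nx ny) (ω : Ω) : ℝ :=
  (condDistrib (Z (Fin.last n)) (calibration Z) μ (calibration Z ω)).real
    {p | p.2 ∈ predictionSet s p.1 (stageParam s J tb ρ (calibration Z ω))}

end Probability

/-- The binomial tail sum `∑_{j < c} (n choose j) ε^j (1 - ε)^(n - j)`. -/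
noncomputable def binomialTail (n c : ℕ) (ε : ℝ) : ℝ :=
  ∑ j ∈ Finset.range c, (n.choose j : ℝ) * ε ^ j * (1 - ε) ^ (n - j)

end RemMCP

set_option linter.unusedSectionVars false

/-! Let `d = (ρ + 1) * nq`. By Helly's theorem the minimizer of a convex program in `nq` variables
is determined by at most `nq` of its constraints. A run of the procedure therefore hinges on few
samples: the `ρ * nq` discarded ones and at most `nq` in the last stage. In a nondegenerate run,
leaving out samples that were not selected changes nothing (`selected_sdiff`, `removed_sdiff`).
Nondegeneracy is assumed for `n` samples only; `nondegenerateOn_of_erase` lifts it to larger systems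
as long as more than `2 * nq` constraints remain, which is the case at every stage but the last.

Exchangeable data. In the run on all `n + 1` points, a point that is neither discarded nor essential
at the last stage satisfies its constraint at the result of the run that leaves it out. So at most
`d` points are violated when left out (`card_violated_le`), and by symmetry the test point is
violated with probability at most `d / (n + 1) ≤ ε`.

Independent data. A selection of exactly `d` samples (`compression`) that commutes with permutations
avoids `k` given samples among `n + k` with the hypergeometric probability `C(n - d + k, k) / C(n +
k, k)`. If moreover `k` fresh samples are all unselected exactly when each of them is unselected on
its own (`disjoint_compression_iff`), this is the `k`-th moment of the conditional probability that
a fresh sample is unselected. These are the moments of `Beta(n - d + 1, d)`, and moments determine a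
law on the unit interval (`map_measureReal_eq_betaMeasure`). Unselected samples satisfy their
constraints, so the coverage dominates this law.

Two obstacles remain: ties broken by the index are not symmetric, and the last stage may degenerate
on more than `n` samples. Independent uniform labels remove both. They break ties symmetrically, and
relaxing each constraint of the last stage by `r` times its label, with a quadratic term of size `r`
in the cost, makes that stage almost surely nondegenerate. Then `r` tends to zero
(`le_measure_labelled`), and sorting by the labels leads back to ties broken by the index
(`le_measure_finalParam`).

Exact law. Under full support no padding occurs and every program with more than `nq` constraints is
nondegenerate; the violation condition turns "unselected implies satisfied" into an equivalence for
fresh samples (`forall_mem_iff_disjoint_removed`). The moment computation then applies to the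
coverage itself. -/

namespace RemMCP

/-! ### Convex programs with finitely many constraints: bases, essential constraints, nondegeneracy.
-/

section ConstraintSystem

variable {ι κ : Type*} [DecidableEq ι] [DecidableEq κ] {nq : ℕ}

/-- `q` is the unique minimizer of `J` over the constraint sets `K i`, `i ∈ A`. -/
def IsArgmin (K : ι → Set (Fin nq → ℝ)) (J : (Fin nq → ℝ) → ℝ) (A : Finset ι)
    (q : Fin nq → ℝ) : Prop :=
  (∀ i ∈ A, q ∈ K i) ∧ ∀ q', (∀ i ∈ A, q' ∈ K i) → q' ≠ q → J q < J q'

open Classical in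
/-- The unique minimizer, with value `0` if there is none. -/
noncomputable def argmin (K : ι → Set (Fin nq → ℝ)) (J : (Fin nq → ℝ) → ℝ) (A : Finset ι) :
    Fin nq → ℝ :=
  if h : ∃ q, IsArgmin K J A q then h.choose else 0

open Classical in
/-- The constraints in `A` without which the minimizer over `A` is lost. -/
noncomputable def essential (K : ι → Set (Fin nq → ℝ)) (J : (Fin nq → ℝ) → ℝ) (A : Finset ι) :
    Finset ι :=
  A.filter fun m => ¬ IsArgmin K J (A.erase m) (argmin K J A)

open Classical in
/-- The first `c` elements of `A` with respect to the relation `b`. -/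
noncomputable def firstOf (b : ι → ι → Prop) (A : Finset ι) (c : ℕ) : Finset ι :=
  A.filter fun i => (A.filter fun j => b j i).card < c

/-- The essential constraints of `A`, padded to `nq` elements. -/
noncomputable def selected (K : ι → Set (Fin nq → ℝ)) (J : (Fin nq → ℝ) → ℝ) (b : ι → ι → Prop)
    (A : Finset ι) : Finset ι :=
  essential K J A ∪ firstOf b (A \ essential K J A) (nq - (essential K J A).card)

/-- The constraints removed in `k` rounds of selection. -/
noncomputable def removed (K : ι → Set (Fin nq → ℝ)) (J : (Fin nq → ℝ) → ℝ) (b : ι → ι → Prop)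
    (A : Finset ι) : ℕ → Finset ι
  | 0 => ∅
  | k + 1 => removed K J b A k ∪ selected K J b (A \ removed K J b A k)

/-- The essential constraints of `A` alone determine the minimizer. -/
def NondegenerateOn (K : ι → Set (Fin nq → ℝ)) (J : (Fin nq → ℝ) → ℝ) (A : Finset ι) : Prop :=
  IsArgmin K J (essential K J A) (argmin K J A)

/-- Every nonempty subsystem has a unique minimizer. -/
def Solvable (K : ι → Set (Fin nq → ℝ)) (J : (Fin nq → ℝ) → ℝ) : Prop :=
  ∀ A : Finset ι, A.Nonempty → ∃ q, IsArgmin K J A q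

variable {K : ι → Set (Fin nq → ℝ)} {J : (Fin nq → ℝ) → ℝ} {A B : Finset ι} {q q' : Fin nq → ℝ}

lemma IsArgmin.unique (h : IsArgmin K J A q) (h' : IsArgmin K J A q') : q = q' := by
  by_contra hne
  exact lt_asymm (h.2 q' h'.1 (Ne.symm hne)) (h'.2 q h.1 hne)

lemma IsArgmin.argmin_eq (h : IsArgmin K J A q) : argmin K J A = q := by
  have hex : ∃ q, IsArgmin K J A q := ⟨q, h⟩
  rw [argmin, dif_pos hex]
  exact hex.choose_spec.unique h

lemma isArgmin_argmin (h : ∃ q, IsArgmin K J A q) : IsArgmin K J A (argmin K J A) := by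
  obtain ⟨q, hq⟩ := h
  rwa [hq.argmin_eq]

lemma Solvable.isArgmin (h : Solvable K J) (hA : A.Nonempty) : IsArgmin K J A (argmin K J A) :=
  isArgmin_argmin (h A hA)

lemma IsArgmin.mono (h : IsArgmin K J B q) (hBA : B ⊆ A) (hq : ∀ i ∈ A, q ∈ K i) :
    IsArgmin K J A q :=
  ⟨hq, fun q' hq' => h.2 q' fun i hi => hq' i (hBA hi)⟩

lemma mem_essential {m : ι} :
    m ∈ essential K J A ↔ m ∈ A ∧ ¬ IsArgmin K J (A.erase m) (argmin K J A) := by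
  simp [essential]

lemma essential_subset : essential K J A ⊆ A := by
  classical exact Finset.filter_subset _ _

/-- A constraint outside `B` is dispensable: the system without it still contains `B`, which already
fixes the minimizer. -/
lemma essential_subset_of_isArgmin (hA : IsArgmin K J A (argmin K J A)) (hBA : B ⊆ A)
    (hB : IsArgmin K J B (argmin K J A)) : essential K J A ⊆ B := by
  intro m hm
  by_contra hmB
  obtain ⟨-, h⟩ := mem_essential.1 hm
  exact h (hB.mono (fun i hi => Finset.mem_erase.2 ⟨fun h => hmB (h ▸ hi), hBA hi⟩)
    fun i hi => hA.1 i (Finset.mem_of_mem_erase hi))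

/-- A subsystem that determines the minimizer contains a minimal one. -/
lemma exists_minimal_isArgmin (h : IsArgmin K J A q) :
    ∃ I ⊆ A, IsArgmin K J I q ∧ ∀ i ∈ I, ¬ IsArgmin K J (I.erase i) q := by
  induction A using Finset.strongInduction with
  | H A ih =>
    by_cases hex : ∃ i ∈ A, IsArgmin K J (A.erase i) q
    · obtain ⟨i, hi, hq⟩ := hex
      obtain ⟨I, hI, h1, h2⟩ := ih _ (Finset.erase_ssubset hi) hq
      exact ⟨I, hI.trans (Finset.erase_subset _ _), h1, h2⟩
    · push Not at hex
      exact ⟨A, Finset.Subset.refl _, h, hex⟩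

/-- By Helly's theorem, a minimal subsystem has at most as many constraints as variables. -/
lemma card_le_of_minimal (hnq : 1 ≤ nq) (hK : ∀ i, Convex ℝ (K i)) (hJ : ConvexOn ℝ Set.univ J)
    (hsolv : Solvable K J) (hA : IsArgmin K J A q)
    (hmin : ∀ i ∈ A, ¬ IsArgmin K J (A.erase i) q) : A.card ≤ nq := by
  by_contra! hcard
  have hne : ∀ i ∈ A, ∃ p, (∀ j ∈ A.erase i, p ∈ K j) ∧ J p < J q := by
    intro i hi
    have hne : (A.erase i).Nonempty := by
      rw [← Finset.card_pos, Finset.card_erase_of_mem hi]; omega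
    have hp := hsolv.isArgmin hne
    refine ⟨_, hp.1, hp.2 q (fun j hj => hA.1 j (Finset.mem_of_mem_erase hj)) fun h => ?_⟩
    exact hmin i hi (h ▸ hp)
  choose! p hpK hpJ using hne
  -- Helly's theorem for the constraint sets together with the strict sublevel set of the cost,
  -- indexed by `none`. A subfamily of at most `nq + 1` sets misses a constraint `i`, and then
  -- contains `p i` in its intersection, or it misses `none`, and then `q` is a common point. A
  -- point common to all sets would be feasible and cheaper than `q`.
  let F : Option ι → Set (Fin nq → ℝ) := fun o => o.elim {x | J x < J q} K
  obtain ⟨x, hx⟩ : (⋂ o ∈ Finset.insertNone A, F o).Nonempty := by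
    refine Convex.helly_theorem (𝕜 := ℝ) ?_ ?_ ?_
    · simp; omega
    · rintro (_ | i) -
      · have := hJ.convex_lt (J q)
        simpa [F] using this
      · exact hK i
    · intro G hG hGc
      simp only [Module.finrank_fintype_fun_eq_card, Fintype.card_fin] at hGc
      by_cases hex : ∃ i ∈ A, some i ∉ G
      · obtain ⟨i, hi, hiG⟩ := hex
        refine ⟨p i, Set.mem_iInter₂.2 ?_⟩
        rintro (_ | j) hj
        · exact hpJ i hi
        · refine hpK i hi j (Finset.mem_erase.2 ⟨fun h => hiG (h ▸ hj), ?_⟩)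
          simpa using hG hj
      · push Not at hex
        refine ⟨q, Set.mem_iInter₂.2 ?_⟩
        rintro (_ | j) hj
        · exfalso
          have hsub : Finset.insertNone A ⊆ G := by
            intro o ho
            rcases o with _ | i
            · exact hj
            · exact hex i (by simpa using ho)
          have := Finset.card_le_card hsub
          simp at this; omega
        · exact hA.1 j (by simpa using hG hj)
  rw [Set.mem_iInter₂] at hx
  have h0 : J x < J q := hx none (by simp)
  have hxK : ∀ i ∈ A, x ∈ K i := fun i hi => hx (some i) (by simpa using hi)
  by_cases hxq : x = q
  · exact absurd h0 (by rw [hxq]; exact lt_irrefl _)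
  · exact lt_asymm h0 (hA.2 x hxK hxq)

/-- A basis of the program, in the sense of linear programming. Unlike the essential set, it
determines the minimizer even in a degenerate system, but it need not be unique. -/
lemma exists_basis (hnq : 1 ≤ nq) (hK : ∀ i, Convex ℝ (K i)) (hJ : ConvexOn ℝ Set.univ J)
    (hsolv : Solvable K J) (hA : IsArgmin K J A q) :
    ∃ I ⊆ A, I.card ≤ nq ∧ IsArgmin K J I q ∧ ∀ i ∈ I, ¬ IsArgmin K J (I.erase i) q := by
  obtain ⟨I, hIA, hI, hmin⟩ := exists_minimal_isArgmin hA
  exact ⟨I, hIA, card_le_of_minimal hnq hK hJ hsolv hI hmin, hI, hmin⟩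

lemma card_essential_le (hnq : 1 ≤ nq) (hK : ∀ i, Convex ℝ (K i)) (hJ : ConvexOn ℝ Set.univ J)
    (hsolv : Solvable K J) (hA : A.Nonempty) : (essential K J A).card ≤ nq := by
  obtain ⟨I, hIA, hc, hI, -⟩ := exists_basis hnq hK hJ hsolv (hsolv.isArgmin hA)
  exact (Finset.card_le_card (essential_subset_of_isArgmin (hsolv.isArgmin hA) hIA hI)).trans hc

/-- A system with more than `2 nq` constraints is nondegenerate if all systems with one constraint
less are. -/
lemma nondegenerateOn_of_erase (hnq : 1 ≤ nq) (hK : ∀ i, Convex ℝ (K i))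
    (hJ : ConvexOn ℝ Set.univ J) (hsolv : Solvable K J) (hcard : 2 * nq < A.card)
    (h : ∀ i ∈ A, NondegenerateOn K J (A.erase i)) : NondegenerateOn K J A := by
  have hne : A.Nonempty := by rw [← Finset.card_pos]; omega
  have hA := hsolv.isArgmin hne
  obtain ⟨I, hIA, hIc, hI, hmin⟩ := exists_basis hnq hK hJ hsolv hA
  by_cases hsub : I ⊆ essential K J A
  · exact hI.mono hsub fun i hi => hA.1 i (essential_subset hi)
  exfalso
  obtain ⟨e, heI, heS⟩ := Finset.not_subset.1 hsub
  have he : IsArgmin K J (A.erase e) (argmin K J A) := by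
    by_contra hcon
    exact heS (mem_essential.2 ⟨hIA heI, hcon⟩)
  -- A second basis, avoiding `e`. Since `I` and `I'` have at most `2 * nq` elements together, some
  -- `i` lies outside both. They remain bases after the removal of `i`, so the essential set of
  -- `A.erase i` lies in both and misses `e`. As it determines the minimizer, `e` is superfluous in
  -- `I`, against minimality.
  obtain ⟨I', hIA', hIc', hI', -⟩ := exists_basis hnq hK hJ hsolv he
  obtain ⟨i, hi, hiI⟩ : ∃ i ∈ A, i ∉ I ∪ I' := by
    by_contra! hcon
    have := (Finset.card_le_card hcon).trans (Finset.card_union_le I I')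
    omega
  rw [Finset.mem_union, not_or] at hiI
  have hIi : I ⊆ A.erase i := fun j hj => Finset.mem_erase.2 ⟨fun h => hiI.1 (h ▸ hj), hIA hj⟩
  have hIi' : I' ⊆ A.erase i := fun j hj =>
    Finset.mem_erase.2 ⟨fun h => hiI.2 (h ▸ hj), Finset.mem_of_mem_erase (hIA' hj)⟩
  have hAi : IsArgmin K J (A.erase i) (argmin K J A) :=
    hI.mono hIi fun j hj => hA.1 j (Finset.mem_of_mem_erase hj)
  have hq : argmin K J (A.erase i) = argmin K J A := hAi.argmin_eq
  have hnd := h i hi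
  rw [NondegenerateOn, hq] at hnd
  have h1 := essential_subset_of_isArgmin (hq ▸ hAi) hIi (hq ▸ hI)
  have h2 := essential_subset_of_isArgmin (hq ▸ hAi) hIi' (hq ▸ hI')
  refine hmin e heI (hnd.mono (fun j hj => Finset.mem_erase.2 ⟨?_, h1 hj⟩)
    fun j hj => hI.1 j (Finset.mem_of_mem_erase hj))
  rintro rfl
  exact Finset.notMem_erase _ _ (hIA' (h2 hj))

lemma NondegenerateOn.isArgmin (h : NondegenerateOn K J A) (hB : essential K J A ⊆ B)
    (hBA : B ⊆ A) (hA : A.Nonempty) (hsolv : Solvable K J) :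
    IsArgmin K J B (argmin K J A) :=
  h.mono hB fun i hi => (hsolv.isArgmin hA).1 i (hBA hi)

/-- Removing constraints that are not essential from a nondegenerate system. -/
lemma NondegenerateOn.restrict (h : NondegenerateOn K J A) (hB : essential K J A ⊆ B)
    (hBA : B ⊆ A) (hA : A.Nonempty) (hsolv : Solvable K J) :
    argmin K J B = argmin K J A ∧ essential K J B = essential K J A ∧ NondegenerateOn K J B := by
  have hBq := h.isArgmin hB hBA hA hsolv
  have hq := hBq.argmin_eq
  have hS : essential K J B = essential K J A := by
    refine Finset.Subset.antisymm
      (essential_subset_of_isArgmin (hq ▸ hBq) hB (by rw [hq]; exact h)) fun m hm => ?_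
    refine mem_essential.2 ⟨hB hm, fun hcon => (mem_essential.1 hm).2 ?_⟩
    rw [hq] at hcon
    exact hcon.mono (Finset.erase_subset_erase _ hBA)
      fun i hi => (hsolv.isArgmin hA).1 i (Finset.mem_of_mem_erase hi)
  refine ⟨hq, hS, ?_⟩
  rw [NondegenerateOn, hS, hq]; exact h

/-- A constraint that is not essential after its insertion is satisfied by the old minimizer. -/
lemma mem_of_notMem_essential {t : ι} (ht : t ∉ A) (hsolv : Solvable K J)
    (h : t ∉ essential K J (insert t A)) : argmin K J A ∈ K t := by
  have h1 : IsArgmin K J ((insert t A).erase t) (argmin K J (insert t A)) := by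
    by_contra hcon
    exact h (mem_essential.2 ⟨Finset.mem_insert_self _ _, hcon⟩)
  rw [Finset.erase_insert ht] at h1
  rw [h1.argmin_eq]
  exact (hsolv.isArgmin (Finset.insert_nonempty t A)).1 t (Finset.mem_insert_self _ _)

end ConstraintSystem

/-! ### The first elements of a finite set in a strict total order. -/

section Ties

variable {ι κ : Type*} [DecidableEq ι] [DecidableEq κ] {b : ι → ι → Prop} {A T : Finset ι} {c : ℕ}

lemma firstOf_subset : firstOf b A c ⊆ A := by
  classical exact Finset.filter_subset _ _

lemma firstOf_zero : firstOf b A 0 = ∅ := by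
  simp [firstOf]

-- The number of predecessors is an injective rank on `A` with values `0, …, A.card - 1`, so exactly
-- `c` elements have rank below `c`.
open Classical in
lemma card_firstOf [IsStrictTotalOrder ι b] (hc : c ≤ A.card) : (firstOf b A c).card = c := by
  induction c with
  | zero => simp [firstOf_zero]
  | succ c ih =>
    have ih := ih (by omega)
    -- the least element outside the first `c` ones
    let rank : ι → ℕ := fun i => (A.filter fun j => b j i).card
    have hrank : ∀ i ∈ A, ∀ j ∈ A, b i j → rank i < rank j := by
      intro i hi j hj hij
      refine Finset.card_lt_card (Finset.ssubset_iff_of_subset ?_ |>.2 ⟨i, ?_, ?_⟩)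
      · intro l hl
        rw [Finset.mem_filter] at hl ⊢
        exact ⟨hl.1, _root_.trans hl.2 hij⟩
      · exact Finset.mem_filter.2 ⟨hi, hij⟩
      · simpa using fun _ => irrefl_of b i
    have hinj : Set.InjOn rank A := by
      intro i hi j hj hij
      rcases trichotomous_of b i j with h | h | h
      · exact absurd hij (hrank i hi j hj h).ne
      · exact h
      · exact absurd hij (hrank j hj i hi h).ne'
    have himg : A.image rank = Finset.range A.card := by
      refine Finset.eq_of_subset_of_card_le ?_ ?_
      · intro r hr
        obtain ⟨i, hi, rfl⟩ := Finset.mem_image.1 hr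
        rw [Finset.mem_range]
        refine Finset.card_lt_card (Finset.ssubset_iff_of_subset (Finset.filter_subset _ _) |>.2
          ⟨i, hi, ?_⟩)
        simpa using fun _ => irrefl_of b i
      · rw [Finset.card_image_of_injOn hinj, Finset.card_range]
    have : (firstOf b A (c + 1)).image rank = Finset.range (c + 1) := by
      ext r
      simp only [Finset.mem_image, Finset.mem_range, firstOf, Finset.mem_filter]
      constructor
      · rintro ⟨i, ⟨-, hi⟩, rfl⟩; exact hi
      · intro hr
        have : r ∈ A.image rank := by rw [himg, Finset.mem_range]; omega
        obtain ⟨i, hi, rfl⟩ := Finset.mem_image.1 this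
        exact ⟨i, ⟨hi, hr⟩, rfl⟩
    rw [← Finset.card_image_of_injOn (hinj.mono (by simpa using firstOf_subset)), this,
      Finset.card_range]

-- Discarding later elements promotes nobody: all of the first `c` elements survive, and they still
-- precede any other element.
open Classical in
lemma firstOf_sdiff [IsStrictTotalOrder ι b] (hT : Disjoint T (firstOf b A c)) :
    firstOf b (A \ T) c = firstOf b A c := by
  ext i
  simp only [firstOf, Finset.mem_filter, Finset.mem_sdiff]
  constructor
  · rintro ⟨⟨hiA, hiT⟩, hi⟩
    refine ⟨hiA, ?_⟩
    by_contra! hcon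
    have hc : c ≤ A.card := hcon.trans (Finset.card_le_card (Finset.filter_subset _ _))
    have hsub : firstOf b A c ⊆ (A \ T).filter fun j => b j i := by
      intro j hj
      have hjT : j ∉ T := fun h => Finset.disjoint_left.1 hT h hj
      have hj' := Finset.mem_filter.1 hj
      refine Finset.mem_filter.2 ⟨Finset.mem_sdiff.2 ⟨hj'.1, hjT⟩, ?_⟩
      rcases trichotomous_of b j i with h | h | h
      · exact h
      · subst h; omega
      · exfalso
        have : (A.filter fun l => b l i).card ≤ (A.filter fun l => b l j).card := by
          refine Finset.card_le_card fun l hl => ?_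
          rw [Finset.mem_filter] at hl ⊢
          exact ⟨hl.1, _root_.trans hl.2 h⟩
        omega
    have := Finset.card_le_card hsub
    rw [card_firstOf hc] at this
    exact absurd (lt_of_le_of_lt this hi) (lt_irrefl _)
  · rintro ⟨hiA, hi⟩
    refine ⟨⟨hiA, fun h => Finset.disjoint_left.1 hT h (Finset.mem_filter.2 ⟨hiA, hi⟩)⟩, ?_⟩
    refine lt_of_le_of_lt (Finset.card_le_card ?_) hi
    intro j hj
    simp only [Finset.mem_filter, Finset.mem_sdiff] at hj ⊢
    exact ⟨hj.1.1, hj.2⟩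

-- Further elements can only push `t` back, because its predecessors in `insert t A` are still
-- present in `A ∪ T`.
open Classical in
lemma disjoint_firstOf_union
    (h : ∀ t ∈ T, t ∉ firstOf b (insert t A) c) : Disjoint T (firstOf b (A ∪ T) c) := by
  rw [Finset.disjoint_left]
  intro t ht hcon
  refine h t ht ?_
  simp only [firstOf, Finset.mem_filter] at hcon ⊢
  refine ⟨Finset.mem_insert_self _ _, lt_of_le_of_lt (Finset.card_le_card ?_) hcon.2⟩
  intro j hj
  simp only [Finset.mem_filter, Finset.mem_insert, Finset.mem_union] at hj ⊢
  refine ⟨?_, hj.2⟩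
  rcases hj.1 with rfl | h
  · exact Or.inr ht
  · exact Or.inl h

end Ties

/-! ### Stability of the removal procedure when samples are deleted or added. -/

section Selection

variable {ι κ : Type*} [DecidableEq ι] [DecidableEq κ] {nq : ℕ}
  {K K' : ι → Set (Fin nq → ℝ)} {J J' : (Fin nq → ℝ) → ℝ} {A B T : Finset ι}
  {b : ι → ι → Prop} {k ρ n : ℕ}

lemma essential_subset_selected : essential K J A ⊆ selected K J b A := Finset.subset_union_left

lemma selected_subset : selected K J b A ⊆ A :=
  Finset.union_subset essential_subset (firstOf_subset.trans Finset.sdiff_subset)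

lemma card_selected [IsStrictTotalOrder ι b] (hnq : 1 ≤ nq) (hK : ∀ i, Convex ℝ (K i))
    (hJ : ConvexOn ℝ Set.univ J) (hsolv : Solvable K J) (hA : nq ≤ A.card) :
    (selected K J b A).card = nq := by
  have hle := card_essential_le hnq hK hJ hsolv (A := A) (by rw [← Finset.card_pos]; omega)
  have hsd := Finset.card_sdiff_of_subset (essential_subset (K := K) (J := J) (A := A))
  rw [selected, Finset.card_union_of_disjoint, card_firstOf (by omega)]
  · omega
  · exact Finset.disjoint_of_subset_right firstOf_subset Finset.disjoint_sdiff

/-- Nondegeneracy is what keeps the essential set unchanged when inessential constraints are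
deleted; the padding is then unchanged by `firstOf_sdiff`. -/
lemma selected_sdiff [IsStrictTotalOrder ι b] (hsolv : Solvable K J) (hA : A.Nonempty)
    (h : NondegenerateOn K J A) (hT : Disjoint T (selected K J b A)) :
    selected K J b (A \ T) = selected K J b A := by
  have hS : essential K J A ⊆ A \ T := fun i hi => Finset.mem_sdiff.2 ⟨essential_subset hi,
    fun h => Finset.disjoint_left.1 hT h (essential_subset_selected hi)⟩
  obtain ⟨-, h2, -⟩ := h.restrict hS Finset.sdiff_subset hA hsolv
  rw [selected, selected, h2, sdiff_right_comm, firstOf_sdiff]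
  exact Finset.disjoint_of_subset_right Finset.subset_union_right hT

lemma isArgmin_union (hsolv : Solvable K J) (hA : A.Nonempty)
    (h : ∀ t ∈ T, argmin K J A ∈ K t) : IsArgmin K J (A ∪ T) (argmin K J A) :=
  (hsolv.isArgmin hA).mono Finset.subset_union_left fun i hi => by
    rcases Finset.mem_union.1 hi with hi | hi
    · exact (hsolv.isArgmin hA).1 i hi
    · exact h i hi

lemma essential_union_subset (hsolv : Solvable K J) (hA : A.Nonempty)
    (h : ∀ t ∈ T, argmin K J A ∈ K t) : essential K J (A ∪ T) ⊆ A := by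
  have h1 := isArgmin_union hsolv hA h
  refine essential_subset_of_isArgmin (by rwa [h1.argmin_eq]) Finset.subset_union_left ?_
  rw [h1.argmin_eq]
  exact hsolv.isArgmin hA

/-- Passage from single fresh constraints to all of them at once. Each `t` is satisfied by the
minimizer over `A`, so this minimizer survives the addition of all of `T`. By nondegeneracy the
systems `A`, `insert t A` and `A ∪ T` have the same essential set, and adding the rest of `T` only
pushes `t` back in the order used for padding. -/
lemma disjoint_selected_union (hsolv : Solvable K J) (hA : A.Nonempty)
    (hTA : Disjoint T A) (hU : NondegenerateOn K J (A ∪ T))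
    (hI : ∀ t ∈ T, NondegenerateOn K J (insert t A))
    (h : ∀ t ∈ T, t ∉ selected K J b (insert t A)) : Disjoint T (selected K J b (A ∪ T)) := by
  have hnot : ∀ t ∈ T, t ∉ A := fun t ht => Finset.disjoint_left.1 hTA ht
  have hess : ∀ t ∈ T, t ∉ essential K J (insert t A) := fun t ht hcon =>
    h t ht (essential_subset_selected hcon)
  have hmem : ∀ t ∈ T, argmin K J A ∈ K t := fun t ht =>
    mem_of_notMem_essential (hnot t ht) hsolv (hess t ht)
  have hsub := essential_union_subset hsolv hA hmem
  have hSU := (hU.restrict hsub Finset.subset_union_left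
    (hA.mono Finset.subset_union_left) hsolv).2.1
  have hSI : ∀ t ∈ T, essential K J A = essential K J (insert t A) := by
    intro t ht
    refine ((hI t ht).restrict (fun i hi => ?_) (Finset.subset_insert _ _)
      (Finset.insert_nonempty _ _) hsolv).2.1
    rcases Finset.mem_insert.1 (essential_subset hi) with rfl | h
    · exact absurd hi (hess _ ht)
    · exact h
  have hS : essential K J A ⊆ A := essential_subset
  rw [selected, ← hSU, Finset.disjoint_union_right]
  refine ⟨hTA.mono_right hS, ?_⟩
  have : (A ∪ T) \ essential K J A = (A \ essential K J A) ∪ T := by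
    rw [Finset.union_sdiff_distrib, (hTA.mono_right hS).sdiff_eq_left]
  rw [this]
  refine disjoint_firstOf_union fun t ht hcon => h t ht ?_
  rw [selected, ← hSI t ht, Finset.insert_sdiff_of_notMem _ fun h => hnot t ht (hS h)]
  exact Finset.mem_union_right _ hcon

lemma removed_subset : ∀ k, removed K J b A k ⊆ A
  | 0 => Finset.empty_subset _
  | k + 1 => Finset.union_subset (removed_subset k) (selected_subset.trans Finset.sdiff_subset)

lemma removed_mono {j k : ℕ} (h : j ≤ k) : removed K J b A j ⊆ removed K J b A k := by
  induction h with
  | refl => exact Finset.Subset.refl _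
  | step _ ih => exact ih.trans Finset.subset_union_left

lemma card_removed [IsStrictTotalOrder ι b] (hnq : 1 ≤ nq) (hK : ∀ i, Convex ℝ (K i))
    (hJ : ConvexOn ℝ Set.univ J) (hsolv : Solvable K J) (hA : k * nq ≤ A.card) :
    (removed K J b A k).card = k * nq := by
  induction k with
  | zero => simp [removed]
  | succ k ih =>
    have h1 : (k + 1) * nq = k * nq + nq := by ring
    have ih := ih (by omega)
    have hsd := Finset.card_sdiff_of_subset (removed_subset (K := K) (J := J) (A := A) (b := b) k)
    rw [removed, Finset.card_union_of_disjoint, ih, card_selected hnq hK hJ hsolv (by omega), h1]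
    exact Finset.disjoint_of_subset_right selected_subset Finset.disjoint_sdiff

lemma card_sdiff_removed [IsStrictTotalOrder ι b] (hnq : 1 ≤ nq) (hK : ∀ i, Convex ℝ (K i))
    (hJ : ConvexOn ℝ Set.univ J) (hsolv : Solvable K J) (hA : k * nq ≤ A.card) :
    (A \ removed K J b A k).card = A.card - k * nq := by
  rw [Finset.card_sdiff_of_subset (removed_subset k), card_removed hnq hK hJ hsolv hA]

lemma removed_sdiff [IsStrictTotalOrder ι b] (hnq : 1 ≤ nq) (hK : ∀ i, Convex ℝ (K i))
    (hJ : ConvexOn ℝ Set.univ J) (hsolv : Solvable K J) (hA : k * nq ≤ A.card)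
    (h : ∀ j < k, NondegenerateOn K J (A \ removed K J b A j))
    (hT : Disjoint T (removed K J b A k)) :
    removed K J b (A \ T) k = removed K J b A k := by
  induction k with
  | zero => rfl
  | succ k ih =>
    have h1 : (k + 1) * nq = k * nq + nq := by ring
    rw [removed, Finset.disjoint_union_right] at hT
    have ih := ih (by omega) (fun j hj => h j (by omega)) hT.1
    have hne : (A \ removed K J b A k).Nonempty := by
      rw [← Finset.card_pos, card_sdiff_removed hnq hK hJ hsolv (by omega)]; omega
    rw [removed, removed, ih, sdiff_right_comm, selected_sdiff hsolv hne (h k (by omega)) hT.2]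

/-- This is `removed_sdiff` read backwards, with `T` as the fresh elements. -/
lemma removed_union [IsStrictTotalOrder ι b] (hnq : 1 ≤ nq) (hK : ∀ i, Convex ℝ (K i))
    (hJ : ConvexOn ℝ Set.univ J) (hsolv : Solvable K J) (hA : k * nq ≤ A.card)
    (hTA : Disjoint T A) (h : ∀ j < k, NondegenerateOn K J ((A ∪ T) \ removed K J b (A ∪ T) j))
    (hT : Disjoint T (removed K J b (A ∪ T) k)) :
    removed K J b (A ∪ T) k = removed K J b A k := by
  have := removed_sdiff hnq hK hJ hsolv
    (hA.trans (Finset.card_le_card Finset.subset_union_left)) h hT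
  rw [← this, Finset.union_sdiff_cancel_right hTA.symm]

lemma union_sdiff_of_disjoint_right {R : Finset ι} (h : Disjoint T R) :
    (A ∪ T) \ R = A \ R ∪ T := by
  rw [Finset.union_sdiff_distrib, h.sdiff_eq_left]

/-- Round by round: as long as no fresh element has been removed, the removed sets of `A`, `A ∪ {t}`
and `A ∪ T` coincide, so `disjoint_selected_union` applies to what remains. -/
lemma disjoint_removed_union [IsStrictTotalOrder ι b] (hnq : 1 ≤ nq) (hK : ∀ i, Convex ℝ (K i))
    (hJ : ConvexOn ℝ Set.univ J) (hsolv : Solvable K J) (hA : k * nq ≤ A.card)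
    (hTA : Disjoint T A) (hU : ∀ j < k, NondegenerateOn K J ((A ∪ T) \ removed K J b (A ∪ T) j))
    (hI : ∀ t ∈ T, ∀ j < k, NondegenerateOn K J ((A ∪ {t}) \ removed K J b (A ∪ {t}) j))
    (h : ∀ t ∈ T, t ∉ removed K J b (A ∪ {t}) k) : Disjoint T (removed K J b (A ∪ T) k) := by
  induction k with
  | zero => simp [removed]
  | succ k ih =>
    have h1 : (k + 1) * nq = k * nq + nq := by ring
    have hI' : ∀ t ∈ T, ∀ j < k,
        NondegenerateOn K J ((A ∪ {t}) \ removed K J b (A ∪ {t}) j) :=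
      fun t ht j hj => hI t ht j (by omega)
    have hT := ih (by omega) (fun j hj => hU j (by omega)) hI'
      fun t ht hcon => h t ht (removed_mono (Nat.le_succ k) hcon)
    have htA : ∀ t ∈ T, Disjoint {t} A := fun t ht =>
      hTA.mono_left (Finset.singleton_subset_iff.2 ht)
    have hRU := removed_union hnq hK hJ hsolv (by omega) hTA (fun j hj => hU j (by omega)) hT
    have hdt : ∀ t ∈ T, Disjoint {t} (removed K J b (A ∪ {t}) k) := fun t ht =>
      Finset.disjoint_singleton_left.2 fun hcon => h t ht (removed_mono (Nat.le_succ k) hcon)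
    have hRI : ∀ t ∈ T, removed K J b (A ∪ {t}) k = removed K J b A k := fun t ht =>
      removed_union hnq hK hJ hsolv (by omega) (htA t ht) (hI' t ht) (hdt t ht)
    have hUk := hU k (by omega)
    rw [removed, Finset.disjoint_union_right]
    refine ⟨hT, ?_⟩
    rw [hRU] at hT hUk ⊢
    rw [union_sdiff_of_disjoint_right hT] at hUk ⊢
    have hins : ∀ t ∈ T, (A ∪ {t}) \ removed K J b (A ∪ {t}) k
        = insert t (A \ removed K J b A k) := by
      intro t ht
      have := hdt t ht
      rw [hRI t ht] at this ⊢
      rw [union_sdiff_of_disjoint_right this, Finset.union_comm, Finset.insert_eq]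
    refine disjoint_selected_union hsolv ?_ (hTA.mono_right Finset.sdiff_subset) hUk ?_ ?_
    · rw [← Finset.card_pos, card_sdiff_removed hnq hK hJ hsolv (by omega)]; omega
    · intro t ht
      rw [← hins t ht]
      exact hI t ht k (by omega)
    · intro t ht hcon
      refine h t ht (Finset.mem_union_right _ ?_)
      rwa [hins t ht]

/-- Nondegeneracy of the stages before the last one passes to larger systems. -/
lemma nondegenerateOn_of_card_le [IsStrictTotalOrder ι b] (hnq : 1 ≤ nq)
    (hK : ∀ i, Convex ℝ (K i)) (hJ : ConvexOn ℝ Set.univ J) (hsolv : Solvable K J)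
    (hn : (ρ + 1) * nq ≤ n)
    (h : ∀ A : Finset ι, A.card = n → ∀ k < ρ, NondegenerateOn K J (A \ removed K J b A k))
    (hA : n ≤ A.card) (hk : k < ρ) : NondegenerateOn K J (A \ removed K J b A k) := by
  obtain ⟨N, hN⟩ : ∃ N, N = A.card := ⟨_, rfl⟩
  induction N generalizing A k with
  | zero => exact h A (by omega) k hk
  | succ N ih =>
    rcases hA.eq_or_lt with hA | hA
    · exact h A hA.symm k hk
    -- The inner induction over the stages is needed because the earlier stages must be
    -- nondegenerate for the removal of `i` to leave the removed set unchanged.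
    induction k using Nat.strong_induction_on with
    | _ k ihk =>
      -- Here `k < ρ` enters: stage `k` still has more than `2 * nq` constraints. At stage `ρ` this
      -- may fail.
      have hle : (k + 2) * nq ≤ n := (Nat.mul_le_mul_right nq (by omega)).trans hn
      have h2 : (k + 2) * nq = k * nq + 2 * nq := by ring
      refine nondegenerateOn_of_erase hnq hK hJ hsolv ?_ fun i hi => ?_
      · rw [card_sdiff_removed hnq hK hJ hsolv (by omega)]; omega
      · have hi' := Finset.mem_sdiff.1 hi
        have hR := removed_sdiff hnq hK hJ hsolv (T := {i}) (k := k) (A := A) (b := b) (by omega)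
          (fun j hj => ihk j hj (by omega)) (Finset.disjoint_singleton_left.2 hi'.2)
        have hc := Finset.card_erase_of_mem hi'.1
        have := ih (A := A.erase i) (by omega) hk (by omega)
        rw [← Finset.sdiff_singleton_eq_erase] at this ⊢
        rwa [hR, sdiff_right_comm] at this

open Classical in
/-- Leave-one-out count: few constraints are violated when they are left out. -/
lemma card_violated_le [Fintype ι] [IsStrictTotalOrder ι b] (hnq : 1 ≤ nq)
    (hK : ∀ i, Convex ℝ (K i)) (hJ : ConvexOn ℝ Set.univ J) (hsolv : Solvable K J)
    (hn : (ρ + 1) * nq < Fintype.card ι)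
    (h : ∀ i, ∀ k < ρ, NondegenerateOn K J (Finset.univ.erase i \
      removed K J b (Finset.univ.erase i) k)) :
    (Finset.univ.filter fun i => argmin K J (Finset.univ.erase i \
      removed K J b (Finset.univ.erase i) ρ) ∉ K i).card ≤ (ρ + 1) * nq := by
  have hnd : ∀ k < ρ, NondegenerateOn K J (Finset.univ \ removed K J b Finset.univ k) := by
    intro k hk
    refine nondegenerateOn_of_card_le hnq hK hJ hsolv (n := Fintype.card ι - 1) (by omega)
      (fun A hA k hk => ?_) (by simp) hk
    obtain ⟨i, hi⟩ : ∃ i, i ∉ A := by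
      by_contra! hcon
      have : A = Finset.univ := Finset.eq_univ_iff_forall.2 hcon
      rw [this, Finset.card_univ] at hA; omega
    have : A = Finset.univ.erase i := by
      refine Finset.eq_of_subset_of_card_le (fun j hj => ?_) ?_
      · exact Finset.mem_erase.2 ⟨fun h => hi (h ▸ hj), Finset.mem_univ _⟩
      · rw [Finset.card_erase_of_mem (Finset.mem_univ _), Finset.card_univ, hA]
    rw [this]; exact h i k hk
  have h1 : (ρ + 1) * nq = ρ * nq + nq := by ring
  set R := removed K J b Finset.univ ρ with hR
  have hRc : R.card = ρ * nq := card_removed hnq hK hJ hsolv (by rw [Finset.card_univ]; omega)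
  have hAc : (Finset.univ \ R).card = Fintype.card ι - ρ * nq := by
    rw [hR, card_sdiff_removed hnq hK hJ hsolv (by rw [Finset.card_univ]; omega), Finset.card_univ]
  have hE := card_essential_le hnq hK hJ hsolv (A := Finset.univ \ R)
    (by rw [← Finset.card_pos]; omega)
  -- A violated index was removed in the full run or is essential at its last stage. Otherwise
  -- leaving it out changes neither the removals nor the last minimizer. The last stage need not be
  -- nondegenerate here, since only the size of its essential set is used.
  refine (Finset.card_le_card (t := R ∪ essential K J (Finset.univ \ R)) fun i hi => ?_).trans
    ((Finset.card_union_le _ _).trans (by omega))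
  by_contra hcon
  rw [Finset.mem_union, not_or] at hcon
  refine (Finset.mem_filter.1 hi).2 ?_
  have hRi := removed_sdiff hnq hK hJ hsolv (T := {i}) (k := ρ) (b := b)
    (by rw [Finset.card_univ]; omega) hnd (Finset.disjoint_singleton_left.2 hcon.1)
  rw [Finset.sdiff_singleton_eq_erase] at hRi
  rw [hRi, ← Finset.sdiff_singleton_eq_erase, sdiff_right_comm, Finset.sdiff_singleton_eq_erase]
  have hmem : i ∈ Finset.univ \ R := Finset.mem_sdiff.2 ⟨Finset.mem_univ _, hcon.1⟩
  refine mem_of_notMem_essential (Finset.notMem_erase _ _) hsolv ?_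
  rw [Finset.insert_erase hmem]
  exact hcon.2

/-- The constraints removed in `ρ` rounds together with those selected in a last round with respect
to another system. -/
noncomputable def compression (K K' : ι → Set (Fin nq → ℝ)) (J J' : (Fin nq → ℝ) → ℝ)
    (b : ι → ι → Prop) (ρ : ℕ) (A : Finset ι) : Finset ι :=
  removed K J b A ρ ∪ selected K' J' b (A \ removed K J b A ρ)

lemma card_compression [IsStrictTotalOrder ι b] (hnq : 1 ≤ nq) (hK : ∀ i, Convex ℝ (K i))
    (hJ : ConvexOn ℝ Set.univ J) (hsolv : Solvable K J) (hK' : ∀ i, Convex ℝ (K' i))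
    (hJ' : ConvexOn ℝ Set.univ J') (hsolv' : Solvable K' J') (hA : (ρ + 1) * nq ≤ A.card) :
    (compression K K' J J' b ρ A).card = (ρ + 1) * nq := by
  have h1 : (ρ + 1) * nq = ρ * nq + nq := by ring
  rw [compression, Finset.card_union_of_disjoint, card_removed hnq hK hJ hsolv (by omega),
    card_selected hnq hK' hJ' hsolv', h1]
  · rw [card_sdiff_removed hnq hK hJ hsolv (by omega)]; omega
  · exact Finset.disjoint_of_subset_right selected_subset Finset.disjoint_sdiff

/-- This makes the events "`t` is unselected" for different fresh `t` combine into one event for the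
joint system, which is what the moment computation needs. Left to right is stability under the
deletion of `T \ {t}`; right to left is the passage from single elements to all of `T`. The last
round may use another system because only its own nondegeneracy matters. -/
lemma disjoint_compression_iff [IsStrictTotalOrder ι b] (hnq : 1 ≤ nq) (hK : ∀ i, Convex ℝ (K i))
    (hJ : ConvexOn ℝ Set.univ J) (hsolv : Solvable K J) (hsolv' : Solvable K' J')
    (hA : (ρ + 1) * nq ≤ A.card) (hTA : Disjoint T A)
    (hE : ∀ B : Finset ι, A.card ≤ B.card → ∀ k < ρ, NondegenerateOn K J (B \ removed K J b B k))
    (hL : ∀ B : Finset ι, B.Nonempty → NondegenerateOn K' J' B) :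
    Disjoint T (compression K K' J J' b ρ (A ∪ T)) ↔
      ∀ t ∈ T, t ∉ compression K K' J J' b ρ (A ∪ {t}) := by
  have h1 : (ρ + 1) * nq = ρ * nq + nq := by ring
  have hne : (A \ removed K J b A ρ).Nonempty := by
    rw [← Finset.card_pos, card_sdiff_removed hnq hK hJ hsolv (by omega)]; omega
  have hU := hE (A ∪ T) (Finset.card_le_card Finset.subset_union_left)
  have hI := fun t : ι => hE (A ∪ {t}) (Finset.card_le_card Finset.subset_union_left)
  have htA : ∀ t ∈ T, Disjoint {t} A := fun t ht =>
    hTA.mono_left (Finset.singleton_subset_iff.2 ht)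
  have hsub : ∀ T' : Finset ι, Disjoint T' A → Disjoint T' (removed K J b (A ∪ T') ρ) →
      removed K J b (A ∪ T') ρ = removed K J b A ρ ∧
        (A ∪ T') \ removed K J b (A ∪ T') ρ = A \ removed K J b A ρ ∪ T' := by
    intro T' hT' hd
    have := removed_union hnq hK hJ hsolv (by omega) hT'
      (hE (A ∪ T') (Finset.card_le_card Finset.subset_union_left)) hd
    rw [this] at hd ⊢
    exact ⟨rfl, union_sdiff_of_disjoint_right hd⟩
  constructor
  · intro hd t ht
    rw [compression, Finset.disjoint_union_right] at hd
    obtain ⟨hR, hRd⟩ := hsub T hTA hd.1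
    rw [hRd] at hd
    have hT' : T \ {t} ∪ {t} = T := Finset.sdiff_union_of_subset (Finset.singleton_subset_iff.2 ht)
    have hRt : removed K J b (A ∪ {t}) ρ = removed K J b A ρ := by
      have := removed_sdiff hnq hK hJ hsolv (T := T \ {t}) (k := ρ) (A := A ∪ T) (b := b)
        (by have := Finset.card_le_card (Finset.subset_union_left (s₁ := A) (s₂ := T)); omega)
        hU (hd.1.mono_left Finset.sdiff_subset)
      rw [hR] at this
      rw [← this]
      congr 1
      ext i
      have hdi : i ∈ T → i ∉ A := fun h => Finset.disjoint_left.1 hTA h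
      simp only [Finset.mem_union, Finset.mem_singleton, Finset.mem_sdiff]
      grind
    have htR : t ∉ removed K J b A ρ := fun h =>
      (Finset.disjoint_left.1 hTA ht) (removed_subset ρ h)
    rw [compression, hRt, Finset.mem_union, not_or]
    refine ⟨htR, ?_⟩
    rw [union_sdiff_of_disjoint_right (Finset.disjoint_singleton_left.2 htR)]
    have := selected_sdiff (b := b) hsolv' (hne.mono Finset.subset_union_left)
      (hL (A \ removed K J b A ρ ∪ T) (hne.mono Finset.subset_union_left)) (T := T \ {t})
      (hd.2.mono_left Finset.sdiff_subset)
    have heq : (A \ removed K J b A ρ ∪ T) \ (T \ {t}) = A \ removed K J b A ρ ∪ {t} := by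
      ext i
      have hdi : i ∈ T → i ∉ A := fun h => Finset.disjoint_left.1 hTA h
      simp only [Finset.mem_union, Finset.mem_singleton, Finset.mem_sdiff]
      grind
    rw [heq] at this
    rw [this]
    exact Finset.disjoint_left.1 hd.2 ht
  · intro h
    have hd : Disjoint T (removed K J b (A ∪ T) ρ) := by
      refine disjoint_removed_union hnq hK hJ hsolv (by omega) hTA hU (fun t _ => hI t) ?_
      exact fun t ht hcon => h t ht (Finset.mem_union_left _ hcon)
    obtain ⟨-, hRd⟩ := hsub T hTA hd
    rw [compression, Finset.disjoint_union_right]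
    refine ⟨hd, ?_⟩
    rw [hRd]
    have hins : ∀ t ∈ T, (A ∪ {t}) \ removed K J b (A ∪ {t}) ρ =
        insert t (A \ removed K J b A ρ) := by
      intro t ht
      rw [(hsub {t} (htA t ht) (Finset.disjoint_singleton_left.2
        fun hcon => h t ht (Finset.mem_union_left _ hcon))).2, Finset.union_comm, Finset.insert_eq]
    refine disjoint_selected_union hsolv' hne (hTA.mono_right Finset.sdiff_subset)
      (hL _ (hne.mono Finset.subset_union_left)) (fun t _ => hL _ (Finset.insert_nonempty _ _)) ?_
    intro t ht hcon
    refine h t ht (Finset.mem_union_right _ ?_)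
    rwa [hins t ht]

/-- If `t` is unselected, the first `ρ` rounds are the same with and without it, and then it is
inessential in the last program. The last program may be degenerate. -/
lemma mem_of_notMem_compression [IsStrictTotalOrder ι b] (hnq : 1 ≤ nq)
    (hK : ∀ i, Convex ℝ (K i)) (hJ : ConvexOn ℝ Set.univ J) (hsolv : Solvable K J)
    (hsolv' : Solvable K' J') (hA : (ρ + 1) * nq ≤ A.card) {t : ι} (htA : t ∉ A)
    (hE : ∀ k < ρ, NondegenerateOn K J ((A ∪ {t}) \ removed K J b (A ∪ {t}) k))
    (h : t ∉ compression K K' J J' b ρ (A ∪ {t})) :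
    argmin K' J' (A \ removed K J b A ρ) ∈ K' t := by
  have h1 : (ρ + 1) * nq = ρ * nq + nq := by ring
  rw [compression, Finset.mem_union, not_or] at h
  have hR := removed_union hnq hK hJ hsolv (by omega) (Finset.disjoint_singleton_left.2 htA) hE
    (Finset.disjoint_singleton_left.2 h.1)
  rw [hR] at h
  rw [union_sdiff_of_disjoint_right (Finset.disjoint_singleton_left.2 h.1)] at h
  refine mem_of_notMem_essential (fun h => htA (Finset.mem_sdiff.1 h).1) hsolv' fun hcon => h.2 ?_
  rw [Finset.union_comm, ← Finset.insert_eq]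
  exact essential_subset_selected hcon

end Selection

/-! ### Full support and the violation condition. -/

section FullSupport

variable {ι κ : Type*} [DecidableEq ι] [DecidableEq κ] {nq : ℕ}
  {K : ι → Set (Fin nq → ℝ)} {J : (Fin nq → ℝ) → ℝ} {A B T : Finset ι}
  {b b' : ι → ι → Prop} {k ρ n : ℕ}

/-- A basis contains the essential set and has at most `nq` elements, so the two coincide. -/
lemma nondegenerateOn_of_card_essential (hnq : 1 ≤ nq) (hK : ∀ i, Convex ℝ (K i))
    (hJ : ConvexOn ℝ Set.univ J) (hsolv : Solvable K J) (hA : A.Nonempty)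
    (h : (essential K J A).card = nq) : NondegenerateOn K J A := by
  obtain ⟨I, hIA, hc, hI, -⟩ := exists_basis hnq hK hJ hsolv (hsolv.isArgmin hA)
  have hsub := essential_subset_of_isArgmin (hsolv.isArgmin hA) hIA hI
  rw [NondegenerateOn, Finset.eq_of_subset_of_card_le hsub (by omega)]
  exact hI

lemma selected_eq_essential (h : (essential K J A).card = nq) :
    selected K J b A = essential K J A := by
  rw [selected, h, Nat.sub_self, firstOf_zero, Finset.union_empty]

/-- Under full support, the removal does not depend on the tie-breaking. -/
lemma removed_fullSupport (h : ∀ B : Finset ι, nq < B.card → (essential K J B).card = nq)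
    (hA : k * nq < A.card) :
    (removed K J b A k).card = k * nq ∧ removed K J b A k = removed K J b' A k := by
  induction k with
  | zero => simp [removed]
  | succ k ih =>
    have h1 : (k + 1) * nq = k * nq + nq := by ring
    obtain ⟨ih1, ih2⟩ := ih (by omega)
    have hc := Finset.card_sdiff_of_subset (removed_subset (K := K) (J := J) (A := A) (b := b) k)
    have hE := h (A \ removed K J b A k) (by omega)
    refine ⟨?_, ?_⟩
    · rw [removed, selected_eq_essential hE, Finset.card_union_of_disjoint, ih1, hE, h1]
      exact Finset.disjoint_of_subset_right essential_subset Finset.disjoint_sdiff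
    · rw [removed, removed, ← ih2, selected_eq_essential hE, selected_eq_essential hE]

lemma essential_subset_removed : essential K J (A \ removed K J b A k) ⊆ removed K J b A (k + 1) :=
  essential_subset_selected.trans Finset.subset_union_right

/-- Under full support and the violation condition, fresh constraints are satisfied at the last
stage if and only if they are not among the selected ones. -/
lemma forall_mem_iff_disjoint_removed [IsStrictTotalOrder ι b] (hnq : 1 ≤ nq)
    (hK : ∀ i, Convex ℝ (K i)) (hJ : ConvexOn ℝ Set.univ J) (hsolv : Solvable K J)
    (hA : (ρ + 1) * nq ≤ A.card) (hTA : Disjoint T A) (hT : T.Nonempty)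
    (hF : ∀ B : Finset ι, nq < B.card → (essential K J B).card = nq)
    (hV : ∀ k ≤ ρ, ∀ i ∈ essential K J ((A ∪ T) \ removed K J b (A ∪ T) k), ∀ B ⊆ A ∪ T,
      i ∉ B → (∀ j < k, Disjoint B (essential K J ((A ∪ T) \ removed K J b (A ∪ T) j))) →
        B.card = nq → argmin K J B ∉ K i) :
    (∀ t ∈ T, argmin K J (A \ removed K J b A ρ) ∈ K t) ↔
      Disjoint T (removed K J b (A ∪ T) (ρ + 1)) := by
  have h1 : (ρ + 1) * nq = ρ * nq + nq := by ring
  have hc := Finset.card_union_of_disjoint hTA.symm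
  have hTc := hT.card_pos
  have hle : ∀ k ≤ ρ, k * nq ≤ ρ * nq := fun k hk => Nat.mul_le_mul_right nq hk
  have hcard : ∀ k ≤ ρ, nq < ((A ∪ T) \ removed K J b (A ∪ T) k).card := by
    intro k hk
    have := hle k hk
    rw [card_sdiff_removed hnq hK hJ hsolv (by omega)]; omega
  have hU : ∀ k ≤ ρ, NondegenerateOn K J ((A ∪ T) \ removed K J b (A ∪ T) k) := fun k hk =>
    nondegenerateOn_of_card_essential hnq hK hJ hsolv
      (by rw [← Finset.card_pos]; have := hcard k hk; omega) (hF _ (hcard k hk))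
  have hcardA : (A \ removed K J b A ρ).card = A.card - ρ * nq :=
    card_sdiff_removed hnq hK hJ hsolv (by omega)
  have hne : (A \ removed K J b A ρ).Nonempty := by rw [← Finset.card_pos]; omega
  constructor
  · intro h
    -- the first stage at which a fresh constraint is selected
    have key : ∀ k ≤ ρ + 1, Disjoint T (removed K J b (A ∪ T) k) := by
      intro k
      induction k with
      | zero => simp [removed]
      | succ k ih =>
        intro hk
        have hd := ih (by omega)
        rw [removed, Finset.disjoint_union_right]
        refine ⟨hd, ?_⟩
        rw [selected_eq_essential (hF _ (hcard k (by omega))), Finset.disjoint_left]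
        intro t ht hcon
        have hlek := hle k (by omega)
        have hR := removed_union hnq hK hJ hsolv (by omega) hTA (fun j hj => hU j (by omega)) hd
        -- Suppose that `t` is essential at stage `k`. A basis of the last program over `A`, padded
        -- to `nq` remaining samples, has the final parameter as its optimizer. These samples avoid
        -- the supports of the earlier stages, since the removals of `A ∪ T` and `A` agree so far.
        -- By the violation condition the final parameter violates `t`, contrary to `h`.
        obtain ⟨I, hIA, hIc, hI, -⟩ := exists_basis hnq hK hJ hsolv (hsolv.isArgmin hne)
        obtain ⟨B, hIB, hBA, hBc⟩ := Finset.exists_subsuperset_card_eq hIA hIc (by omega)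
        have hB := hI.mono hIB fun i hi => (hsolv.isArgmin hne).1 i (hBA hi)
        refine hV k (by omega) t hcon B ?_ ?_ ?_ hBc ?_
        · exact hBA.trans (Finset.sdiff_subset.trans Finset.subset_union_left)
        · exact fun hBt => Finset.disjoint_left.1 hTA ht (Finset.mem_sdiff.1 (hBA hBt)).1
        · intro j hj
          refine Finset.disjoint_of_subset_left hBA ?_
          refine Finset.disjoint_of_subset_right essential_subset_removed ?_
          refine Finset.disjoint_of_subset_right (removed_mono (Nat.succ_le_of_lt hj)) ?_
          rw [hR]
          exact Finset.disjoint_of_subset_right (removed_mono (by omega : k ≤ ρ))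
            Finset.sdiff_disjoint
        · rw [hB.argmin_eq]; exact h t ht
    exact key (ρ + 1) le_rfl
  · intro hd t ht
    rw [removed, Finset.disjoint_union_right] at hd
    have hR := removed_union hnq hK hJ hsolv (by omega) hTA (fun j hj => hU j (by omega)) hd.1
    have hnd := hU ρ le_rfl
    rw [hR] at hd hnd
    rw [union_sdiff_of_disjoint_right hd.1] at hd hnd
    -- No fresh constraint is essential at stage `ρ`, so by nondegeneracy dropping all of `T` does
    -- not move the minimizer.
    have hS : essential K J (A \ removed K J b A ρ ∪ T) ⊆ A \ removed K J b A ρ := by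
      intro i hi
      rcases Finset.mem_union.1 (essential_subset hi) with h | h
      · exact h
      · exact absurd (essential_subset_selected hi) (Finset.disjoint_left.1 hd.2 h)
    have hne' := hne.mono (Finset.subset_union_left (s₂ := T))
    obtain ⟨hq, -, -⟩ := hnd.restrict hS Finset.subset_union_left hne' hsolv
    rw [hq]
    exact (hsolv.isArgmin hne').1 t (Finset.mem_union_right _ ht)

end FullSupport

/-! ### Naturality of the procedure in the index set. -/

section Map

variable {ι κ : Type*} [DecidableEq ι] [DecidableEq κ] {nq : ℕ}
  (K : ι → Set (Fin nq → ℝ)) (J : (Fin nq → ℝ) → ℝ) (b : ι → ι → Prop) (e : κ ↪ ι)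
  (A : Finset κ)

/-- The lemmas of this section serve three purposes: equivariance under permutations, restriction to
subfamilies of the samples, and runs that leave one sample out. -/
lemma isArgmin_map {q : Fin nq → ℝ} :
    IsArgmin K J (A.map e) q ↔ IsArgmin (fun i => K (e i)) J A q := by
  simp [IsArgmin]

lemma argmin_map : argmin K J (A.map e) = argmin (fun i => K (e i)) J A := by
  have h : IsArgmin K J (A.map e) = IsArgmin (fun i => K (e i)) J A :=
    funext fun q => propext (isArgmin_map K J e A)
  unfold argmin
  rw [h]

lemma essential_map :
    essential K J (A.map e) = (essential (fun i => K (e i)) J A).map e := by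
  ext i
  simp only [mem_essential, Finset.mem_map]
  constructor
  · rintro ⟨⟨j, hj, rfl⟩, h⟩
    refine ⟨j, ⟨hj, ?_⟩, rfl⟩
    rwa [← Finset.map_erase, isArgmin_map, argmin_map] at h
  · rintro ⟨j, ⟨hj, h⟩, rfl⟩
    refine ⟨⟨j, hj, rfl⟩, ?_⟩
    rwa [← Finset.map_erase, isArgmin_map, argmin_map]

lemma firstOf_map (c : ℕ) :
    firstOf b (A.map e) c = (firstOf (fun i j => b (e i) (e j)) A c).map e := by
  classical
  ext i
  simp only [firstOf, Finset.mem_map, Finset.mem_filter]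
  have (j : κ) : ((A.map e).filter fun l => b l (e j)).card =
      (A.filter fun l => b (e l) (e j)).card := by
    rw [Finset.filter_map, Finset.card_map]; rfl
  constructor
  · rintro ⟨⟨j, hj, rfl⟩, h⟩
    exact ⟨j, ⟨hj, by rwa [← this]⟩, rfl⟩
  · rintro ⟨j, ⟨hj, h⟩, rfl⟩
    exact ⟨⟨j, hj, rfl⟩, by rwa [this]⟩

lemma map_sdiff' (A B : Finset κ) : (A \ B).map e = A.map e \ B.map e := by
  ext i
  simp only [Finset.mem_map, Finset.mem_sdiff]
  constructor
  · rintro ⟨j, ⟨h1, h2⟩, rfl⟩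
    exact ⟨⟨j, h1, rfl⟩, by simpa using h2⟩
  · rintro ⟨⟨j, h1, rfl⟩, h2⟩
    exact ⟨j, ⟨h1, fun h => h2 ⟨j, h, rfl⟩⟩, rfl⟩

lemma selected_map :
    selected K J b (A.map e) =
      (selected (fun i => K (e i)) J (fun i j => b (e i) (e j)) A).map e := by
  rw [selected, selected, essential_map, ← map_sdiff', firstOf_map, Finset.card_map,
    Finset.map_union]

lemma removed_map (k : ℕ) :
    removed K J b (A.map e) k =
      (removed (fun i => K (e i)) J (fun i j => b (e i) (e j)) A k).map e := by
  induction k with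
  | zero => simp [removed]
  | succ k ih => rw [removed, removed, ih, ← map_sdiff', selected_map, Finset.map_union]

lemma nondegenerateOn_map :
    NondegenerateOn K J (A.map e) ↔ NondegenerateOn (fun i => K (e i)) J A := by
  rw [NondegenerateOn, NondegenerateOn, essential_map, argmin_map, isArgmin_map]

lemma compression_map (K' : ι → Set (Fin nq → ℝ)) (J' : (Fin nq → ℝ) → ℝ) (ρ : ℕ) :
    compression K K' J J' b ρ (A.map e) =
      (compression (fun i => K (e i)) (fun i => K' (e i)) J J'
        (fun i j => b (e i) (e j)) ρ A).map e := by
  rw [compression, compression, removed_map, ← map_sdiff', selected_map, Finset.map_union]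

end Map

/-! ### The procedure of the statement as an instance of the abstract one. -/

section Frozen

variable {nx ny nq ns N : ℕ} (s : Score nx ny nq ns) (J : (Fin nq → ℝ) → ℝ)
  (tb : TieBreak nx ny) (d : Fin N → Sample nx ny) (A : Finset (Fin N))

/-- The constraint set of a sample. -/
def feasibleSet (p : Sample nx ny) : Set (Fin nq → ℝ) := {q | s p.1 p.2 q ≤ 0}

lemma isSolution_iff {q : Fin nq → ℝ} :
    IsSolution s J d A q ↔ IsArgmin (fun i => feasibleSet s (d i)) J A q := Iff.rfl

lemma optimizer_eq : optimizer s J d A = argmin (fun i => feasibleSet s (d i)) J A := rfl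

lemma support_eq : support s J d A = essential (fun i => feasibleSet s (d i)) J A := rfl

lemma discarded_eq (k : ℕ) : discarded s J tb d A k =
    removed (fun i => feasibleSet s (d i)) J (tb.Before d) A k := by
  induction k with
  | zero => rfl
  | succ k ih =>
    rw [discarded, removed, ih, support_eq, Finset.union_assoc, selected, sdiff_sdiff_left]
    rfl

lemma isStrictTotalOrder_before : IsStrictTotalOrder (Fin N) (tb.Before d) where
  trichotomous i j h1 h2 := by
    by_contra hne
    rcases tb.total (d i) (d j) with h | h
    · refine h1 ⟨h, fun h' => ?_⟩
      by_contra hlt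
      exact h2 ⟨h', fun _ => lt_of_le_of_ne (not_lt.1 hlt) (Ne.symm hne)⟩
    · refine h2 ⟨h, fun h' => ?_⟩
      by_contra hlt
      exact h1 ⟨h', fun _ => lt_of_le_of_ne (not_lt.1 hlt) hne⟩
  irrefl i h := lt_irrefl i (h.2 h.1)
  trans i j k h1 h2 := ⟨tb.trans _ _ _ h1.1 h2.1, fun h =>
    (h1.2 (tb.trans _ _ _ h2.1 h)).trans (h2.2 (tb.trans _ _ _ h h1.1))⟩

end Frozen

/-! ### Active constraints, and programs with relaxed constraints and regularized cost. -/

section Perturbation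

variable {ι : Type*} [DecidableEq ι] {nq : ℕ} {g : ι → (Fin nq → ℝ) → ℝ}
  {J : (Fin nq → ℝ) → ℝ} {A I : Finset ι} {q : Fin nq → ℝ}

lemma convexOn_finset_sum {E α : Type*} [AddCommGroup E] [Module ℝ E] {f : α → E → ℝ}
    (s : Finset α) (h : ∀ i ∈ s, ConvexOn ℝ Set.univ (f i)) :
    ConvexOn ℝ Set.univ fun x => ∑ i ∈ s, f i x := by
  classical
  induction s using Finset.induction_on with
  | empty => simpa using convexOn_const (0 : ℝ) convex_univ
  | insert a s ha ih =>
    simp only [Finset.sum_insert ha]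
    exact (h a (Finset.mem_insert_self _ _)).add
      (ih fun i hi => h i (Finset.mem_insert_of_mem hi))

lemma convexOn_max_zero {E : Type*} [AddCommGroup E] [Module ℝ E] {f : E → ℝ}
    (h : ConvexOn ℝ Set.univ f) : ConvexOn ℝ Set.univ fun x => max (f x) 0 :=
  h.sup (convexOn_const 0 convex_univ)

/-- A constraint of a minimal system is active at the minimizer. -/
lemma eq_zero_of_minimal (hg : ∀ i, ConvexOn ℝ Set.univ (g i)) (hJ : ConvexOn ℝ Set.univ J)
    (hI : IsArgmin (fun i => {q | g i q ≤ 0}) J I q) {e : ι} (he : e ∈ I)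
    (hmin : ¬ IsArgmin (fun i => {q | g i q ≤ 0}) J (I.erase e) q) : g e q = 0 := by
  refine le_antisymm (hI.1 e he) ?_
  by_contra! hlt
  rw [IsArgmin, not_and] at hmin
  have := hmin fun i hi => hI.1 i (Finset.mem_of_mem_erase hi)
  push Not at this
  obtain ⟨p, hp, hpq, hpJ⟩ := this
  -- If the constraint `e` had slack at `q`, a short step from `q` towards `p` would respect it by
  -- continuity and the others by convexity, and it would not raise the cost. This contradicts the
  -- uniqueness of `q` over `I`.
  have hcont : Continuous fun t : ℝ => g e ((1 - t) • q + t • p) :=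
    (hg e).locallyLipschitz.continuous.comp (by fun_prop)
  have hnhds : ∀ᶠ t in nhdsWithin (0 : ℝ) (Set.Ioi 0), g e ((1 - t) • q + t • p) < 0 := by
    refine (hcont.continuousAt.eventually_lt continuousAt_const ?_).filter_mono nhdsWithin_le_nhds
    simpa using hlt
  have hIoo : ∀ᶠ t in nhdsWithin (0 : ℝ) (Set.Ioi 0), t ∈ Set.Ioo (0 : ℝ) 1 :=
    Ioo_mem_nhdsGT one_pos
  obtain ⟨t, ht1, ht0, ht2⟩ := (hnhds.and hIoo).exists
  have hne : (1 - t) • q + t • p ≠ q := by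
    intro h
    have h0 : t • (p - q) = 0 := by
      have : t • (p - q) = ((1 - t) • q + t • p) - q := by module
      rw [this, h, sub_self]
    exact hpq (sub_eq_zero.1 ((smul_eq_zero.1 h0).resolve_left ht0.ne'))
  have hJlt := hI.2 _ (fun i hi => ?_) hne
  · have := hJ.2 (Set.mem_univ q) (Set.mem_univ p) (by linarith : 0 ≤ 1 - t) ht0.le (by ring)
    simp only [smul_eq_mul] at this
    nlinarith
  · by_cases hie : i = e
    · subst hie; exact ht1.le
    · have h1 := hI.1 i hi
      have h2 := hp i (Finset.mem_erase.2 ⟨hie, hi⟩)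
      have := (hg i).2 (Set.mem_univ q) (Set.mem_univ p) (by linarith : 0 ≤ 1 - t) ht0.le (by ring)
      simp only [smul_eq_mul, Set.mem_ofPred_eq] at this h1 h2 ⊢
      nlinarith

lemma convex_sublevel (hg : ∀ i, ConvexOn ℝ Set.univ (g i)) (i : ι) :
    Convex ℝ {q | g i q ≤ 0} := by
  simpa using (hg i).convex_le 0

/-- In a degenerate system, some constraint is active at the minimizer over the others. -/
lemma exists_active_of_not_nondegenerateOn (hg : ∀ i, ConvexOn ℝ Set.univ (g i))
    (hJ : ConvexOn ℝ Set.univ J) (hsolv : Solvable (fun i => {q | g i q ≤ 0}) J)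
    (hA : A.Nonempty) (h : ¬ NondegenerateOn (fun i => {q | g i q ≤ 0}) J A) :
    ∃ e ∈ A, (A.erase e).Nonempty ∧
      g e (argmin (fun i => {q | g i q ≤ 0}) J (A.erase e)) = 0 := by
  have hAq := hsolv.isArgmin hA
  obtain ⟨I, hIA, hI, hmin⟩ := exists_minimal_isArgmin hAq
  -- A constraint of a minimal basis that is not essential: dropping it from `A` keeps the
  -- minimizer, and there it is active because the basis is minimal.
  obtain ⟨e, heI, heS⟩ : ∃ e ∈ I, e ∉ essential (fun i => {q | g i q ≤ 0}) J A := by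
    by_contra! hcon
    exact h (hI.mono hcon fun i hi => hAq.1 i (essential_subset hi))
  have he : IsArgmin (fun i => {q | g i q ≤ 0}) J (A.erase e)
      (argmin (fun i => {q | g i q ≤ 0}) J A) := by
    by_contra hcon
    exact heS (mem_essential.2 ⟨hIA heI, hcon⟩)
  refine ⟨e, hIA heI, ?_, ?_⟩
  · rw [Finset.nonempty_iff_ne_empty]
    intro h0
    have hIe : I.erase e = A.erase e := by
      rw [h0, ← Finset.subset_empty, ← h0]
      exact Finset.erase_subset_erase _ hIA
    exact hmin e heI (hIe ▸ he)
  · rw [he.argmin_eq]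
    exact eq_zero_of_minimal hg hJ hI heI (hmin e heI)

/-- The cost with a quadratic regularization. -/
noncomputable def regularized (J : (Fin nq → ℝ) → ℝ) (r : ℝ) (q : Fin nq → ℝ) : ℝ :=
  J q + r * ∑ i, q i ^ 2

lemma convexOn_regularized (hJ : ConvexOn ℝ Set.univ J) {r : ℝ} (hr : 0 ≤ r) :
    ConvexOn ℝ Set.univ (regularized J r) := by
  refine hJ.add (ConvexOn.smul hr (convexOn_finset_sum _ fun i _ => ?_))
  exact (Even.convexOn_pow (𝕜 := ℝ) even_two).comp_linearMap
    (LinearMap.proj (R := ℝ) (φ := fun _ : Fin nq => ℝ) i)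

/-- The quadratic term gains `r / 4` times the squared distance at the midpoint. This gives
uniqueness of the perturbed minimizer. -/
lemma regularized_midpoint_lt (hJ : ConvexOn ℝ Set.univ J) {r : ℝ} (hr : 0 < r)
    {p q : Fin nq → ℝ} (hpq : p ≠ q) (hle : regularized J r p ≤ regularized J r q) :
    regularized J r ((1 / 2 : ℝ) • q + (1 / 2 : ℝ) • p) < regularized J r q := by
  have h1 := hJ.2 (Set.mem_univ q) (Set.mem_univ p) (by norm_num : (0 : ℝ) ≤ 1 / 2)
    (by norm_num : (0 : ℝ) ≤ 1 / 2) (by norm_num)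
  have h2 : ∑ i, ((1 / 2 : ℝ) • q + (1 / 2 : ℝ) • p) i ^ 2 =
      (1 / 2) * ∑ i, q i ^ 2 + (1 / 2) * ∑ i, p i ^ 2 - (1 / 4) * ∑ i, (q i - p i) ^ 2 := by
    simp only [Finset.mul_sum, ← Finset.sum_add_distrib, ← Finset.sum_sub_distrib]
    refine Finset.sum_congr rfl fun i _ => ?_
    simp only [Pi.add_apply, Pi.smul_apply, smul_eq_mul]
    ring
  obtain ⟨i, hi⟩ := Function.ne_iff.1 hpq
  have h3 : 0 < ∑ i, (q i - p i) ^ 2 :=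
    Finset.sum_pos' (fun i _ => sq_nonneg _) ⟨i, Finset.mem_univ _, by
      have : q i - p i ≠ 0 := fun h => hi (by linarith)
      positivity⟩
  simp only [smul_eq_mul] at h1
  simp only [regularized, h2] at hle ⊢
  nlinarith [mul_pos hr h3]

/-- The function `φ`, total violation plus excess cost, is convex and vanishes at `q`. Since `q` is
the unique minimizer, `φ` is at least some `c > 0` on the sphere of radius `δ`, by compactness;
convexity then forces linear growth outside. On the other hand `φ p ≤ r * (A.card + ∑ i, q i ^ 2)`
for the points `p` in question. The same bound yields existence of the perturbed minimizers and
their convergence. -/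
lemma exists_norm_sub_le (hg : ∀ i, ConvexOn ℝ Set.univ (g i)) (hJ : ConvexOn ℝ Set.univ J)
    (hq : IsArgmin (fun i => {q | g i q ≤ 0}) J A q) {δ : ℝ} (hδ : 0 < δ) :
    ∃ C : ℝ, ∀ r > 0, ∀ p, (∀ i ∈ A, g i p ≤ r) → regularized J r p ≤ regularized J r q →
      δ ≤ ‖p - q‖ → ‖p - q‖ ≤ C * r := by
  let φ : (Fin nq → ℝ) → ℝ := fun p => ∑ i ∈ A, max (g i p) 0 + max (J p - J q) 0
  have hφ : ConvexOn ℝ Set.univ φ :=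
    (convexOn_finset_sum _ fun i _ => convexOn_max_zero (hg i)).add
      (convexOn_max_zero (by
        simp only [sub_eq_add_neg]
        exact hJ.add (convexOn_const (-J q) convex_univ)))
  have hsum : ∀ p, 0 ≤ ∑ i ∈ A, max (g i p) 0 := fun p =>
    Finset.sum_nonneg fun i _ => le_max_right _ _
  have hφ0 : φ q = 0 := by
    have : ∑ i ∈ A, max (g i q) 0 = 0 := Finset.sum_eq_zero fun i hi => max_eq_right (hq.1 i hi)
    simp [φ, this]
  have hpos : ∀ p ∈ Metric.sphere q δ, 0 < φ p := by
    intro p hp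
    have hne : p ≠ q := by
      rintro rfl
      simp only [Metric.mem_sphere, dist_self] at hp
      exact hδ.ne hp
    by_contra! hle
    have h1 : ∑ i ∈ A, max (g i p) 0 ≤ 0 := by
      have := le_max_right (J p - J q) 0
      simp only [φ] at hle
      linarith
    have h2 : J p - J q ≤ 0 := by
      have := le_max_left (J p - J q) 0
      have := hsum p
      simp only [φ] at hle
      linarith
    refine absurd (hq.2 p (fun i hi => ?_) hne) (by linarith)
    exact (le_max_left _ _).trans
      ((Finset.single_le_sum (fun i _ => le_max_right _ _) hi).trans h1)
  obtain ⟨c, hc, hcφ⟩ := (isCompact_sphere q δ).exists_forall_le'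
    hφ.locallyLipschitz.continuous.continuousOn hpos
  refine ⟨δ * (A.card + ∑ i, q i ^ 2) / c, fun r hr p hp hJp hpδ => ?_⟩
  have hD : 0 < ‖p - q‖ := hδ.trans_le hpδ
  set t := δ / ‖p - q‖ with ht
  have ht0 : 0 < t := div_pos hδ hD
  have ht1 : t ≤ 1 := (div_le_one hD).2 hpδ
  have hmem : (1 - t) • q + t • p ∈ Metric.sphere q δ := by
    rw [mem_sphere_iff_norm]
    have : (1 - t) • q + t • p - q = t • (p - q) := by module
    rw [this, norm_smul, Real.norm_of_nonneg ht0.le, ht, div_mul_cancel₀ _ hD.ne']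
  have h1 := hcφ _ hmem
  have h2 := hφ.2 (Set.mem_univ q) (Set.mem_univ p) (by linarith : 0 ≤ 1 - t) ht0.le (by ring)
  simp only [smul_eq_mul, hφ0, mul_zero, zero_add] at h2
  have h3 : φ p ≤ r * (A.card + ∑ i, q i ^ 2) := by
    have h4 : ∑ i ∈ A, max (g i p) 0 ≤ A.card * r := by
      rw [← nsmul_eq_mul]
      exact Finset.sum_le_card_nsmul _ _ _ fun i hi => max_le (hp i hi) hr.le
    have h5 : max (J p - J q) 0 ≤ r * ∑ i, q i ^ 2 := by
      have h6 : 0 ≤ r * ∑ i, p i ^ 2 := by positivity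
      have h7 : 0 ≤ r * ∑ i, q i ^ 2 := by positivity
      refine max_le ?_ h7
      simp only [regularized] at hJp
      linarith
    calc φ p ≤ A.card * r + r * ∑ i, q i ^ 2 := add_le_add h4 h5
      _ = _ := by ring
  have h6 : c ≤ t * (r * (A.card + ∑ i, q i ^ 2)) :=
    (h1.trans h2).trans (mul_le_mul_of_nonneg_left h3 ht0.le)
  have h7 : c * ‖p - q‖ ≤ δ * (r * (A.card + ∑ i, q i ^ 2)) := by
    have := mul_le_mul_of_nonneg_right h6 hD.le
    have h8 : t * ‖p - q‖ = δ := by rw [ht, div_mul_cancel₀ _ hD.ne']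
    calc c * ‖p - q‖ ≤ t * (r * (A.card + ∑ i, q i ^ 2)) * ‖p - q‖ := this
      _ = t * ‖p - q‖ * (r * (A.card + ∑ i, q i ^ 2)) := by ring
      _ = _ := by rw [h8]
  rw [div_mul_eq_mul_div, le_div_iff₀ hc]
  linarith

/-- Relaxing the constraints and regularizing the cost keeps the program solvable. -/
lemma solvable_perturbed (hg : ∀ i, ConvexOn ℝ Set.univ (g i)) (hJ : ConvexOn ℝ Set.univ J)
    (hsolv : Solvable (fun i => {q | g i q ≤ 0}) J) {r : ℝ} (hr : 0 < r) {c : ι → ℝ}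
    (hc0 : ∀ i, 0 ≤ c i) (hcr : ∀ i, c i ≤ r) :
    Solvable (fun i => {q | g i q - c i ≤ 0}) (regularized J r) := by
  intro A hA
  have hq := hsolv.isArgmin hA
  set q := argmin (fun i => {q | g i q ≤ 0}) J A
  obtain ⟨C, hC⟩ := exists_norm_sub_le hg hJ hq one_pos
  let F : Set (Fin nq → ℝ) := {p | ∀ i ∈ A, g i p - c i ≤ 0}
  have hJc := (convexOn_regularized hJ hr.le).locallyLipschitz.continuous
  -- Feasible points at least as good as `q` lie in a fixed ball, so minimizing over that ball
  -- suffices.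
  have hbd : ∀ p ∈ F, regularized J r p ≤ regularized J r q →
      p ∈ Metric.closedBall q (max 1 (C * r)) := by
    intro p hp hle
    rw [mem_closedBall_iff_norm]
    rcases le_or_gt 1 ‖p - q‖ with h | h
    · exact (hC r hr p (fun i hi => by have := hp i hi; have := hcr i; linarith) hle h).trans
        (le_max_right _ _)
    · exact h.le.trans (le_max_left _ _)
  have hFc : IsClosed F := by
    have : F = ⋂ i ∈ A, {p | g i p - c i ≤ 0} := by ext; simp [F]
    rw [this]
    exact isClosed_biInter fun i _ => isClosed_le
      ((hg i).locallyLipschitz.continuous.sub continuous_const) continuous_const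
  have hqF : q ∈ F := fun i hi => by
    have h1 : g i q ≤ 0 := hq.1 i hi
    have := hc0 i
    linarith
  obtain ⟨p, ⟨hpF, hpB⟩, hpmin⟩ := ((isCompact_closedBall q (max 1 (C * r))).inter_left
    hFc).exists_isMinOn ⟨q, hqF, Metric.mem_closedBall_self (le_max_of_le_left zero_le_one)⟩
    hJc.continuousOn
  have hpq : regularized J r p ≤ regularized J r q :=
    hpmin ⟨hqF, Metric.mem_closedBall_self (le_max_of_le_left zero_le_one)⟩
  refine ⟨p, hpF, fun p' hp' hne => ?_⟩
  by_contra! hle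
  have hlt := regularized_midpoint_lt hJ hr hne hle
  have hmF : (1 / 2 : ℝ) • p + (1 / 2 : ℝ) • p' ∈ F := by
    intro i hi
    have h1 := (hg i).2 (Set.mem_univ p) (Set.mem_univ p') (by norm_num : (0 : ℝ) ≤ 1 / 2)
      (by norm_num : (0 : ℝ) ≤ 1 / 2) (by norm_num)
    have h2 := hpF i hi
    have h3 : g i p' - c i ≤ 0 := hp' i hi
    simp only [smul_eq_mul] at h1
    linarith
  exact absurd (hpmin ⟨hmF, hbd _ hmF (hlt.le.trans hpq)⟩) (not_le.2 hlt)

/-- The perturbed minimizers converge to the minimizer. -/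
lemma tendsto_argmin_perturbed (hg : ∀ i, ConvexOn ℝ Set.univ (g i))
    (hJ : ConvexOn ℝ Set.univ J) (hsolv : Solvable (fun i => {q | g i q ≤ 0}) J)
    (hA : A.Nonempty) {r : ℕ → ℝ} (hr : ∀ m, 0 < r m)
    (hlim : Filter.Tendsto r Filter.atTop (nhds 0)) {c : ℕ → ι → ℝ}
    (hc0 : ∀ m i, 0 ≤ c m i) (hcr : ∀ m i, c m i ≤ r m) :
    Filter.Tendsto
      (fun m => argmin (fun i => {q | g i q - c m i ≤ 0}) (regularized J (r m)) A)
      Filter.atTop (nhds (argmin (fun i => {q | g i q ≤ 0}) J A)) := by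
  have hq := hsolv.isArgmin hA
  set q := argmin (fun i => {q | g i q ≤ 0}) J A
  rw [Metric.tendsto_nhds]
  intro δ hδ
  obtain ⟨C, hC⟩ := exists_norm_sub_le hg hJ hq (half_pos hδ)
  have hCr : Filter.Tendsto (fun m => C * r m) Filter.atTop (nhds 0) := by
    simpa using hlim.const_mul C
  filter_upwards [hCr.eventually (gt_mem_nhds hδ)] with m hm
  have hp := (solvable_perturbed hg hJ hsolv (hr m) (hc0 m) (hcr m)).isArgmin hA
  set p := argmin (fun i => {q | g i q - c m i ≤ 0}) (regularized J (r m)) A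
  -- Relaxation keeps `q` feasible, so the perturbed minimizer `p` is at least as good as `q` for
  -- the perturbed cost.
  have hle : regularized J (r m) p ≤ regularized J (r m) q := by
    by_cases hpq : q = p
    · rw [hpq]
    · refine (hp.2 q (fun i hi => ?_) hpq).le
      have h1 : g i q ≤ 0 := hq.1 i hi
      have := hc0 m i
      simp only [Set.mem_ofPred_eq]
      linarith
  rw [dist_eq_norm]
  rcases le_or_gt (δ / 2) ‖p - q‖ with h | h
  · refine (hC (r m) (hr m) p (fun i hi => ?_) hle h).trans_lt hm
    have h1 : g i p - c m i ≤ 0 := hp.1 i hi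
    have := hcr m i
    linarith
  · linarith

end Perturbation

/-! ### Measurability of the minimizer and of the selected sets. -/

section Measurability

variable {D : Type*} [MeasurableSpace D] {ι : Type*} [DecidableEq ι] [Fintype ι] {nq : ℕ}

/-- On a compact set the minimum is attained, so the condition says that the infimum over a
countable dense subset is at most zero. -/
lemma measurableSet_exists_le_zero {E : Type*} [TopologicalSpace E]
    [TopologicalSpace.PseudoMetrizableSpace E] [SecondCountableTopology E]
    {f : D → E → ℝ} (hf : ∀ q, Measurable fun d => f d q) (hc : ∀ d, Continuous (f d))
    {C : Set E} (hC : IsCompact C) : MeasurableSet {d | ∃ q ∈ C, f d q ≤ 0} := by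
  obtain ⟨t, htC, htc, htd⟩ :=
    (TopologicalSpace.IsSeparable.of_separableSpace C).exists_countable_dense_subset
  have : {d | ∃ q ∈ C, f d q ≤ 0} = ⋂ m : ℕ, ⋃ q ∈ t, {d | f d q < 1 / ((m : ℝ) + 1)} := by
    ext d
    simp only [Set.mem_ofPred_eq, Set.mem_iInter, Set.mem_iUnion, exists_prop]
    constructor
    · rintro ⟨q, hq, hle⟩ m
      have hpos : (0 : ℝ) < 1 / ((m : ℝ) + 1) := by positivity
      have hopen : IsOpen {q | f d q < 1 / ((m : ℝ) + 1)} := isOpen_lt (hc d) continuous_const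
      obtain ⟨p, hp, hpt⟩ := mem_closure_iff.1 (htd hq) _ hopen (hle.trans_lt hpos)
      exact ⟨p, hpt, hp⟩
    · intro h
      obtain ⟨q, hq, -⟩ := h 0
      obtain ⟨p, hpC, hp⟩ := hC.exists_isMinOn ⟨q, htC hq⟩ (hc d).continuousOn
      refine ⟨p, hpC, ?_⟩
      by_contra! hlt
      obtain ⟨m, hm⟩ := exists_nat_one_div_lt hlt
      obtain ⟨q', hq', hlt'⟩ := h m
      have : f d p ≤ f d q' := hp (htC hq')
      linarith
  rw [this]
  exact MeasurableSet.iInter fun m => MeasurableSet.biUnion htc fun q _ =>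
    measurableSet_lt (hf q) measurable_const

variable {G : D → ι → (Fin nq → ℝ) → ℝ} {J : (Fin nq → ℝ) → ℝ}

lemma sum_max_le_zero_iff {A : Finset ι} {u : ι → ℝ} {v : ℝ} :
    ∑ i ∈ A, max (u i) 0 + max v 0 ≤ 0 ↔ (∀ i ∈ A, u i ≤ 0) ∧ v ≤ 0 := by
  have h1 : 0 ≤ ∑ i ∈ A, max (u i) 0 := Finset.sum_nonneg fun i _ => le_max_right _ _
  constructor
  · intro h
    have h2 := le_max_right v 0
    have h3 := le_max_left v 0
    refine ⟨fun i hi => ?_, by linarith⟩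
    have h4 := Finset.single_le_sum (f := fun i => max (u i) 0) (fun i _ => le_max_right _ _) hi
    have h5 := le_max_left (u i) 0
    linarith
  · rintro ⟨h2, h3⟩
    rw [Finset.sum_eq_zero fun i hi => max_eq_right (h2 i hi), max_eq_right h3, add_zero]

/-- The finitely many inequalities merge into one continuous function of `q`, and a closed set is
exhausted by its compact intersections with balls. -/
lemma measurableSet_exists_feasible (hG : ∀ i q, Measurable fun d => G d i q)
    (hGc : ∀ d i, Continuous (G d i)) (hJ : Continuous J) (A : Finset ι)
    {v : D → ℝ} (hv : Measurable v) {F : Set (Fin nq → ℝ)} (hF : IsClosed F) :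
    MeasurableSet {d | ∃ q ∈ F, (∀ i ∈ A, G d i q ≤ 0) ∧ J q ≤ v d} := by
  have : {d | ∃ q ∈ F, (∀ i ∈ A, G d i q ≤ 0) ∧ J q ≤ v d} = ⋃ R : ℕ,
      {d | ∃ q ∈ F ∩ Metric.closedBall 0 R,
        ∑ i ∈ A, max (G d i q) 0 + max (J q - v d) 0 ≤ 0} := by
    ext d
    simp only [Set.mem_ofPred_eq, Set.mem_iUnion, sum_max_le_zero_iff, sub_nonpos]
    constructor
    · rintro ⟨q, hq, h⟩
      obtain ⟨R, hR⟩ := exists_nat_ge ‖q‖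
      exact ⟨R, q, ⟨hq, by simpa using hR⟩, h⟩
    · rintro ⟨R, q, hq, h⟩
      exact ⟨q, hq.1, h⟩
  rw [this]
  refine MeasurableSet.iUnion fun R => measurableSet_exists_le_zero (fun q => ?_) (fun d => ?_)
    ((isCompact_closedBall 0 (R : ℝ)).inter_left hF)
  · exact (Finset.measurable_sum _ fun i _ => (hG i q).max measurable_const).add
      ((measurable_const.sub hv).max measurable_const)
  · exact (continuous_finsetSum _ fun i _ => (hGc d i).max continuous_const).add
      ((hJ.sub continuous_const).max continuous_const)

/-- The optimal value is measurable because its sublevel sets are feasibility events. With the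
optimal value as the bound on the cost, the only admissible point is the minimizer, so its preimages
of closed sets are feasibility events too. -/
lemma measurable_argmin (hG : ∀ i q, Measurable fun d => G d i q)
    (hGc : ∀ d i, Continuous (G d i)) (hJ : Continuous J)
    (hsolv : ∀ d, Solvable (fun i => {q | G d i q ≤ 0}) J) (A : Finset ι) :
    Measurable fun d => argmin (fun i => {q | G d i q ≤ 0}) J A := by
  -- Solvability says nothing about the empty system; there the minimizer, or the default value,
  -- does not depend on `d`.
  rcases A.eq_empty_or_nonempty with rfl | hA
  · have : ∀ d, argmin (fun i => {q | G d i q ≤ 0}) J ∅ =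
        argmin (fun _ : ι => (Set.univ : Set (Fin nq → ℝ))) J ∅ := by
      intro d
      have : IsArgmin (fun i => {q | G d i q ≤ 0}) J ∅ =
          IsArgmin (fun _ : ι => (Set.univ : Set (Fin nq → ℝ))) J ∅ := by
        funext q; simp [IsArgmin]
      unfold argmin
      rw [this]
    simp only [this]
    exact measurable_const
  have hv : Measurable fun d => J (argmin (fun i => {q | G d i q ≤ 0}) J A) := by
    refine measurable_of_Iic fun c => ?_
    convert measurableSet_exists_feasible hG hGc hJ A (measurable_const (a := c)) isClosed_univ
      using 1
    ext d
    have hd := (hsolv d).isArgmin hA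
    simp only [Set.mem_preimage, Set.mem_Iic, Set.mem_ofPred_eq, Set.mem_univ, true_and]
    constructor
    · exact fun h => ⟨_, hd.1, h⟩
    · rintro ⟨q, hq, hle⟩
      by_cases hne : q = argmin (fun i => {q | G d i q ≤ 0}) J A
      · rwa [← hne]
      · exact (hd.2 q hq hne).le.trans hle
  refine measurable_of_isClosed fun F hF => ?_
  convert measurableSet_exists_feasible hG hGc hJ A hv hF using 1
  ext d
  have hd := (hsolv d).isArgmin hA
  simp only [Set.mem_preimage, Set.mem_ofPred_eq]
  constructor
  · exact fun h => ⟨_, h, hd.1, le_rfl⟩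
  · rintro ⟨q, hqF, hq, hle⟩
    by_cases hne : q = argmin (fun i => {q | G d i q ≤ 0}) J A
    · rwa [← hne]
    · exact absurd hle (not_le.2 (hd.2 q hq hne))

/-- Measurability of a random finite set. -/
def MeasurableFinset (S : D → Finset ι) : Prop := ∀ m, MeasurableSet {d | m ∈ S d}

lemma MeasurableFinset.measurableSet_eq {S : D → Finset ι} (hS : MeasurableFinset S)
    (B : Finset ι) : MeasurableSet {d | S d = B} := by
  have : {d | S d = B} = ⋂ m, {d | m ∈ S d ↔ m ∈ B} := by
    ext d; simp [Finset.ext_iff]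
  rw [this]
  refine MeasurableSet.iInter fun m => ?_
  by_cases hm : m ∈ B
  · simpa [hm] using hS m
  · simp only [hm, iff_false]
    exact (hS m).compl

/-- A random finite set takes finitely many values, so one may argue separately for each of them. In
this way measurability passes through the successive stages. -/
lemma MeasurableFinset.bind {S : D → Finset ι} (hS : MeasurableFinset S)
    {p : Finset ι → D → Prop} (hp : ∀ B, MeasurableSet {d | p B d}) :
    MeasurableSet {d | p (S d) d} := by
  have : {d | p (S d) d} = ⋃ B, {d | S d = B} ∩ {d | p B d} := by
    ext d; simp
  rw [this]
  exact MeasurableSet.iUnion fun B => (hS.measurableSet_eq B).inter (hp B)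

lemma MeasurableFinset.comp {S : D → Finset ι} (hS : MeasurableFinset S)
    {T : Finset ι → D → Finset ι} (hT : ∀ B, MeasurableFinset (T B)) :
    MeasurableFinset fun d => T (S d) d := fun m =>
  hS.bind (p := fun B d => m ∈ T B d) fun B => hT B m

lemma measurableFinset_const (B : Finset ι) : MeasurableFinset fun _ : D => B := fun _ =>
  MeasurableSet.const _

lemma MeasurableFinset.union {S T : D → Finset ι} (hS : MeasurableFinset S)
    (hT : MeasurableFinset T) : MeasurableFinset fun d => S d ∪ T d := by
  intro m
  simp only [Finset.mem_union]
  exact (hS m).union (hT m)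

lemma measurableSet_isArgmin_argmin (hG : ∀ i q, Measurable fun d => G d i q)
    (hGc : ∀ d i, Continuous (G d i)) (hJ : Continuous J)
    (hsolv : ∀ d, Solvable (fun i => {q | G d i q ≤ 0}) J) (A B : Finset ι) :
    MeasurableSet {d | IsArgmin (fun i => {q | G d i q ≤ 0}) J B
      (argmin (fun i => {q | G d i q ≤ 0}) J A)} := by
  -- Without constraints there is at most one minimizer and it is the same for all `d`, so the event
  -- is the preimage of a subsingleton.
  rcases B.eq_empty_or_nonempty with h0 | hne
  · rw [h0]
    have hsub : {q | IsArgmin (fun _ : ι => (Set.univ : Set (Fin nq → ℝ))) J ∅ q}.Subsingleton :=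
      fun p hp q hq => IsArgmin.unique hp hq
    convert measurable_argmin hG hGc hJ hsolv A hsub.measurableSet using 1
    ext d
    simp [IsArgmin]
  · convert measurableSet_eq_fun (measurable_argmin hG hGc hJ hsolv B)
      (measurable_argmin hG hGc hJ hsolv A) using 1
    ext d
    refine ⟨fun h => IsArgmin.argmin_eq h, fun h => ?_⟩
    have h' : argmin (fun i => {q | G d i q ≤ 0}) J B =
      argmin (fun i => {q | G d i q ≤ 0}) J A := h
    simp only [Set.mem_ofPred_eq]
    rw [← h']
    exact (hsolv d).isArgmin hne

lemma measurableFinset_essential (hG : ∀ i q, Measurable fun d => G d i q)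
    (hGc : ∀ d i, Continuous (G d i)) (hJ : Continuous J)
    (hsolv : ∀ d, Solvable (fun i => {q | G d i q ≤ 0}) J) (A : Finset ι) :
    MeasurableFinset fun d => essential (fun i => {q | G d i q ≤ 0}) J A := by
  intro m
  by_cases hm : m ∈ A
  swap
  · simp [mem_essential, hm]
  simp only [mem_essential, hm, true_and]
  exact (measurableSet_isArgmin_argmin hG hGc hJ hsolv A (A.erase m)).compl

lemma measurableSet_nondegenerateOn (hG : ∀ i q, Measurable fun d => G d i q)
    (hGc : ∀ d i, Continuous (G d i)) (hJ : Continuous J)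
    (hsolv : ∀ d, Solvable (fun i => {q | G d i q ≤ 0}) J) (A : Finset ι) :
    MeasurableSet {d | NondegenerateOn (fun i => {q | G d i q ≤ 0}) J A} :=
  (measurableFinset_essential hG hGc hJ hsolv A).bind
    (p := fun B d => IsArgmin (fun i => {q | G d i q ≤ 0}) J B
      (argmin (fun i => {q | G d i q ≤ 0}) J A))
    fun B => measurableSet_isArgmin_argmin hG hGc hJ hsolv A B

variable {b : D → ι → ι → Prop}

lemma measurableFinset_firstOf (hb : ∀ i j, MeasurableSet {d | b d i j}) (A : Finset ι) (c : ℕ) :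
    MeasurableFinset fun d => firstOf (b d) A c := by
  classical
  intro m
  have hfil : MeasurableFinset fun d => A.filter fun j => b d j m := by
    intro j
    by_cases hj : j ∈ A
    · simpa [hj] using hb j m
    · simp [hj]
  have := hfil.bind (p := fun B _ => m ∈ A ∧ B.card < c) fun B => MeasurableSet.const _
  convert this using 1
  ext d
  simp only [firstOf, Finset.mem_filter, Set.mem_ofPred_eq]

lemma measurableFinset_selected (hG : ∀ i q, Measurable fun d => G d i q)
    (hGc : ∀ d i, Continuous (G d i)) (hJ : Continuous J)
    (hsolv : ∀ d, Solvable (fun i => {q | G d i q ≤ 0}) J)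
    (hb : ∀ i j, MeasurableSet {d | b d i j}) (A : Finset ι) :
    MeasurableFinset fun d => selected (fun i => {q | G d i q ≤ 0}) J (b d) A := by
  have hE := measurableFinset_essential hG hGc hJ hsolv A
  exact hE.union (hE.comp (T := fun S d => firstOf (b d) (A \ S) (nq - S.card))
    fun S => measurableFinset_firstOf hb _ _)

lemma measurableFinset_removed (hG : ∀ i q, Measurable fun d => G d i q)
    (hGc : ∀ d i, Continuous (G d i)) (hJ : Continuous J)
    (hsolv : ∀ d, Solvable (fun i => {q | G d i q ≤ 0}) J)
    (hb : ∀ i j, MeasurableSet {d | b d i j}) (A : Finset ι) (k : ℕ) :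
    MeasurableFinset fun d => removed (fun i => {q | G d i q ≤ 0}) J (b d) A k := by
  induction k with
  | zero => exact measurableFinset_const _
  | succ k ih =>
    exact ih.union (ih.comp (T := fun R d => selected (fun i => {q | G d i q ≤ 0}) J (b d) (A \ R))
      fun R => measurableFinset_selected hG hGc hJ hsolv hb _)

lemma measurableFinset_compression {G' : D → ι → (Fin nq → ℝ) → ℝ} {J' : (Fin nq → ℝ) → ℝ}
    (hG : ∀ i q, Measurable fun d => G d i q)
    (hGc : ∀ d i, Continuous (G d i)) (hJ : Continuous J)
    (hsolv : ∀ d, Solvable (fun i => {q | G d i q ≤ 0}) J)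
    (hG' : ∀ i q, Measurable fun d => G' d i q)
    (hGc' : ∀ d i, Continuous (G' d i)) (hJ' : Continuous J')
    (hsolv' : ∀ d, Solvable (fun i => {q | G' d i q ≤ 0}) J')
    (hb : ∀ i j, MeasurableSet {d | b d i j}) (A : Finset ι) (ρ : ℕ) :
    MeasurableFinset fun d => compression (fun i => {q | G d i q ≤ 0})
      (fun i => {q | G' d i q ≤ 0}) J J' (b d) ρ A := by
  have hR := measurableFinset_removed hG hGc hJ hsolv hb A ρ
  exact hR.union (hR.comp
    (T := fun R d => selected (fun i => {q | G' d i q ≤ 0}) J' (b d) (A \ R))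
    fun R => measurableFinset_selected hG' hGc' hJ' hsolv' hb _)

/-- The minimizer after `k` rounds of removal. -/
lemma measurable_argmin_removed (hG : ∀ i q, Measurable fun d => G d i q)
    (hGc : ∀ d i, Continuous (G d i)) (hJ : Continuous J)
    (hsolv : ∀ d, Solvable (fun i => {q | G d i q ≤ 0}) J)
    (hb : ∀ i j, MeasurableSet {d | b d i j}) (A : Finset ι) (k : ℕ) :
    Measurable fun d => argmin (fun i => {q | G d i q ≤ 0}) J
      (A \ removed (fun i => {q | G d i q ≤ 0}) J (b d) A k) := by
  intro U hU
  exact (measurableFinset_removed hG hGc hJ hsolv hb A k).bind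
    (p := fun R d => argmin (fun i => {q | G d i q ≤ 0}) J (A \ R) ∈ U)
    fun R => measurable_argmin hG hGc hJ hsolv (A \ R) hU

end Measurability

/-! ### Moments and distribution function of beta distributions. -/

section Beta

/-- Finite measures on the unit interval are determined by their moments. -/
lemma measure_eq_of_moments {P P' : Measure ℝ} [IsFiniteMeasure P] [IsFiniteMeasure P']
    (hP : ∀ᵐ x ∂P, x ∈ Set.Icc (0 : ℝ) 1) (hP' : ∀ᵐ x ∂P', x ∈ Set.Icc (0 : ℝ) 1)
    (h : ∀ k : ℕ, ∫ x, x ^ k ∂P = ∫ x, x ^ k ∂P') : P = P' := by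
  have hint : ∀ (M : Measure ℝ) [IsFiniteMeasure M], (∀ᵐ x ∂M, x ∈ Set.Icc (0 : ℝ) 1) →
      ∀ f : ℝ → ℝ, Continuous f → Integrable f M := by
    intro M _ hM f hf
    obtain ⟨C, hC⟩ := isCompact_Icc.exists_bound_of_continuousOn (s := Set.Icc (0 : ℝ) 1)
      hf.continuousOn
    exact Integrable.of_bound hf.aestronglyMeasurable C (hM.mono fun x hx => hC x hx)
  have hpoly : ∀ p : Polynomial ℝ, ∫ x, p.eval x ∂P = ∫ x, p.eval x ∂P' := by
    intro p
    simp only [Polynomial.eval_eq_sum_range]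
    rw [integral_finsetSum _ fun i _ => (hint P hP _ (by fun_prop)),
      integral_finsetSum _ fun i _ => (hint P' hP' _ (by fun_prop))]
    simp only [integral_const_mul, h]
  refine ext_of_forall_integral_eq_of_IsFiniteMeasure fun f => ?_
  refine eq_of_forall_dist_le fun ε hε => ?_
  -- Weierstrass approximation up to `ε / c` costs at most `ε` for both measures together; the
  -- summand `1` keeps `c` positive.
  set c := P.real Set.univ + P'.real Set.univ + 1 with hc
  have hc0 : 0 < c := by positivity
  obtain ⟨p, hp⟩ := exists_polynomial_near_of_continuousOn 0 1 f f.continuous.continuousOn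
    (ε / c) (by positivity)
  have hdist : ∀ (M : Measure ℝ) [IsFiniteMeasure M], (∀ᵐ x ∂M, x ∈ Set.Icc (0 : ℝ) 1) →
      |∫ x, f x ∂M - ∫ x, p.eval x ∂M| ≤ ε / c * M.real Set.univ := by
    intro M _ hM
    rw [← integral_sub (hint M hM _ f.continuous) (hint M hM _ p.continuous)]
    rw [← Real.norm_eq_abs]
    refine norm_integral_le_of_norm_le_const (hM.mono fun x hx => ?_)
    rw [Real.norm_eq_abs, abs_sub_comm]
    exact (hp x hx).le
  have h1 := hdist P hP
  have h2 := hdist P' hP'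
  rw [hpoly] at h1
  rw [Real.dist_eq]
  have h3 : ε / c * P.real Set.univ + ε / c * P'.real Set.univ ≤ ε := by
    rw [← mul_add, div_mul_eq_mul_div, div_le_iff₀ hc0]
    nlinarith
  rw [abs_le] at *
  constructor <;> linarith

lemma beta_nat (m d : ℕ) (hd : 1 ≤ d) :
    ProbabilityTheory.beta ((m : ℝ) + 1) d = 1 / ((d : ℝ) * ((m + d).choose d)) := by
  obtain ⟨d, rfl⟩ : ∃ e, d = e + 1 := ⟨d - 1, by omega⟩
  have h1 : (m : ℝ) + 1 + ((d + 1 : ℕ) : ℝ) = ((m + (d + 1) : ℕ) : ℝ) + 1 := by push_cast; ring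
  rw [ProbabilityTheory.beta, h1, Real.Gamma_nat_eq_factorial, Real.Gamma_nat_eq_factorial]
  rw [show (((d + 1 : ℕ) : ℝ)) = (d : ℝ) + 1 by push_cast; ring, Real.Gamma_nat_eq_factorial]
  have h2 := Nat.add_choose_mul_factorial_mul_factorial m (d + 1)
  have h3 : ((m + (d + 1)).choose (d + 1) : ℝ) * m.factorial * (d + 1).factorial =
      (m + (d + 1)).factorial := by
    exact_mod_cast h2
  have h4 : ((d + 1).factorial : ℝ) = (d + 1) * d.factorial := by
    rw [Nat.factorial_succ]; push_cast; ring
  have h5 : ((m + (d + 1)).choose (d + 1) : ℝ) ≠ 0 := by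
    have := Nat.choose_pos (show d + 1 ≤ m + (d + 1) by omega)
    positivity
  rw [← h3, h4]
  field_simp

/-- Multiplying the density by `x ^ k` gives a multiple of the beta density with first parameter `a
+ k`. -/
lemma integral_pow_betaMeasure {a c : ℝ} (ha : 0 < a) (hc : 0 < c) (k : ℕ) :
    ∫ x, x ^ k ∂betaMeasure a c = ProbabilityTheory.beta (a + k) c / ProbabilityTheory.beta a c := by
  have hB := beta_pos ha hc
  have hBk := beta_pos (α := a + k) (by positivity) hc
  have hsupp : ∀ᵐ x ∂betaMeasure a c, 0 ≤ x ^ k := by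
    rw [betaMeasure, ae_withDensity_iff (by unfold betaPDF; fun_prop)]
    refine Filter.Eventually.of_forall fun x hx => ?_
    by_contra! hlt
    refine hx (betaPDF_eq_zero_of_nonpos ?_)
    by_contra! h0
    exact absurd hlt (not_lt.2 (by positivity))
  rw [integral_eq_lintegral_of_nonneg_ae hsupp (by fun_prop), betaMeasure,
    lintegral_withDensity_eq_lintegral_mul _ (by unfold betaPDF; fun_prop) (by fun_prop)]
  have : ∀ x, (betaPDF a c * fun x => ENNReal.ofReal (x ^ k)) x =
      ENNReal.ofReal (ProbabilityTheory.beta (a + k) c / ProbabilityTheory.beta a c) *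
        betaPDF (a + k) c x := by
    intro x
    rw [Pi.mul_apply]
    by_cases hx : 0 < x ∧ x < 1
    · rw [betaPDF_of_pos_lt_one hx.1 hx.2, betaPDF_of_pos_lt_one hx.1 hx.2,
        ← ENNReal.ofReal_mul' (by have := hx.1; positivity),
        ← ENNReal.ofReal_mul (by positivity)]
      congr 1
      rw [show a + (k : ℝ) - 1 = a - 1 + k by ring, Real.rpow_add_natCast hx.1.ne']
      field_simp
    · rw [betaPDF_eq, betaPDF_eq, if_neg hx, if_neg hx]; simp
  simp only [this]
  rw [lintegral_const_mul _ (by unfold betaPDF; fun_prop),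
    lintegral_betaPDF_eq_one (by positivity) hc, mul_one, ENNReal.toReal_ofReal (by positivity)]

/-- This quotient is also the probability that `k` given elements among `m + d + k` avoid a
uniformly random subset of size `d`; that is the link to `choose_mul_measure_disjoint`. -/
lemma integral_pow_betaMeasure_nat (m d : ℕ) (hd : 1 ≤ d) (k : ℕ) :
    ∫ x, x ^ k ∂betaMeasure ((m : ℝ) + 1) d =
      ((m + k).choose k : ℝ) / ((m + d + k).choose k) := by
  rw [integral_pow_betaMeasure (by positivity) (by positivity),
    show (m : ℝ) + 1 + (k : ℝ) = ((m + k : ℕ) : ℝ) + 1 by push_cast; ring, beta_nat _ _ hd,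
    beta_nat _ _ hd]
  have hd0 : (d : ℝ) ≠ 0 := by positivity
  have hpos : ∀ i j : ℕ, ((i + j).choose j : ℝ) ≠ 0 := fun i j => by
    have := Nat.choose_pos (show j ≤ i + j by omega)
    positivity
  have key : (m + d).choose d * (m + d + k).choose k = (m + k).choose k * (m + k + d).choose d := by
    have h1 := Nat.add_choose_mul_factorial_mul_factorial m d
    have h2 := Nat.add_choose_mul_factorial_mul_factorial (m + d) k
    have h3 := Nat.add_choose_mul_factorial_mul_factorial m k
    have h4 := Nat.add_choose_mul_factorial_mul_factorial (m + k) d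
    rw [show m + k + d = m + d + k by ring] at h4 ⊢
    have hf : 0 < m.factorial * d.factorial * k.factorial := by positivity
    refine Nat.eq_of_mul_eq_mul_right hf ?_
    calc (m + d).choose d * (m + d + k).choose k * (m.factorial * d.factorial * k.factorial)
        = ((m + d + k).choose k) * ((m + d).choose d * m.factorial * d.factorial)
          * k.factorial := by ring
      _ = (m + d + k).factorial := by rw [h1, h2]
      _ = ((m + d + k).choose d) * ((m + k).choose k * m.factorial * k.factorial)
          * d.factorial := by rw [h3, h4]
      _ = _ := by ring
  have key' : ((m + d).choose d : ℝ) * (m + d + k).choose k =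
      (m + k).choose k * (m + k + d).choose d := by exact_mod_cast key
  have := hpos m d
  have := hpos (m + d) k
  have := hpos (m + k) d
  field_simp
  linarith

/-- The derivatives of the summands telescope, and only one boundary term survives: a multiple of a
beta density. -/
lemma hasDerivAt_binomialTail (n d : ℕ) (hd : d ≤ n) (t : ℝ) :
    HasDerivAt (fun t => binomialTail n d (1 - t))
      (d * n.choose d * t ^ (n - d) * (1 - t) ^ (d - 1)) t := by
  induction d with
  | zero => simpa [binomialTail] using hasDerivAt_const t (0 : ℝ)
  | succ d ih =>
    have ih := ih (by omega)
    simp only [binomialTail, Finset.sum_range_succ] at ih ⊢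
    have h1 : HasDerivAt (fun t : ℝ => 1 - t) (-1) t := by
      simpa using (hasDerivAt_id t).const_sub 1
    have h2 : HasDerivAt (fun t : ℝ => (1 - (1 - t))) 1 t := by
      simp only [sub_sub_cancel]
      exact hasDerivAt_id' t
    have h3 := ((h1.pow d).const_mul (n.choose d : ℝ)).mul (h2.pow (n - d))
    refine (ih.add h3).congr_deriv ?_
    have h4 : ((n.choose (d + 1) : ℕ) : ℝ) * (d + 1) = n.choose d * (n - d : ℕ) := by
      exact_mod_cast Nat.choose_succ_right_eq n d
    have h5 : n - d = (n - (d + 1)) + 1 := by omega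
    have h6 : n - d - 1 = n - (d + 1) := by omega
    simp only [Nat.add_sub_cancel, sub_sub_cancel, Nat.cast_add, Nat.cast_one, Pi.pow_apply]
    rw [h6]
    have h7 : ((d : ℝ) + 1) * n.choose (d + 1) = n.choose d * (n - d : ℕ) := by rw [← h4]; ring
    rw [h7]
    ring

lemma binomialTail_eq_betaMeasure (m d : ℕ) (hd : 1 ≤ d) {ε : ℝ} (h0 : 0 < ε) (h1 : ε < 1) :
    binomialTail (m + d) d ε = (betaMeasure ((m : ℝ) + 1) d).real (Set.Iic (1 - ε)) := by
  have hderiv := hasDerivAt_binomialTail (m + d) d (by omega)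
  have hftc := intervalIntegral.integral_eq_sub_of_hasDerivAt (a := 0) (b := 1 - ε)
    (fun t _ => hderiv t) (Continuous.intervalIntegrable (by fun_prop) _ _)
  -- At miscoverage one every summand contains `0 ^ (m + d - j)` with `j < d`, so there is no
  -- constant of integration.
  have hzero : binomialTail (m + d) d (1 - 0) = 0 := by
    rw [binomialTail]
    refine Finset.sum_eq_zero fun j hj => ?_
    rw [Finset.mem_range] at hj
    rw [sub_zero, sub_self, zero_pow (by omega), mul_zero]
  rw [hzero, sub_zero, sub_sub_cancel, intervalIntegral.integral_of_le (by linarith)] at hftc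
  rw [← hftc, measureReal_def, betaMeasure, withDensity_apply _ measurableSet_Iic,
    integral_eq_lintegral_of_nonneg_ae]
  · congr 1
    rw [← lintegral_indicator measurableSet_Ioc, ← lintegral_indicator measurableSet_Iic]
    refine lintegral_congr fun x => ?_
    by_cases hx : x ∈ Set.Ioc 0 (1 - ε)
    · have hx' : x ∈ Set.Iic (1 - ε) := hx.2
      rw [Set.indicator_of_mem hx, Set.indicator_of_mem hx',
        betaPDF_of_pos_lt_one hx.1 (by linarith [hx.2]), beta_nat m d hd]
      congr 1
      rw [one_div_one_div, add_sub_cancel_right, Real.rpow_natCast, Nat.add_sub_cancel,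
        ← Nat.cast_one, ← Nat.cast_sub hd, Real.rpow_natCast]
    · rw [Set.indicator_of_notMem hx]
      by_cases hx' : x ∈ Set.Iic (1 - ε)
      · rw [Set.indicator_of_mem hx', betaPDF_eq_zero_of_nonpos]
        by_contra! h
        exact hx ⟨h, hx'⟩
      · rw [Set.indicator_of_notMem hx']
  · refine ae_restrict_of_forall_mem measurableSet_Ioc fun x hx => ?_
    have h2 : 0 ≤ x := hx.1.le
    have h3 : 0 ≤ 1 - x := by linarith [hx.2]
    simp only [Pi.zero_apply]
    positivity
  · fun_prop

end Beta

/-! ### From equivariant selections of fixed size to the beta law. -/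

section Law

variable {X : Type*} [MeasurableSpace X] (Q : Measure X) [IsProbabilityMeasure Q]
  {ι κ : Type*} [DecidableEq ι] [Fintype ι] [Fintype κ]

/-- A subfamily of independent samples consists of independent samples. -/
lemma measurePreserving_comp_embedding (e : κ ↪ ι) :
    MeasurePreserving (fun (z : ι → X) j => z (e j)) (Measure.pi fun _ => Q)
      (Measure.pi fun _ => Q) := by
  have hmeas : Measurable fun (z : ι → X) j => z (e j) := by fun_prop
  refine ⟨hmeas, (Measure.pi_eq fun s hs => ?_).symm⟩
  rw [Measure.map_apply hmeas (MeasurableSet.univ_pi hs)]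
  have : (fun (z : ι → X) j => z (e j)) ⁻¹' Set.univ.pi s =
      Set.univ.pi (Function.extend e s fun _ => Set.univ) := by
    ext z
    simp only [Set.mem_preimage, Set.mem_univ_pi]
    constructor
    · intro h i
      by_cases hi : ∃ j, e j = i
      · obtain ⟨j, rfl⟩ := hi
        rw [e.injective.extend_apply]; exact h j
      · rw [Function.extend_apply' _ _ _ hi]; trivial
    · intro h j
      have := h (e j)
      rwa [e.injective.extend_apply] at this
  rw [this, Measure.pi_pi]
  refine (Fintype.prod_of_injective e e.injective _ _ (fun i hi => ?_) fun j => ?_).symm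
  · rw [Function.extend_apply' _ _ _ hi, measure_univ]
  · rw [e.injective.extend_apply]

/-- A permutation-equivariant random subset with `d` elements avoids a given set with `k` elements
with the hypergeometric probability. -/
lemma choose_mul_measure_disjoint {S : (ι → X) → Finset ι} (hS : MeasurableFinset S) {d k : ℕ}
    (hcard : ∀ᵐ z ∂(Measure.pi fun _ : ι => Q), (S z).card = d)
    (hperm : ∀ σ : Equiv.Perm ι, ∀ᵐ z ∂(Measure.pi fun _ : ι => Q),
      ∀ i, i ∈ S (fun j => z (σ j)) ↔ σ i ∈ S z)
    {T : Finset ι} (hT : T.card = k) :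
    ((Fintype.card ι).choose k : ENNReal) *
      (Measure.pi fun _ : ι => Q) {z | Disjoint T (S z)} = ((Fintype.card ι - d).choose k : ℕ) := by
  set M := Measure.pi fun _ : ι => Q
  have hmeas : ∀ U : Finset ι, MeasurableSet {z | Disjoint U (S z)} := fun U =>
    hS.bind (p := fun B _ => Disjoint U B) fun B => MeasurableSet.const _
  -- A permutation carrying `T` to `U` preserves the product measure, so all sets of `k` indices are
  -- avoided with the same probability. Their sum is found by counting the sets of `k` indices
  -- outside `S z`, whose number does not depend on `z`.
  have hinv : ∀ U ∈ Finset.powersetCard k (Finset.univ : Finset ι),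
      M {z | Disjoint U (S z)} = M {z | Disjoint T (S z)} := by
    intro U hU
    have hUc : U.card = T.card := by rw [hT]; exact (Finset.mem_powersetCard.1 hU).2
    let σ : Equiv.Perm ι := (Finset.equivOfCardEq hUc.symm).extendSubtype
    have hσ : ∀ t, σ t ∈ U ↔ t ∈ T := by
      intro t
      by_cases ht : t ∈ T
      · exact iff_of_true ((Finset.equivOfCardEq hUc.symm).extendSubtype_mem t ht) ht
      · exact iff_of_false ((Finset.equivOfCardEq hUc.symm).extendSubtype_not_mem t ht) ht
    have hmp := measurePreserving_comp_embedding Q σ.toEmbedding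
    rw [← hmp.measure_preimage (hmeas T).nullMeasurableSet]
    refine measure_congr ?_
    filter_upwards [hperm σ] with z hz
    refine propext ?_
    change Disjoint U (S z) ↔ Disjoint T (S fun j => z (σ j))
    rw [Finset.disjoint_left, Finset.disjoint_left]
    constructor
    · intro h t ht hcon
      exact h ((hσ t).2 ht) ((hz t).1 hcon)
    · intro h u hu hcon
      obtain ⟨t, rfl⟩ := σ.surjective u
      exact h ((hσ t).1 hu) ((hz t).2 hcon)
  have hsum : ∑ U ∈ Finset.powersetCard k (Finset.univ : Finset ι), M {z | Disjoint U (S z)} =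
      ((Fintype.card ι - d).choose k : ℕ) := by
    have h1 : ∀ U : Finset ι, M {z | Disjoint U (S z)} =
        ∫⁻ z, {z | Disjoint U (S z)}.indicator 1 z ∂M := fun U =>
      (lintegral_indicator_one (hmeas U)).symm
    simp only [h1]
    rw [← lintegral_finsetSum _ fun U _ => measurable_one.indicator (hmeas U)]
    have h2 : ∀ᵐ z ∂M, ∑ U ∈ Finset.powersetCard k (Finset.univ : Finset ι),
        {z | Disjoint U (S z)}.indicator (1 : (ι → X) → ENNReal) z =
          ((Fintype.card ι - d).choose k : ℕ) := by
      filter_upwards [hcard] with z hz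
      simp only [Set.indicator_apply, Set.mem_ofPred_eq, Pi.one_apply]
      rw [Finset.sum_boole]
      congr 1
      have : Finset.filter (fun U => Disjoint U (S z)) (Finset.powersetCard k Finset.univ) =
          Finset.powersetCard k (Finset.univ \ S z) := by
        ext U
        simp only [Finset.mem_filter, Finset.mem_powersetCard, Finset.subset_univ, true_and,
          Finset.subset_sdiff]
        tauto
      rw [this, Finset.card_powersetCard, Finset.card_sdiff_of_subset (Finset.subset_univ _),
        Finset.card_univ, hz]
    rw [lintegral_congr_ae h2, lintegral_const, measure_univ, mul_one]
  rw [Finset.sum_congr rfl hinv, Finset.sum_const, Finset.card_powersetCard, Finset.card_univ,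
    nsmul_eq_mul] at hsum
  exact hsum

/-- The law of the probability of a random set, if membership of fresh samples is governed by an
equivariant selection of `d` samples. -/
lemma map_measureReal_eq_betaMeasure {m d : ℕ} (hd : 1 ≤ d)
    {G : Set ((Fin (m + d) → X) × X)} (hG : MeasurableSet G)
    (S : ∀ k, (Fin (m + d) ⊕ Fin k → X) → Finset (Fin (m + d) ⊕ Fin k))
    (hS : ∀ k, MeasurableFinset (S k))
    (hcard : ∀ k, 1 ≤ k → ∀ᵐ z ∂(Measure.pi fun _ => Q), (S k z).card = d)
    (hperm : ∀ k, 1 ≤ k → ∀ σ : Equiv.Perm (Fin (m + d) ⊕ Fin k), ∀ᵐ z ∂(Measure.pi fun _ => Q),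
      ∀ i, i ∈ S k (fun j => z (σ j)) ↔ σ i ∈ S k z)
    (hiff : ∀ k, 1 ≤ k → ∀ᵐ z ∂(Measure.pi fun _ => Q),
      (∀ j, ((fun i => z (Sum.inl i)), z (Sum.inr j)) ∈ G) ↔ ∀ j, Sum.inr j ∉ S k z) :
    (Measure.pi fun _ : Fin (m + d) => Q).map (fun a => Q.real {x | (a, x) ∈ G}) =
      betaMeasure ((m : ℝ) + 1) d := by
  have hmeas : Measurable fun a => Q.real {x | (a, x) ∈ G} :=
    (measurable_measure_prodMk_left hG).ennreal_toReal
  have : IsProbabilityMeasure (betaMeasure ((m : ℝ) + 1) d) :=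
    isProbabilityMeasureBeta (by positivity) (by positivity)
  have : IsProbabilityMeasure
      ((Measure.pi fun _ : Fin (m + d) => Q).map (fun a => Q.real {x | (a, x) ∈ G})) :=
    Measure.isProbabilityMeasure_map hmeas.aemeasurable
  refine measure_eq_of_moments ?_ ?_ fun k => ?_
  · refine (ae_map_iff hmeas.aemeasurable (p := fun x => x ∈ Set.Icc (0 : ℝ) 1)
      measurableSet_Icc).2 ?_
    exact Filter.Eventually.of_forall fun a => ⟨measureReal_nonneg, measureReal_le_one⟩
  · rw [betaMeasure, ae_withDensity_iff (by unfold betaPDF; fun_prop)]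
    refine Filter.Eventually.of_forall fun x hx => ⟨?_, ?_⟩
    · by_contra! h; exact hx (betaPDF_eq_zero_of_nonpos h.le)
    · by_contra! h; exact hx (betaPDF_eq_zero_of_one_le h.le)
  rw [integral_pow_betaMeasure_nat m d hd, integral_map hmeas.aemeasurable (by fun_prop)]
  -- The zeroth moment is the total mass; the hypotheses on the selection concern at least one fresh
  -- sample.
  rcases Nat.eq_zero_or_pos k with rfl | hk
  · simp
  rw [integral_eq_lintegral_of_nonneg_ae (Filter.Eventually.of_forall fun a => by positivity)
    (hmeas.pow_const k).aestronglyMeasurable]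
  -- The `k`-th power of the conditional probability is the conditional probability that `k`
  -- independent fresh samples all fall into `G`.
  have h1 : ∀ a : Fin (m + d) → X, ENNReal.ofReal (Q.real {x | (a, x) ∈ G} ^ k) =
      (Measure.pi fun _ : Fin k => Q) {c | ∀ j, (a, c j) ∈ G} := by
    intro a
    have : {c : Fin k → X | ∀ j, (a, c j) ∈ G} = Set.univ.pi fun _ => {x | (a, x) ∈ G} := by
      ext c; simp
    rw [this, Measure.pi_pi, Finset.prod_const, Finset.card_univ, Fintype.card_fin,
      ENNReal.ofReal_pow measureReal_nonneg, ofReal_measureReal]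
  simp only [h1]
  let F : Set ((Fin (m + d) → X) × (Fin k → X)) := {p | ∀ j, (p.1, p.2 j) ∈ G}
  have hF : MeasurableSet F := by
    have : F = ⋂ j, {p | (p.1, p.2 j) ∈ G} := by ext; simp [F]
    rw [this]
    exact MeasurableSet.iInter fun j => hG.preimage (by fun_prop)
  have h2 : ∫⁻ a, (Measure.pi fun _ : Fin k => Q) {c | ∀ j, (a, c j) ∈ G}
      ∂(Measure.pi fun _ : Fin (m + d) => Q) =
      ((Measure.pi fun _ : Fin (m + d) => Q).prod (Measure.pi fun _ : Fin k => Q)) F :=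
    (Measure.prod_apply hF).symm
  have hmp := measurePreserving_sumPiEquivProdPi
    (fun _ : Fin (m + d) ⊕ Fin k => Q)
  rw [h2, ← hmp.measure_preimage hF.nullMeasurableSet]
  set T : Finset (Fin (m + d) ⊕ Fin k) := Finset.univ.map Function.Embedding.inr with hTdef
  have h3 : (Measure.pi fun _ : Fin (m + d) ⊕ Fin k => Q)
      ((MeasurableEquiv.sumPiEquivProdPi fun _ => X) ⁻¹' F) =
      (Measure.pi fun _ : Fin (m + d) ⊕ Fin k => Q) {z | Disjoint T (S k z)} := by
    refine measure_congr ?_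
    filter_upwards [hiff k hk] with z hz
    refine propext (Iff.trans hz ?_)
    change _ ↔ Disjoint T (S k z)
    rw [Finset.disjoint_left]
    simp [hTdef]
  have h4 := choose_mul_measure_disjoint Q (hS k) (hcard k hk) (hperm k hk) (T := T) (k := k)
    (by simp [hTdef])
  rw [h3]
  simp only [Fintype.card_sum, Fintype.card_fin] at h4
  have h5 := congrArg ENNReal.toReal h4
  rw [ENNReal.toReal_mul, ENNReal.toReal_natCast, ENNReal.toReal_natCast] at h5
  have h6 : m + d + k - d = m + k := by omega
  rw [h6] at h5
  have h7 : ((m + d + k).choose k : ℝ) ≠ 0 := by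
    have := Nat.choose_pos (show k ≤ m + d + k by omega)
    positivity
  rw [eq_div_iff h7, mul_comm]
  exact h5

/-- A point lies in infinitely many of the sets with at least the limiting probability. -/
lemma le_measure_frequently {D : Type*} [MeasurableSpace D] {M : Measure D} [IsFiniteMeasure M]
    {E : ℕ → Set D} (hE : ∀ m, MeasurableSet (E m)) {c : ENNReal}
    (h : ∃ᶠ m in Filter.atTop, c ≤ M (E m)) :
    c ≤ M {x | ∃ᶠ m in Filter.atTop, x ∈ E m} := by
  have hset : {x | ∃ᶠ m in Filter.atTop, x ∈ E m} = ⋂ N : ℕ, ⋃ m ≥ N, E m := by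
    ext x; simp [Filter.frequently_atTop]
  have hanti : Antitone fun N : ℕ => ⋃ m ≥ N, E m := fun N N' hN =>
    Set.biUnion_subset_biUnion_left fun m hm => le_trans hN hm
  rw [hset, hanti.measure_iInter (fun N => (MeasurableSet.biUnion (Set.to_countable _)
    fun m _ => hE m).nullMeasurableSet) ⟨0, measure_ne_top _ _⟩]
  refine le_iInf fun N => ?_
  obtain ⟨m, hm, hc⟩ := Filter.frequently_atTop.1 h N
  exact hc.trans (measure_mono (Set.subset_biUnion_of_mem (u := fun m => E m) hm))

end Law

/-! ### Independent uniform labels. -/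

section Labels

open unitInterval

variable {ι κ : Type*} [DecidableEq ι] [Fintype ι]

lemma volume_singleton_unitInterval (c : ℝ) : (volume : Measure I) {v | (v : ℝ) = c} = 0 := by
  have hm : MeasurableSet {v : I | (v : ℝ) = c} :=
    measurableSet_eq_fun measurable_subtype_coe measurable_const
  rw [unitInterval.volume_apply]
  refine measure_mono_null (t := {c}) ?_ (by simp)
  rintro _ ⟨v, hv, rfl⟩
  exact hv

/-- Resampling one of finitely many independent labels. -/
lemma measurePreserving_update {Y : Type*} [MeasurableSpace Y] (L : Measure Y)
    [IsProbabilityMeasure L] (i : ι) :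
    MeasurePreserving (fun p : (ι → Y) × Y => Function.update p.1 i p.2)
      ((Measure.pi fun _ => L).prod L) (Measure.pi fun _ => L) := by
  have hmeas : Measurable fun p : (ι → Y) × Y => Function.update p.1 i p.2 := by
    rw [measurable_pi_iff]
    intro j
    by_cases hj : j = i
    · subst hj; simpa using measurable_snd
    · simp only [Function.update_of_ne hj]; fun_prop
  refine ⟨hmeas, (Measure.pi_eq fun s hs => ?_).symm⟩
  rw [Measure.map_apply hmeas (MeasurableSet.univ_pi hs)]
  have : (fun p : (ι → Y) × Y => Function.update p.1 i p.2) ⁻¹' Set.univ.pi s =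
      (Set.univ.pi (Function.update s i Set.univ)) ×ˢ s i := by
    ext p
    simp only [Set.mem_preimage, Set.mem_univ_pi, Set.mem_prod]
    constructor
    · intro h
      refine ⟨fun j => ?_, by simpa using h i⟩
      by_cases hj : j = i
      · subst hj; simp
      · simpa [Function.update_of_ne hj] using h j
    · rintro ⟨h1, h2⟩ j
      by_cases hj : j = i
      · subst hj; simpa using h2
      · simpa [Function.update_of_ne hj] using h1 j
  rw [this, Measure.prod_prod, Measure.pi_pi, ← Finset.mul_prod_erase _ _ (Finset.mem_univ i),
    ← Finset.mul_prod_erase _ _ (Finset.mem_univ i), Function.update_self, measure_univ, one_mul,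
    mul_comm]
  congr 1
  refine Finset.prod_congr rfl fun j hj => ?_
  rw [Function.update_of_ne (Finset.ne_of_mem_erase hj)]

variable {X : Type*} [MeasurableSpace X] (P : Measure X) [IsProbabilityMeasure P]

/-- Almost surely, a label differs from any quantity that does not depend on it. -/
lemma ae_label_ne (i : ι) {φ : (ι → X × I) → ℝ} (hφ : Measurable φ)
    (hdep : ∀ z z' : ι → X × I, (∀ j, j ≠ i → z j = z' j) → (z i).1 = (z' i).1 → φ z = φ z') :
    ∀ᵐ z ∂(Measure.pi fun _ : ι => P.prod (volume : Measure I)), ((z i).2 : ℝ) ≠ φ z := by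
  have hmp := measurePreserving_arrowProdEquivProdArrow X I ι (fun _ => P)
    (fun _ => (volume : Measure I))
  have hset : MeasurableSet {z : ι → X × I | ((z i).2 : ℝ) = φ z} :=
    measurableSet_eq_fun (by fun_prop) hφ
  have hsymm := hmp.symm
  rw [ae_iff]
  simp only [ne_eq, not_not]
  rw [← hsymm.measure_preimage hset.nullMeasurableSet, Measure.prod_apply (hsymm.measurable hset)]
  refine lintegral_eq_zero_of_ae_eq_zero (Filter.Eventually.of_forall fun x => ?_)
  simp only [Pi.zero_apply]
  -- Drawing the label of `i` anew does not change the law of the labels. As `φ` ignores this label,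
  -- the new one would have to hit a single fixed number.
  have hup := measurePreserving_update (volume : Measure I) i
  have hsx : MeasurableSet (Prod.mk x ⁻¹' ((MeasurableEquiv.arrowProdEquivProdArrow X I ι).symm ⁻¹'
      {z : ι → X × I | ((z i).2 : ℝ) = φ z})) :=
    measurable_prodMk_left (hsymm.measurable hset)
  rw [← hup.measure_preimage hsx.nullMeasurableSet, Measure.prod_apply (hup.measurable hsx)]
  refine lintegral_eq_zero_of_ae_eq_zero (Filter.Eventually.of_forall fun u => ?_)
  simp only [Pi.zero_apply]
  refine measure_mono_null ?_ (volume_singleton_unitInterval (φ fun j => (x j, u j)))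
  intro v hv
  have hv' : ((Function.update u i v i : I) : ℝ) = φ fun j => (x j, Function.update u i v j) := hv
  rw [Function.update_self] at hv'
  refine hv'.trans (hdep _ _ (fun j hj => ?_) rfl)
  simp only [Function.update_of_ne hj]

lemma ae_injective_label :
    ∀ᵐ z ∂(Measure.pi fun _ : ι => P.prod (volume : Measure I)),
      Function.Injective fun i => (z i).2 := by
  have : ∀ i j : ι, i ≠ j → ∀ᵐ z ∂(Measure.pi fun _ : ι => P.prod (volume : Measure I)),
      (z i).2 ≠ (z j).2 := by
    intro i j hij
    filter_upwards [ae_label_ne P i (φ := fun z => ((z j).2 : ℝ)) (by fun_prop)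
      (fun z z' h _ => by rw [h j hij.symm])] with z hz h
    exact hz (by rw [h])
  have hall : ∀ᵐ z ∂(Measure.pi fun _ : ι => P.prod (volume : Measure I)),
      ∀ i j : ι, i ≠ j → (z i).2 ≠ (z j).2 := by
    simp only [ae_all_iff]
    exact this
  filter_upwards [hall] with z hz i j h
  by_contra hne
  exact hz i j hne h

lemma argmin_congr {nq : ℕ} {K K' : ι → Set (Fin nq → ℝ)} (J : (Fin nq → ℝ) → ℝ) {A : Finset ι}
    (h : ∀ i ∈ A, K i = K' i) : argmin K J A = argmin K' J A := by
  have : IsArgmin K J A = IsArgmin K' J A := by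
    funext q
    have h1 : ∀ q, (∀ i ∈ A, q ∈ K i) ↔ ∀ i ∈ A, q ∈ K' i := fun q =>
      forall₂_congr fun i hi => by rw [h i hi]
    simp only [IsArgmin, h1]
  unfold argmin
  rw [this]

end Labels

/-! ### Ties broken by labels. -/

section LabelledOrder

open unitInterval

variable {nx ny nq : ℕ} {ι : Type*}

/-- The tie-breaking order with ties resolved by labels. -/
def TieBreak.Labelled (tb : TieBreak nx ny) (z : ι → Sample nx ny × I) (i j : ι) : Prop :=
  tb.le (z i).1 (z j).1 ∧ (tb.le (z j).1 (z i).1 → (z i).2 < (z j).2)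

lemma isStrictTotalOrder_labelled (tb : TieBreak nx ny) {z : ι → Sample nx ny × I}
    (hz : Function.Injective fun i => (z i).2) : IsStrictTotalOrder ι (tb.Labelled z) where
  trichotomous i j h1 h2 := by
    by_contra hne
    have hne' : (z i).2 ≠ (z j).2 := fun h => hne (hz h)
    rcases tb.total (z i).1 (z j).1 with h | h
    · refine h1 ⟨h, fun h' => ?_⟩
      by_contra hlt
      exact h2 ⟨h', fun _ => lt_of_le_of_ne (not_lt.1 hlt) hne'.symm⟩
    · refine h2 ⟨h, fun h' => ?_⟩
      by_contra hlt
      exact h1 ⟨h', fun _ => lt_of_le_of_ne (not_lt.1 hlt) hne'⟩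
  irrefl i h := lt_irrefl _ (h.2 h.1)
  trans i j k h1 h2 := ⟨tb.trans _ _ _ h1.1 h2.1, fun h =>
    (h1.2 (tb.trans _ _ _ h2.1 h)).trans (h2.2 (tb.trans _ _ _ h h1.1))⟩

lemma measurableSet_le_comp (tb : TieBreak nx ny) {D : Type*} [MeasurableSpace D]
    {f g : D → Sample nx ny} (hf : Measurable f) (hg : Measurable g) :
    MeasurableSet {x | tb.le (f x) (g x)} :=
  (hf.prodMk hg) tb.measurableSet_le

lemma measurableSet_labelled (tb : TieBreak nx ny) (i j : ι) :
    MeasurableSet {z : ι → Sample nx ny × I | tb.Labelled z i j} := by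
  have h1 := measurableSet_le_comp tb (D := ι → Sample nx ny × I) (f := fun z => (z i).1)
    (g := fun z => (z j).1) (by fun_prop) (by fun_prop)
  have h2 := measurableSet_le_comp tb (D := ι → Sample nx ny × I) (f := fun z => (z j).1)
    (g := fun z => (z i).1) (by fun_prop) (by fun_prop)
  have h3 : MeasurableSet {z : ι → Sample nx ny × I | (z i).2 < (z j).2} :=
    measurableSet_lt (by fun_prop) (by fun_prop)
  exact h1.inter (h2.himp h3)

lemma measurableSet_before (tb : TieBreak nx ny) {N : ℕ} (i j : Fin N) :
    MeasurableSet {d : Fin N → Sample nx ny | tb.Before d i j} := by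
  have h1 := measurableSet_le_comp tb (D := Fin N → Sample nx ny) (f := fun z => z i)
    (g := fun z => z j) (by fun_prop) (by fun_prop)
  have h2 := measurableSet_le_comp tb (D := Fin N → Sample nx ny) (f := fun z => z j)
    (g := fun z => z i) (by fun_prop) (by fun_prop)
  exact h1.inter (h2.himp (MeasurableSet.const _))

/-- Once the samples are listed by increasing label, comparing labels is comparing indices. -/
lemma labelled_comp_sort (tb : TieBreak nx ny) {n : ℕ} {z : Fin n → Sample nx ny × I}
    (hz : Function.Injective fun i => (z i).2) (i j : Fin n) :
    tb.Labelled z (Tuple.sort (fun i => (z i).2) i) (Tuple.sort (fun i => (z i).2) j) ↔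
      tb.Before (fun l => (z (Tuple.sort (fun i => (z i).2) l)).1) i j := by
  have hmono : StrictMono ((fun i => (z i).2) ∘ Tuple.sort fun i => (z i).2) :=
    (Tuple.monotone_sort _).strictMono_of_injective (hz.comp (Equiv.injective _))
  have := hmono.lt_iff_lt (a := i) (b := j)
  simp only [Function.comp] at this
  simp only [TieBreak.Labelled, TieBreak.Before, this]

end LabelledOrder

open unitInterval in
/-- The distribution of a sample with an independent uniform label. -/
noncomputable abbrev labelledMeasure {X : Type*} [MeasurableSpace X] (P : Measure X) :
    Measure (X × I) := P.prod volume

/-! ### Almost sure nondegeneracy of labelled runs. -/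

section HighConfidence

open unitInterval

variable {nx ny nq : ℕ} {h : Sample nx ny → (Fin nq → ℝ) → ℝ} {J : (Fin nq → ℝ) → ℝ}
  {ι : Type} [DecidableEq ι] [Fintype ι]

/-- A convex function on `ℝ^nq` is continuous, so measurability in the sample gives joint
measurability. -/
lemma measurable_uncurry_of_convex (hmeas : ∀ q, Measurable fun p => h p q)
    (hconv : ∀ p, ConvexOn ℝ Set.univ (h p)) :
    Measurable fun x : Sample nx ny × (Fin nq → ℝ) => h x.1 x.2 :=
  (measurable_uncurry_of_continuous_of_measurable (u := fun q p => h p q)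
    (fun p => (hconv p).locallyLipschitz.continuous) hmeas).comp measurable_swap

lemma solvable_of_fin (hfin : ∀ N, 1 ≤ N → ∀ d : Fin N → Sample nx ny,
      ∃ q, IsArgmin (fun i => {q | h (d i) q ≤ 0}) J Finset.univ q)
    {κ : Type*} (z : κ → Sample nx ny) : Solvable (fun i => {q | h (z i) q ≤ 0}) J := by
  classical
  intro A hA
  let e : Fin A.card ↪ κ := A.equivFin.symm.toEmbedding.trans (Function.Embedding.subtype _)
  have he : Finset.univ.map e = A := by
    ext i
    simp only [Finset.mem_map, Finset.mem_univ, true_and, e, Function.Embedding.trans_apply,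
      Equiv.coe_toEmbedding, Function.Embedding.subtype_apply]
    constructor
    · rintro ⟨j, rfl⟩; exact (A.equivFin.symm j).2
    · intro hi; exact ⟨A.equivFin ⟨i, hi⟩, by simp⟩
  obtain ⟨q, hq⟩ := hfin A.card hA.card_pos fun i => z (e i)
  refine ⟨q, ?_⟩
  rw [← he, isArgmin_map]
  exact hq

variable (P : Measure (Sample nx ny)) [IsProbabilityMeasure P] (tb : TieBreak nx ny)

/-- The perturbed programs are almost surely nondegenerate. -/
lemma ae_nondegenerateOn_perturbed (hmeas : ∀ q, Measurable fun p => h p q)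
    (hconv : ∀ p, ConvexOn ℝ Set.univ (h p)) (hJ : ConvexOn ℝ Set.univ J)
    (hsolv : ∀ {κ : Type} (z : κ → Sample nx ny), Solvable (fun i => {q | h (z i) q ≤ 0}) J)
    {r : ℝ} (hr : 0 < r) :
    ∀ᵐ z ∂(Measure.pi fun _ : ι => labelledMeasure P), ∀ A : Finset ι, A.Nonempty →
      NondegenerateOn (fun i => {q | h (z i).1 q - r * (z i).2 ≤ 0}) (regularized J r) A := by
  have hsolv' : ∀ z : ι → Sample nx ny × I, Solvable
      (fun i => {q | h (z i).1 q - r * (z i).2 ≤ 0}) (regularized J r) := fun z =>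
    solvable_perturbed (g := fun i => h (z i).1) (fun i => hconv _) hJ
      (hsolv fun i => (z i).1) hr (fun i => mul_nonneg hr.le (z i).2.2.1)
      fun i => mul_le_of_le_one_right hr.le (z i).2.2.2
  have hconv' : ∀ (z : ι → Sample nx ny × I) i,
      ConvexOn ℝ Set.univ fun q => h (z i).1 q - r * (z i).2 := fun z i => by
    simp only [sub_eq_add_neg]
    exact (hconv _).add (convexOn_const _ convex_univ)
  have hJ' := convexOn_regularized hJ hr.le
  have hq : ∀ B : Finset ι, Measurable fun z : ι → Sample nx ny × I =>
      argmin (fun i => {q | h (z i).1 q - r * (z i).2 ≤ 0}) (regularized J r) B := by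
    intro B
    refine measurable_argmin (G := fun z i q => h (z i).1 q - r * (z i).2) (fun i q => ?_)
      (fun z i => (hconv' z i).locallyLipschitz.continuous)
      hJ'.locallyLipschitz.continuous hsolv' B
    exact ((hmeas q).comp (by fun_prop)).sub (by fun_prop)
  -- In a degenerate perturbed system some constraint `e` is active at the minimizer over the
  -- others. This would make the label of `e` equal to a quantity that does not depend on it.
  have hall : ∀ᵐ z ∂(Measure.pi fun _ : ι => labelledMeasure P), ∀ (A : Finset ι) (e : ι),
      ((z e).2 : ℝ) ≠ h (z e).1 (argmin (fun i => {q | h (z i).1 q - r * (z i).2 ≤ 0})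
        (regularized J r) (A.erase e)) / r := by
    simp only [ae_all_iff]
    intro A e
    refine ae_label_ne P e (φ := fun z => h (z e).1
      (argmin (fun i => {q | h (z i).1 q - r * (z i).2 ≤ 0})
        (regularized J r) (A.erase e)) / r) ?_ ?_
    · exact ((measurable_uncurry_of_convex hmeas hconv).comp
        (Measurable.prodMk (by fun_prop) (hq (A.erase e)))).div_const r
    · intro z z' hz hze
      have : argmin (fun i => {q | h (z i).1 q - r * (z i).2 ≤ 0}) (regularized J r) (A.erase e) =
          argmin (fun i => {q | h (z' i).1 q - r * (z' i).2 ≤ 0}) (regularized J r) (A.erase e) :=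
        argmin_congr _ fun i hi => by simp only [hz i (Finset.ne_of_mem_erase hi)]
      simp only [this, hze]
  filter_upwards [hall] with z hz A hA
  by_contra hcon
  obtain ⟨e, heA, -, he⟩ := exists_active_of_not_nondegenerateOn
    (g := fun i q => h (z i).1 q - r * (z i).2) (hconv' z) hJ' (hsolv' z) hA hcon
  refine hz A e ?_
  rw [eq_div_iff hr.ne']
  linarith

lemma univ_map_perm (τ : Equiv.Perm ι) : Finset.univ.map τ.toEmbedding = Finset.univ := by
  simp

/-- A run with labels is a run with the samples listed in the order of their labels. -/
lemma sdiff_removed_sort {n : ℕ} {z : Fin n → Sample nx ny × I}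
    (hz : Function.Injective fun i => (z i).2) (k : ℕ) :
    Finset.univ \ removed (fun i => {q | h (z i).1 q ≤ 0}) J (tb.Labelled z) Finset.univ k =
      (Finset.univ \ removed
        (fun i => {q | h (z (Tuple.sort (fun i => (z i).2) i)).1 q ≤ 0}) J
        (tb.Before fun l => (z (Tuple.sort (fun i => (z i).2) l)).1) Finset.univ k).map
          (Tuple.sort fun i => (z i).2).toEmbedding := by
  have hb : (fun i j => tb.Labelled z (Tuple.sort (fun i => (z i).2) i)
      (Tuple.sort (fun i => (z i).2) j)) =
      tb.Before fun l => (z (Tuple.sort (fun i => (z i).2) l)).1 := by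
    funext i j
    exact propext (labelled_comp_sort tb hz i j)
  rw [map_sdiff', ← hb]
  have := removed_map (fun i => {q | h (z i).1 q ≤ 0}) J (tb.Labelled z)
    (Tuple.sort fun i => (z i).2).toEmbedding Finset.univ k
  rw [univ_map_perm] at this ⊢
  rw [this]
  rfl

/-- Early nondegeneracy of the runs with labels on `n` samples. -/
lemma ae_nondegenerateOn_labelled {n ρ : ℕ}
    (hnd : ∀ k < ρ, ∀ᵐ d ∂(Measure.pi fun _ : Fin n => P),
      NondegenerateOn (fun i => {q | h (d i) q ≤ 0}) J
        (Finset.univ \ removed (fun i => {q | h (d i) q ≤ 0}) J (tb.Before d) Finset.univ k)) :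
    ∀ᵐ z ∂(Measure.pi fun _ : Fin n => labelledMeasure P), ∀ k < ρ,
      NondegenerateOn (fun i => {q | h (z i).1 q ≤ 0}) J
        (Finset.univ \ removed (fun i => {q | h (z i).1 q ≤ 0}) J (tb.Labelled z)
          Finset.univ k) := by
  have hfst : MeasurePreserving (fun (z : Fin n → Sample nx ny × I) i => (z i).1)
      (Measure.pi fun _ => labelledMeasure P) (Measure.pi fun _ => P) := by
    exact measurePreserving_pi (fun _ : Fin n => labelledMeasure P) (fun _ => P)
      fun _ => measurePreserving_fst
  -- The sorting permutation is random, so nondegeneracy is first secured for all of the finitely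
  -- many permutations at once.
  have hall : ∀ᵐ z ∂(Measure.pi fun _ : Fin n => labelledMeasure P),
      ∀ (τ : Equiv.Perm (Fin n)) (k : ℕ), k < ρ →
        NondegenerateOn (fun i => {q | h (z (τ i)).1 q ≤ 0}) J
          (Finset.univ \ removed (fun i => {q | h (z (τ i)).1 q ≤ 0}) J
            (tb.Before fun l => (z (τ l)).1) Finset.univ k) := by
    simp only [ae_all_iff]
    intro τ k hk
    have hmp := (measurePreserving_comp_embedding P τ.toEmbedding).comp hfst
    exact hmp.quasiMeasurePreserving.ae (hnd k hk)
  filter_upwards [hall, ae_injective_label P] with z hz hinj k hk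
  rw [sdiff_removed_sort tb hinj k, nondegenerateOn_map]
  exact hz _ k hk

/-- Early nondegeneracy of the runs with labels on at least `n` samples. -/
lemma ae_nondegenerateOn_of_card_le
    (hconv : ∀ p, ConvexOn ℝ Set.univ (h p)) (hJ : ConvexOn ℝ Set.univ J)
    (hsolv : ∀ {κ : Type} (z : κ → Sample nx ny), Solvable (fun i => {q | h (z i) q ≤ 0}) J)
    {n ρ : ℕ} (hnq : 1 ≤ nq) (hn : (ρ + 1) * nq ≤ n)
    (hnd : ∀ k < ρ, ∀ᵐ d ∂(Measure.pi fun _ : Fin n => P),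
      NondegenerateOn (fun i => {q | h (d i) q ≤ 0}) J
        (Finset.univ \ removed (fun i => {q | h (d i) q ≤ 0}) J (tb.Before d) Finset.univ k)) :
    ∀ᵐ z ∂(Measure.pi fun _ : ι => labelledMeasure P),
      IsStrictTotalOrder ι (tb.Labelled z) ∧ ∀ A : Finset ι, n ≤ A.card → ∀ k < ρ,
      NondegenerateOn (fun i => {q | h (z i).1 q ≤ 0}) J
        (A \ removed (fun i => {q | h (z i).1 q ≤ 0}) J (tb.Labelled z) A k) := by
  have hall : ∀ᵐ z ∂(Measure.pi fun _ : ι => labelledMeasure P), ∀ (e : Fin n ↪ ι), ∀ k < ρ,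
      NondegenerateOn (fun i => {q | h (z (e i)).1 q ≤ 0}) J
        (Finset.univ \ removed (fun i => {q | h (z (e i)).1 q ≤ 0}) J
          (tb.Labelled fun i => z (e i)) Finset.univ k) := by
    rw [ae_all_iff]
    intro e
    exact (measurePreserving_comp_embedding (labelledMeasure P) e).quasiMeasurePreserving.ae
      (ae_nondegenerateOn_labelled P tb hnd)
  filter_upwards [hall, ae_injective_label P] with z hz hinj
  have hord := isStrictTotalOrder_labelled tb hinj
  refine ⟨hord, fun A hA k hk => ?_⟩
  refine nondegenerateOn_of_card_le hnq
    (convex_sublevel (g := fun i => h (z i).1) fun i => hconv _) hJ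
    (hsolv fun i => (z i).1) hn (fun B hB k hk => ?_) hA hk
  let e : Fin n ↪ ι :=
    (B.equivFinOfCardEq hB).symm.toEmbedding.trans (Function.Embedding.subtype _)
  have he : Finset.univ.map e = B := by
    refine Finset.eq_of_subset_of_card_le (fun i hi => ?_) (by simp [hB])
    obtain ⟨j, -, rfl⟩ := Finset.mem_map.1 hi
    exact ((B.equivFinOfCardEq hB).symm j).2
  rw [← he, removed_map, ← map_sdiff', nondegenerateOn_map]
  exact hz e k hk

/-- Appending one sample. -/
lemma measurePreserving_sumElim {X : Type*} [MeasurableSpace X] (Q : Measure X)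
    [IsProbabilityMeasure Q] (n : ℕ) :
    MeasurePreserving (fun p : (Fin n → X) × X => Sum.elim p.1 fun _ : Fin 1 => p.2)
      ((Measure.pi fun _ => Q).prod Q) (Measure.pi fun _ => Q) := by
  have hmeas : Measurable fun p : (Fin n → X) × X => Sum.elim p.1 fun _ : Fin 1 => p.2 := by
    rw [measurable_pi_iff]
    rintro (i | i)
    · simp only [Sum.elim_inl]; fun_prop
    · simp only [Sum.elim_inr]; fun_prop
  refine ⟨hmeas, (Measure.pi_eq fun s hs => ?_).symm⟩
  rw [Measure.map_apply hmeas (MeasurableSet.univ_pi hs)]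
  have : (fun p : (Fin n → X) × X => Sum.elim p.1 fun _ : Fin 1 => p.2) ⁻¹' Set.univ.pi s =
      (Set.univ.pi fun i => s (Sum.inl i)) ×ˢ s (Sum.inr 0) := by
    ext p; simp
  rw [this, Measure.prod_prod, Measure.pi_pi, Fintype.prod_sum_type]
  simp

end HighConfidence

/-! ### The coverage bound with high confidence: selection, passage to the limit, removal of the
labels. -/

section HighConfidence

open unitInterval

variable {nx ny nq : ℕ} {h : Sample nx ny → (Fin nq → ℝ) → ℝ} {J : (Fin nq → ℝ) → ℝ}
  {ι κ : Type} [DecidableEq ι] [Fintype ι] [DecidableEq κ] [Fintype κ]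

/-- The selected samples of a run with labels whose last stage uses the perturbed program. -/
noncomputable def labelledCompression (h : Sample nx ny → (Fin nq → ℝ) → ℝ)
    (J : (Fin nq → ℝ) → ℝ) (tb : TieBreak nx ny) (ρ : ℕ) (r : ℝ) (z : ι → Sample nx ny × I)
    (A : Finset ι) : Finset ι :=
  compression (fun i => {q | h (z i).1 q ≤ 0}) (fun i => {q | h (z i).1 q - r * (z i).2 ≤ 0}) J
    (regularized J r) (tb.Labelled z) ρ A

lemma labelledCompression_map (tb : TieBreak nx ny) (ρ : ℕ) (r : ℝ) (z : ι → Sample nx ny × I)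
    (e : κ ↪ ι) (A : Finset κ) :
    labelledCompression h J tb ρ r z (A.map e) =
      (labelledCompression h J tb ρ r (fun i => z (e i)) A).map e :=
  compression_map _ _ _ e A _ _ ρ

/-- The final minimizer of a run with labels whose last stage uses the perturbed program. -/
noncomputable def perturbedParam (h : Sample nx ny → (Fin nq → ℝ) → ℝ)
    (J : (Fin nq → ℝ) → ℝ) (tb : TieBreak nx ny) (ρ : ℕ) (r : ℝ) (z : ι → Sample nx ny × I) :
    Fin nq → ℝ :=
  argmin (fun i => {q | h (z i).1 q - r * (z i).2 ≤ 0}) (regularized J r)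
    (Finset.univ \ removed (fun i => {q | h (z i).1 q ≤ 0}) J (tb.Labelled z) Finset.univ ρ)

variable (P : Measure (Sample nx ny)) [IsProbabilityMeasure P] (tb : TieBreak nx ny)

lemma solvable_labelled (hconv : ∀ p, ConvexOn ℝ Set.univ (h p)) (hJ : ConvexOn ℝ Set.univ J)
    (hsolv : ∀ {κ : Type} (z : κ → Sample nx ny), Solvable (fun i => {q | h (z i) q ≤ 0}) J)
    {r : ℝ} (hr : 0 < r) (z : ι → Sample nx ny × I) :
    Solvable (fun i => {q | h (z i).1 q - r * (z i).2 ≤ 0}) (regularized J r) :=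
  solvable_perturbed (g := fun i => h (z i).1) (fun _ => hconv _) hJ
    (hsolv fun i => (z i).1) hr (fun i => mul_nonneg hr.le (z i).2.2.1)
    fun i => mul_le_of_le_one_right hr.le (z i).2.2.2

lemma convexOn_sub_label (hconv : ∀ p, ConvexOn ℝ Set.univ (h p)) (r : ℝ)
    (x : Sample nx ny × I) : ConvexOn ℝ Set.univ fun q => h x.1 q - r * x.2 := by
  simp only [sub_eq_add_neg]
  exact (hconv _).add (convexOn_const _ convex_univ)

lemma measurableFinset_labelledCompression (hmeas : ∀ q, Measurable fun p => h p q)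
    (hconv : ∀ p, ConvexOn ℝ Set.univ (h p)) (hJ : ConvexOn ℝ Set.univ J)
    (hsolv : ∀ {κ : Type} (z : κ → Sample nx ny), Solvable (fun i => {q | h (z i) q ≤ 0}) J)
    (ρ : ℕ) {r : ℝ} (hr : 0 < r) (A : Finset ι) :
    MeasurableFinset fun z : ι → Sample nx ny × I => labelledCompression h J tb ρ r z A :=
  measurableFinset_compression (G := fun (z : ι → Sample nx ny × I) i q => h (z i).1 q)
    (G' := fun (z : ι → Sample nx ny × I) i q => h (z i).1 q - r * (z i).2)
    (fun i q => (hmeas q).comp (by fun_prop))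
    (fun z i => (hconv _).locallyLipschitz.continuous) hJ.locallyLipschitz.continuous
    (fun z => hsolv fun i => (z i).1)
    (fun i q => ((hmeas q).comp (by fun_prop)).sub (by fun_prop))
    (fun z i => (convexOn_sub_label hconv r (z i)).locallyLipschitz.continuous)
    (convexOn_regularized hJ hr.le).locallyLipschitz.continuous
    (fun z => solvable_labelled hconv hJ hsolv hr z)
    (fun i j => measurableSet_labelled tb i j) A ρ

lemma measurable_perturbedParam (hmeas : ∀ q, Measurable fun p => h p q)
    (hconv : ∀ p, ConvexOn ℝ Set.univ (h p)) (hJ : ConvexOn ℝ Set.univ J)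
    (hsolv : ∀ {κ : Type} (z : κ → Sample nx ny), Solvable (fun i => {q | h (z i) q ≤ 0}) J)
    (ρ : ℕ) {r : ℝ} (hr : 0 < r) :
    Measurable fun z : ι → Sample nx ny × I => perturbedParam h J tb ρ r z := by
  intro U hU
  exact (measurableFinset_removed (G := fun (z : ι → Sample nx ny × I) i q => h (z i).1 q)
    (fun i q => (hmeas q).comp (by fun_prop))
    (fun z i => (hconv _).locallyLipschitz.continuous) hJ.locallyLipschitz.continuous
    (fun z => hsolv fun i => (z i).1) (fun i j => measurableSet_labelled tb i j)
    Finset.univ ρ).bind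
    (p := fun R z => argmin (fun i => {q | h (z i).1 q - r * (z i).2 ≤ 0}) (regularized J r)
      (Finset.univ \ R) ∈ U)
    fun R => measurable_argmin (G := fun (z : ι → Sample nx ny × I) i q => h (z i).1 q - r * (z i).2)
      (fun i q => ((hmeas q).comp (by fun_prop)).sub (by fun_prop))
      (fun z i => (convexOn_sub_label hconv r (z i)).locallyLipschitz.continuous)
      (convexOn_regularized hJ hr.le).locallyLipschitz.continuous
      (fun z => solvable_labelled hconv hJ hsolv hr z) (Finset.univ \ R) hU

/-- The samples that would not be selected if they were appended to the labelled samples. -/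
def unselected (h : Sample nx ny → (Fin nq → ℝ) → ℝ) (J : (Fin nq → ℝ) → ℝ)
    (tb : TieBreak nx ny) (ρ : ℕ) (r : ℝ) (n : ℕ) :
    Set ((Fin n → Sample nx ny × I) × (Sample nx ny × I)) :=
  {p | Sum.inr 0 ∉ labelledCompression h J tb ρ r (Sum.elim p.1 fun _ : Fin 1 => p.2)
    Finset.univ}

/-- The embedding that keeps only the `j`-th of the appended indices. -/
def keepAppended {n k : ℕ} (j : Fin k) : Fin n ⊕ Fin 1 ↪ Fin n ⊕ Fin k :=
  (Function.Embedding.refl (Fin n)).sumMap ⟨fun _ => j, fun _ _ _ => Subsingleton.elim _ _⟩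

lemma univ_map_keepAppended {n k : ℕ} (j : Fin k) :
    (Finset.univ : Finset (Fin n ⊕ Fin 1)).map (keepAppended j) =
      Finset.univ.map Function.Embedding.inl ∪ {Sum.inr j} := by
  ext i
  rcases i with i | i
  · simp [keepAppended]
  · simp only [Finset.mem_map, Finset.mem_univ, true_and, Sum.exists, Finset.mem_union,
      Finset.mem_singleton, Sum.inr.injEq, Function.Embedding.inl_apply, reduceCtorEq,
      exists_false, false_or]
    constructor
    · rintro (⟨a, ha⟩ | ⟨a, ha⟩)
      · exact absurd ha Sum.inl_ne_inr
      · exact (Sum.inr_injective ha).symm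
    · rintro rfl
      exact Or.inr ⟨0, rfl⟩

lemma univ_map_inl_union_inr {n k : ℕ} :
    (Finset.univ.map Function.Embedding.inl ∪ Finset.univ.map Function.Embedding.inr :
      Finset (Fin n ⊕ Fin k)) = Finset.univ := by
  ext i
  rcases i with i | i <;> simp

/-- The labels travel with the samples, so the selection commutes with permutations exactly. Its
size is fixed by the padding, and the criterion for several fresh samples is
`disjoint_compression_iff`, whose nondegeneracy conditions hold almost surely: for the first `ρ`
rounds by transfer from `n` samples, for the last one by the perturbation. -/
lemma map_real_unselected (hmeas : ∀ q, Measurable fun p => h p q)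
    (hconv : ∀ p, ConvexOn ℝ Set.univ (h p)) (hJ : ConvexOn ℝ Set.univ J)
    (hsolv : ∀ {κ : Type} (z : κ → Sample nx ny), Solvable (fun i => {q | h (z i) q ≤ 0}) J)
    {m ρ : ℕ} (hnq : 1 ≤ nq)
    (hnd : ∀ k < ρ, ∀ᵐ d ∂(Measure.pi fun _ : Fin (m + (ρ + 1) * nq) => P),
      NondegenerateOn (fun i => {q | h (d i) q ≤ 0}) J
        (Finset.univ \ removed (fun i => {q | h (d i) q ≤ 0}) J (tb.Before d) Finset.univ k))
    {r : ℝ} (hr : 0 < r) :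
    MeasurableSet (unselected h J tb ρ r (m + (ρ + 1) * nq)) ∧
    (Measure.pi fun _ : Fin (m + (ρ + 1) * nq) => labelledMeasure P).map
      (fun a => (labelledMeasure P).real {x | (a, x) ∈ unselected h J tb ρ r _}) =
      betaMeasure ((m : ℝ) + 1) (((ρ + 1) * nq : ℕ) : ℝ) := by
  have hSm : ∀ k, MeasurableFinset
      fun z : Fin (m + (ρ + 1) * nq) ⊕ Fin k → Sample nx ny × I =>
        labelledCompression h J tb ρ r z Finset.univ := fun k =>
    measurableFinset_labelledCompression tb hmeas hconv hJ hsolv ρ hr _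
  have hGm : MeasurableSet (unselected h J tb ρ r (m + (ρ + 1) * nq)) :=
    ((measurePreserving_sumElim (labelledMeasure P) _).measurable (hSm 1 (Sum.inr 0))).compl
  refine ⟨hGm, ?_⟩
  have hKc : ∀ {κ : Type} [DecidableEq κ] (z : κ → Sample nx ny × I) i, Convex ℝ {q | h (z i).1 q ≤ 0} :=
    fun z => convex_sublevel (g := fun i => h (z i).1) fun i => hconv _
  have hKc' : ∀ {κ : Type} [DecidableEq κ] (z : κ → Sample nx ny × I) i,
      Convex ℝ {q | h (z i).1 q - r * (z i).2 ≤ 0} :=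
    fun z => convex_sublevel (g := fun i q => h (z i).1 q - r * (z i).2)
      fun i => convexOn_sub_label hconv r _
  refine map_measureReal_eq_betaMeasure (labelledMeasure P) (Nat.mul_pos (Nat.succ_pos ρ) hnq) hGm
    (fun k z => labelledCompression h J tb ρ r z Finset.univ) hSm ?_ ?_ ?_
  · intro k _
    filter_upwards [ae_injective_label P] with z hz
    have := isStrictTotalOrder_labelled tb hz
    exact card_compression hnq (hKc z) hJ (hsolv fun i => (z i).1) (hKc' z)
      (convexOn_regularized hJ hr.le) (solvable_labelled hconv hJ hsolv hr z) (by simp; omega)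
  · intro k _ τ
    refine Filter.Eventually.of_forall fun z i => ?_
    have := labelledCompression_map (h := h) (J := J) tb ρ r z τ.toEmbedding Finset.univ
    rw [univ_map_perm] at this
    rw [this]
    exact (Finset.mem_map' τ.toEmbedding).symm
  · intro k _
    filter_upwards [ae_nondegenerateOn_of_card_le (ι := Fin (m + (ρ + 1) * nq) ⊕ Fin k)
      P tb hconv hJ hsolv hnq (by omega) hnd,
      ae_nondegenerateOn_perturbed P hmeas hconv hJ hsolv hr] with z hz hL
    obtain ⟨hord, hE⟩ := hz
    have hd := disjoint_compression_iff (b := tb.Labelled z) hnq (hKc z) hJ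
      (hsolv fun i => (z i).1) (solvable_labelled hconv hJ hsolv hr z)
      (A := Finset.univ.map Function.Embedding.inl)
      (T := Finset.univ.map Function.Embedding.inr) (ρ := ρ) (by simp) (by
        rw [Finset.disjoint_left]; simp) (by simpa using hE) hL
    rw [univ_map_inl_union_inr, Finset.disjoint_left] at hd
    simp only [Finset.mem_map, Finset.mem_univ, true_and, Function.Embedding.inr_apply,
      forall_exists_index, forall_apply_eq_imp_iff] at hd
    refine Iff.trans (forall_congr' fun j => ?_) hd.symm
    have := labelledCompression_map (h := h) (J := J) tb ρ r z
      (keepAppended j) Finset.univ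
    rw [univ_map_keepAppended] at this
    change _ ↔ Sum.inr j ∉ labelledCompression h J tb ρ r z _
    rw [this]
    refine not_congr ?_
    have hz' : (fun i => z (keepAppended j i)) =
        Sum.elim (fun i => z (Sum.inl i)) fun _ : Fin 1 => z (Sum.inr j) := by
      funext i
      rcases i with i | i <;> rfl
    rw [hz']
    exact (Finset.mem_map' (keepAppended j) (a := Sum.inr 0)).symm

/-- An unselected sample satisfies its perturbed constraint. -/
lemma ae_unselected_subset
    (hconv : ∀ p, ConvexOn ℝ Set.univ (h p)) (hJ : ConvexOn ℝ Set.univ J)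
    (hsolv : ∀ {κ : Type} (z : κ → Sample nx ny), Solvable (fun i => {q | h (z i) q ≤ 0}) J)
    {n ρ : ℕ} (hnq : 1 ≤ nq) (hn : (ρ + 1) * nq ≤ n)
    (hnd : ∀ k < ρ, ∀ᵐ d ∂(Measure.pi fun _ : Fin n => P),
      NondegenerateOn (fun i => {q | h (d i) q ≤ 0}) J
        (Finset.univ \ removed (fun i => {q | h (d i) q ≤ 0}) J (tb.Before d) Finset.univ k))
    {r : ℝ} (hr : 0 < r) :
    ∀ᵐ a ∂(Measure.pi fun _ : Fin n => labelledMeasure P), ∀ᵐ x ∂(labelledMeasure P),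
      (a, x) ∈ unselected h J tb ρ r n → h x.1 (perturbedParam h J tb ρ r a) - r * x.2 ≤ 0 := by
  have h1 := (measurePreserving_sumElim (labelledMeasure P) n).quasiMeasurePreserving.ae
    (ae_nondegenerateOn_of_card_le (ι := Fin n ⊕ Fin 1) P tb hconv hJ hsolv hnq hn hnd)
  filter_upwards [Measure.ae_ae_of_ae_prod h1] with a ha
  filter_upwards [ha] with x hx hmem
  obtain ⟨hord, hE⟩ := hx
  set z : Fin n ⊕ Fin 1 → Sample nx ny × I := Sum.elim a fun _ => x with hz
  have huniv : (Finset.univ.map Function.Embedding.inl ∪ {Sum.inr 0} : Finset (Fin n ⊕ Fin 1)) =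
      Finset.univ := by
    ext i
    rcases i with i | i
    · simp
    · simp; omega
  have hmem' := mem_of_notMem_compression (b := tb.Labelled z) (t := Sum.inr 0)
    (K := fun i => {q | h (z i).1 q ≤ 0}) (K' := fun i => {q | h (z i).1 q - r * (z i).2 ≤ 0})
    (J := J) (J' := regularized J r) hnq
    (convex_sublevel (g := fun i => h (z i).1) fun i => hconv _) hJ
    (hsolv fun i => (z i).1) (solvable_labelled hconv hJ hsolv hr z)
    (A := Finset.univ.map Function.Embedding.inl) (ρ := ρ) (by simpa using hn) (by simp)
    (by rw [huniv]; exact hE Finset.univ (by simp)) (by rw [huniv]; exact hmem)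
  rw [removed_map, ← map_sdiff', argmin_map] at hmem'
  exact hmem'

/-- The final minimizer of a run with labels. -/
noncomputable def labelledParam (h : Sample nx ny → (Fin nq → ℝ) → ℝ)
    (J : (Fin nq → ℝ) → ℝ) (tb : TieBreak nx ny) (ρ : ℕ) (z : ι → Sample nx ny × I) :
    Fin nq → ℝ :=
  argmin (fun i => {q | h (z i).1 q ≤ 0}) J
    (Finset.univ \ removed (fun i => {q | h (z i).1 q ≤ 0}) J (tb.Labelled z) Finset.univ ρ)

/-- The removed set does not depend on `r`; only the program of the last stage moves, over a fixed
nonempty set of samples. -/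
lemma tendsto_perturbedParam (hconv : ∀ p, ConvexOn ℝ Set.univ (h p)) (hJ : ConvexOn ℝ Set.univ J)
    (hsolv : ∀ {κ : Type} (z : κ → Sample nx ny), Solvable (fun i => {q | h (z i) q ≤ 0}) J)
    {ρ : ℕ} (hnq : 1 ≤ nq) (hn : (ρ + 1) * nq ≤ Fintype.card ι) {z : ι → Sample nx ny × I}
    (hz : Function.Injective fun i => (z i).2) {r : ℕ → ℝ} (hr : ∀ m, 0 < r m)
    (hlim : Filter.Tendsto r Filter.atTop (nhds 0)) :
    Filter.Tendsto (fun m => perturbedParam h J tb ρ (r m) z) Filter.atTop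
      (nhds (labelledParam h J tb ρ z)) := by
  have := isStrictTotalOrder_labelled tb hz
  have h1 : (ρ + 1) * nq = ρ * nq + nq := by ring
  refine tendsto_argmin_perturbed (g := fun i => h (z i).1) (fun i => hconv _) hJ
    (hsolv fun i => (z i).1) ?_ hr hlim (fun m i => mul_nonneg (hr m).le (z i).2.2.1)
    fun m i => mul_le_of_le_one_right (hr m).le (z i).2.2.2
  rw [← Finset.card_pos, card_sdiff_removed hnq
    (convex_sublevel (g := fun i => h (z i).1) fun i => hconv _) hJ (hsolv fun i => (z i).1)
    (by rw [Finset.card_univ]; omega), Finset.card_univ]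
  omega

/-- The coverage guarantee with high confidence, for a run with labels. -/
lemma le_measure_labelled (hmeas : ∀ q, Measurable fun p => h p q)
    (hconv : ∀ p, ConvexOn ℝ Set.univ (h p)) (hJ : ConvexOn ℝ Set.univ J)
    (hsolv : ∀ {κ : Type} (z : κ → Sample nx ny), Solvable (fun i => {q | h (z i) q ≤ 0}) J)
    {m ρ : ℕ} (hnq : 1 ≤ nq)
    (hnd : ∀ k < ρ, ∀ᵐ d ∂(Measure.pi fun _ : Fin (m + (ρ + 1) * nq) => P),
      NondegenerateOn (fun i => {q | h (d i) q ≤ 0}) J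
        (Finset.univ \ removed (fun i => {q | h (d i) q ≤ 0}) J (tb.Before d) Finset.univ k))
    (c : ℝ) :
    betaMeasure ((m : ℝ) + 1) (((ρ + 1) * nq : ℕ) : ℝ) (Set.Ici c) ≤
      (Measure.pi fun _ : Fin (m + (ρ + 1) * nq) => labelledMeasure P)
        {a | c ≤ P.real {p | h p (labelledParam h J tb ρ a) ≤ 0}} := by
  set n := m + (ρ + 1) * nq with hn
  set M := Measure.pi fun _ : Fin n => labelledMeasure P
  let r : ℕ → ℝ := fun j => 1 / ((j : ℝ) + 1)
  have hr : ∀ j, 0 < r j := fun j => by positivity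
  have hlim : Filter.Tendsto r Filter.atTop (nhds 0) := tendsto_one_div_add_atTop_nhds_zero_nat
  have hh := measurable_uncurry_of_convex hmeas hconv
  have hpm : ∀ j, Measurable fun a : Fin n → Sample nx ny × I => perturbedParam h J tb ρ (r j) a :=
    fun j => measurable_perturbedParam tb hmeas hconv hJ hsolv ρ (hr j)
  let C : ℕ → Set ((Fin n → Sample nx ny × I) × (Sample nx ny × I)) := fun j =>
    {p | h p.2.1 (perturbedParam h J tb ρ (r j) p.1) - r j * p.2.2 ≤ 0}
  have hC : ∀ j, MeasurableSet (C j) := by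
    intro j
    refine measurableSet_le ?_ measurable_const
    exact (hh.comp (Measurable.prodMk (by fun_prop) ((hpm j).comp measurable_fst))).sub
      (by fun_prop)
  let B : ℕ → Set (Fin n → Sample nx ny × I) := fun j =>
    {a | c ≤ (labelledMeasure P).real {x | (a, x) ∈ C j}}
  have hB : ∀ j, MeasurableSet (B j) := fun j =>
    measurableSet_le measurable_const (measurable_measure_prodMk_left (hC j)).ennreal_toReal
  have hBle : ∀ j, betaMeasure ((m : ℝ) + 1) (((ρ + 1) * nq : ℕ) : ℝ) (Set.Ici c) ≤ M (B j) := by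
    intro j
    obtain ⟨hG, hlaw⟩ := map_real_unselected P tb hmeas hconv hJ hsolv hnq hnd (hr j)
    have hgm : Measurable fun a =>
        (labelledMeasure P).real {x | (a, x) ∈ unselected h J tb ρ (r j) n} :=
      (measurable_measure_prodMk_left hG).ennreal_toReal
    rw [← hlaw, Measure.map_apply hgm measurableSet_Ici]
    refine measure_mono_ae ?_
    filter_upwards [ae_unselected_subset P tb hconv hJ hsolv hnq (by omega) hnd (hr j)]
      with a ha hca
    have hca' : c ≤ (labelledMeasure P).real {x | (a, x) ∈ unselected h J tb ρ (r j) n} := hca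
    refine hca'.trans ?_
    refine ENNReal.toReal_mono (measure_ne_top _ _) (measure_mono_ae ?_)
    filter_upwards [ha] with x hx hmem
    exact hx hmem
  -- The limit is taken twice: for the calibration data here, and below for the test point with the
  -- calibration data fixed.
  refine (le_measure_frequently hB (Filter.Frequently.of_forall hBle)).trans (measure_mono_ae ?_)
  filter_upwards [ae_injective_label P] with a ha hfreq
  have hfreq' : ∃ᶠ j in Filter.atTop, ENNReal.ofReal c ≤
      (labelledMeasure P) {x | (a, x) ∈ C j} := by
    refine Filter.Frequently.mono hfreq fun j hj => ?_
    exact (ENNReal.ofReal_le_iff_le_toReal (measure_ne_top _ _)).2 hj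
  have hle := le_measure_frequently (fun j => measurable_prodMk_left (hC j)) hfreq'
  -- A relaxed constraint that holds for infinitely many `j` holds in the limit, because the
  -- parameters converge and the relaxation vanishes.
  have hsub : {x | ∃ᶠ j in Filter.atTop, x ∈ Prod.mk a ⁻¹' C j} ⊆
      Prod.fst ⁻¹' {p | h p (labelledParam h J tb ρ a) ≤ 0} := by
    intro x hx
    have htend := tendsto_perturbedParam (ρ := ρ) tb hconv hJ hsolv hnq (by simp; omega) ha hr hlim
    have h2 : Filter.Tendsto
        (fun j => h x.1 (perturbedParam h J tb ρ (r j) a) - r j * x.2) Filter.atTop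
        (nhds (h x.1 (labelledParam h J tb ρ a) - 0 * x.2)) :=
      (((hconv x.1).locallyLipschitz.continuous.tendsto _).comp htend).sub
        (hlim.mul_const _)
    rw [zero_mul, sub_zero] at h2
    exact le_of_tendsto_of_frequently h2 hx
  have hms : MeasurableSet {p | h p (labelledParam h J tb ρ a) ≤ 0} :=
    measurableSet_le (hmeas _) measurable_const
  have hfin := hle.trans (measure_mono hsub)
  rw [(measurePreserving_fst (μ := P) (ν := (volume : Measure I))).measure_preimage
    hms.nullMeasurableSet] at hfin
  exact (ENNReal.ofReal_le_iff_le_toReal (measure_ne_top _ _)).1 hfin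

/-- The final minimizer of a run in which ties are resolved by the index. -/
noncomputable def finalParam (h : Sample nx ny → (Fin nq → ℝ) → ℝ)
    (J : (Fin nq → ℝ) → ℝ) (tb : TieBreak nx ny) (ρ : ℕ) {n : ℕ} (d : Fin n → Sample nx ny) :
    Fin nq → ℝ :=
  argmin (fun i => {q | h (d i) q ≤ 0}) J
    (Finset.univ \ removed (fun i => {q | h (d i) q ≤ 0}) J (tb.Before d) Finset.univ ρ)

lemma measurable_finalParam (hmeas : ∀ q, Measurable fun p => h p q)
    (hconv : ∀ p, ConvexOn ℝ Set.univ (h p)) (hJ : ConvexOn ℝ Set.univ J)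
    (hsolv : ∀ {κ : Type} (z : κ → Sample nx ny), Solvable (fun i => {q | h (z i) q ≤ 0}) J)
    (ρ n : ℕ) : Measurable fun d : Fin n → Sample nx ny => finalParam h J tb ρ d :=
  measurable_argmin_removed (G := fun (d : Fin n → Sample nx ny) i q => h (d i) q)
    (fun i q => (hmeas q).comp (by fun_prop))
    (fun z i => (hconv _).locallyLipschitz.continuous) hJ.locallyLipschitz.continuous
    (fun z => hsolv z) (fun i j => measurableSet_before tb i j) Finset.univ ρ

lemma measurableSet_finalParam_le (hmeas : ∀ q, Measurable fun p => h p q)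
    (hconv : ∀ p, ConvexOn ℝ Set.univ (h p)) (hJ : ConvexOn ℝ Set.univ J)
    (hsolv : ∀ {κ : Type} (z : κ → Sample nx ny), Solvable (fun i => {q | h (z i) q ≤ 0}) J)
    (ρ n : ℕ) : MeasurableSet
      {p : (Fin n → Sample nx ny) × Sample nx ny | h p.2 (finalParam h J tb ρ p.1) ≤ 0} := by
  have hh := measurable_uncurry_of_convex hmeas hconv
  exact measurableSet_le (hh.comp (measurable_snd.prodMk
    ((measurable_finalParam tb hmeas hconv hJ hsolv ρ n).comp measurable_fst))) measurable_const

lemma labelledParam_eq_finalParam {n ρ : ℕ} {z : Fin n → Sample nx ny × I}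
    (hz : Function.Injective fun i => (z i).2) :
    labelledParam h J tb ρ z =
      finalParam h J tb ρ fun i => (z (Tuple.sort (fun i => (z i).2) i)).1 := by
  rw [labelledParam, sdiff_removed_sort tb hz, argmin_map]
  rfl

/-- The coverage guarantee with high confidence. -/
lemma le_measure_finalParam (hmeas : ∀ q, Measurable fun p => h p q)
    (hconv : ∀ p, ConvexOn ℝ Set.univ (h p)) (hJ : ConvexOn ℝ Set.univ J)
    (hsolv : ∀ {κ : Type} (z : κ → Sample nx ny), Solvable (fun i => {q | h (z i) q ≤ 0}) J)
    {m ρ : ℕ} (hnq : 1 ≤ nq)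
    (hnd : ∀ k < ρ, ∀ᵐ d ∂(Measure.pi fun _ : Fin (m + (ρ + 1) * nq) => P),
      NondegenerateOn (fun i => {q | h (d i) q ≤ 0}) J
        (Finset.univ \ removed (fun i => {q | h (d i) q ≤ 0}) J (tb.Before d) Finset.univ k))
    (c : ℝ) :
    betaMeasure ((m : ℝ) + 1) (((ρ + 1) * nq : ℕ) : ℝ) (Set.Ici c) ≤
      (Measure.pi fun _ : Fin (m + (ρ + 1) * nq) => P)
        {d | c ≤ P.real {p | h p (finalParam h J tb ρ d) ≤ 0}} := by
  refine (le_measure_labelled P tb hmeas hconv hJ hsolv hnq hnd c).trans ?_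
  set n := m + (ρ + 1) * nq
  set B : Set (Fin n → Sample nx ny) := {d | c ≤ P.real {p | h p (finalParam h J tb ρ d) ≤ 0}}
  have hB : MeasurableSet B := measurableSet_le measurable_const
    (measurable_measure_prodMk_left
      (measurableSet_finalParam_le tb hmeas hconv hJ hsolv ρ n)).ennreal_toReal
  have hmp := measurePreserving_arrowProdEquivProdArrow (Sample nx ny) I (Fin n) (fun _ => P)
    (fun _ => (volume : Measure I))
  -- conditionally on the labels, the samples are only permuted
  let E : Set ((Fin n → Sample nx ny) × (Fin n → I)) :=
    {p | (fun i => p.1 (Tuple.sort p.2 i)) ∈ B}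
  have hE : MeasurableSet E := by
    have : E = ⋃ τ : Equiv.Perm (Fin n), {p | Tuple.sort p.2 = τ} ∩
        {p | (fun i => p.1 (τ i)) ∈ B} := by
      ext p; simp [E]
    rw [this]
    refine MeasurableSet.iUnion fun τ => MeasurableSet.inter ?_ ?_
    · have : {p : (Fin n → Sample nx ny) × (Fin n → I) | Tuple.sort p.2 = τ} =
          {p | Monotone (p.2 ∘ τ) ∧ ∀ i j, i < j → p.2 (τ i) = p.2 (τ j) → τ i < τ j} := by
        ext p
        simp only [Set.mem_ofPred_eq]
        rw [eq_comm, Tuple.eq_sort_iff]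
      rw [this]
      have h1 : {p : (Fin n → Sample nx ny) × (Fin n → I) | Monotone (p.2 ∘ τ)} =
          ⋂ i, ⋂ j, {p | i ≤ j → p.2 (τ i) ≤ p.2 (τ j)} := by
        ext p; simp [Monotone]
      have h2 : {p : (Fin n → Sample nx ny) × (Fin n → I) |
          ∀ i j, i < j → p.2 (τ i) = p.2 (τ j) → τ i < τ j} =
          ⋂ i, ⋂ j, {p | i < j → p.2 (τ i) = p.2 (τ j) → τ i < τ j} := by
        ext p; simp
      have m1 : MeasurableSet {p : (Fin n → Sample nx ny) × (Fin n → I) |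
          Monotone (p.2 ∘ τ)} := by
        rw [h1]
        exact MeasurableSet.iInter fun i => MeasurableSet.iInter fun j =>
          (MeasurableSet.const _).himp (measurableSet_le (by fun_prop) (by fun_prop))
      have m2 : MeasurableSet {p : (Fin n → Sample nx ny) × (Fin n → I) |
          ∀ i j, i < j → p.2 (τ i) = p.2 (τ j) → τ i < τ j} := by
        rw [h2]
        exact MeasurableSet.iInter fun i => MeasurableSet.iInter fun j =>
          (MeasurableSet.const _).himp
            ((measurableSet_eq_fun (by fun_prop) (by fun_prop)).himp (MeasurableSet.const _))
      exact m1.inter m2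
    · exact (measurable_pi_lambda _ fun i => by fun_prop :
        Measurable fun (p : (Fin n → Sample nx ny) × (Fin n → I)) i => p.1 (τ i)) hB
  have hEB : ((Measure.pi fun _ : Fin n => P).prod
      (Measure.pi fun _ : Fin n => (volume : Measure I))) E =
      (Measure.pi fun _ : Fin n => P) B := by
    rw [Measure.prod_apply_symm hE]
    have : ∀ u : Fin n → I, (Measure.pi fun _ : Fin n => P) ((fun x => (x, u)) ⁻¹' E) =
        (Measure.pi fun _ : Fin n => P) B := fun u =>
      (measurePreserving_comp_embedding P (Tuple.sort u).toEmbedding).measure_preimage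
        hB.nullMeasurableSet
    simp only [this, lintegral_const, measure_univ, mul_one]
  rw [← hEB, ← hmp.measure_preimage hE.nullMeasurableSet]
  refine measure_mono_ae ?_
  filter_upwards [ae_injective_label P] with z hz hc
  have hc' : c ≤ P.real {p | h p (labelledParam h J tb ρ z) ≤ 0} := hc
  rw [labelledParam_eq_finalParam tb hz] at hc'
  exact hc'

end HighConfidence

/-! ### The exact law under full support. -/

section ExactLaw

variable {nx ny nq : ℕ} {h : Sample nx ny → (Fin nq → ℝ) → ℝ} {J : (Fin nq → ℝ) → ℝ}
  {ι : Type} [DecidableEq ι] [Fintype ι]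
  (P : Measure (Sample nx ny)) [IsProbabilityMeasure P] (tb : TieBreak nx ny)

/-- Full support passes to all subfamilies. -/
lemma ae_card_essential
    (hF : ∀ N, nq < N → ∀ᵐ d ∂(Measure.pi fun _ : Fin N => P),
      (essential (fun i => {q | h (d i) q ≤ 0}) J Finset.univ).card = nq) :
    ∀ᵐ z ∂(Measure.pi fun _ : ι => P), ∀ A : Finset ι, nq < A.card →
      (essential (fun i => {q | h (z i) q ≤ 0}) J A).card = nq := by
  rw [ae_all_iff]
  intro A
  by_cases hA : nq < A.card
  swap
  · exact Filter.Eventually.of_forall fun z h => absurd h hA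
  let e : Fin A.card ↪ ι := A.equivFin.symm.toEmbedding.trans (Function.Embedding.subtype _)
  have he : Finset.univ.map e = A := by
    refine Finset.eq_of_subset_of_card_le (fun i hi => ?_) (by simp)
    obtain ⟨j, -, rfl⟩ := Finset.mem_map.1 hi
    exact (A.equivFin.symm j).2
  filter_upwards [(measurePreserving_comp_embedding P e).quasiMeasurePreserving.ae
    (hF A.card hA)] with z hz _
  rw [← he, essential_map, Finset.card_map]
  exact hz

lemma isStrictTotalOrder_comp {κ : Type*} {b : κ → κ → Prop} [IsStrictTotalOrder κ b]
    (e : ι ↪ κ) : IsStrictTotalOrder ι fun i j => b (e i) (e j) where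
  trichotomous i j h1 h2 := by
    rcases trichotomous_of b (e i) (e j) with h | h | h
    · exact absurd h h1
    · exact e.injective h
    · exact absurd h h2
  irrefl i := irrefl_of b (e i)
  trans i j k := trans_of b

/-- The law of the coverage under full support and the violation condition. -/
lemma map_real_finalParam (hmeas : ∀ q, Measurable fun p => h p q)
    (hconv : ∀ p, ConvexOn ℝ Set.univ (h p)) (hJ : ConvexOn ℝ Set.univ J)
    (hsolv : ∀ {κ : Type} (z : κ → Sample nx ny), Solvable (fun i => {q | h (z i) q ≤ 0}) J)
    {m ρ : ℕ} (hnq : 1 ≤ nq)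
    (hF : ∀ N, nq < N → ∀ᵐ d ∂(Measure.pi fun _ : Fin N => P),
      (essential (fun i => {q | h (d i) q ≤ 0}) J Finset.univ).card = nq)
    (hV : ∀ N, ∀ᵐ d ∂(Measure.pi fun _ : Fin N => P), ∀ k ≤ ρ,
      ∀ i ∈ essential (fun i => {q | h (d i) q ≤ 0}) J
        (Finset.univ \ removed (fun i => {q | h (d i) q ≤ 0}) J (tb.Before d) Finset.univ k),
      ∀ B : Finset (Fin N), i ∉ B → (∀ j < k, Disjoint B
        (essential (fun i => {q | h (d i) q ≤ 0}) J (Finset.univ \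
          removed (fun i => {q | h (d i) q ≤ 0}) J (tb.Before d) Finset.univ j))) →
        B.card = nq → argmin (fun i => {q | h (d i) q ≤ 0}) J B ∉ {q | h (d i) q ≤ 0}) :
    (Measure.pi fun _ : Fin (m + (ρ + 1) * nq) => P).map
      (fun d => P.real {p | h p (finalParam h J tb ρ d) ≤ 0}) =
      betaMeasure ((m : ℝ) + 1) (((ρ + 1) * nq : ℕ) : ℝ) := by
  have h1 : (ρ + 1) * nq = ρ * nq + nq := by ring
  set n := m + (ρ + 1) * nq with hn
  have hKc : ∀ {κ : Type} [DecidableEq κ] (z : κ → Sample nx ny) i,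
      Convex ℝ {q | h (z i) q ≤ 0} :=
    fun z => convex_sublevel (g := fun i => h (z i)) fun i => hconv _
  have hFA := fun k : ℕ => ae_card_essential (ι := Fin n ⊕ Fin k) P hF
  refine map_measureReal_eq_betaMeasure P (Nat.mul_pos (Nat.succ_pos ρ) hnq)
    (measurableSet_finalParam_le tb hmeas hconv hJ hsolv ρ n)
    -- Under full support nothing is padded, so the relation that never holds may replace the order.
    -- The selection thereby becomes free of the indices, hence equivariant.
    (fun k z => removed (fun i => {q | h (z i) q ≤ 0}) J (fun _ _ => False) Finset.univ (ρ + 1))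
    ?_ ?_ ?_ ?_
  · intro k
    exact measurableFinset_removed
      (G := fun (z : Fin n ⊕ Fin k → Sample nx ny) i q => h (z i) q)
      (fun i q => (hmeas q).comp (by fun_prop))
      (fun z i => (hconv _).locallyLipschitz.continuous) hJ.locallyLipschitz.continuous
      (fun z => hsolv z) (fun i j => MeasurableSet.const _) Finset.univ (ρ + 1)
  · intro k hk
    filter_upwards [hFA k] with z hz
    exact (removed_fullSupport (b' := fun _ _ => False) hz (by simp; omega)).1
  · intro k hk τ
    refine Filter.Eventually.of_forall fun z i => ?_
    have := removed_map (fun i => {q | h (z i) q ≤ 0}) J (fun _ _ => False) τ.toEmbedding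
      Finset.univ (ρ + 1)
    rw [univ_map_perm] at this
    change _ ↔ τ i ∈ removed (fun i => {q | h (z i) q ≤ 0}) J (fun _ _ => False) Finset.univ (ρ + 1)
    rw [this]
    exact (Finset.mem_map' τ.toEmbedding).symm
  · intro k hk
    -- The violation condition concerns runs on `Fin (n + k)` with ties broken by the index; this
    -- order is transported to `Fin n ⊕ Fin k`.
    have hVz := (measurePreserving_comp_embedding P
      (finSumFinEquiv (m := n) (n := k)).symm.toEmbedding).quasiMeasurePreserving.ae (hV (n + k))
    filter_upwards [hFA k, hVz] with z hz hv
    set e : Fin (n + k) ↪ Fin n ⊕ Fin k := finSumFinEquiv.symm.toEmbedding with he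
    set e' : Fin n ⊕ Fin k ↪ Fin (n + k) := finSumFinEquiv.toEmbedding with he'
    have hee' : ∀ i, e (e' i) = i := fun i => finSumFinEquiv.symm_apply_apply i
    have he'e : ∀ i, e' (e i) = i := fun i => finSumFinEquiv.apply_symm_apply i
    have hord := isStrictTotalOrder_before tb fun i => z (e i)
    set b : Fin n ⊕ Fin k → Fin n ⊕ Fin k → Prop :=
      fun i j => tb.Before (fun i => z (e i)) (e' i) (e' j) with hb
    have hbord : IsStrictTotalOrder (Fin n ⊕ Fin k) b := isStrictTotalOrder_comp e'
    have hbe : (fun i j => b (e i) (e j)) = tb.Before fun i => z (e i) := by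
      funext i j
      simp only [hb, he'e]
    have hmapuniv : Finset.univ.map e = Finset.univ := by simp [he]
    have hrem : ∀ j, Finset.univ \ removed (fun i => {q | h (z i) q ≤ 0}) J b Finset.univ j =
        (Finset.univ \ removed (fun i => {q | h (z (e i)) q ≤ 0}) J
          (tb.Before fun i => z (e i)) Finset.univ j).map e := by
      intro j
      rw [map_sdiff', ← hbe]
      have := removed_map (fun i => {q | h (z i) q ≤ 0}) J b e Finset.univ j
      rw [hmapuniv] at this ⊢
      rw [this]
    have hiff := forall_mem_iff_disjoint_removed (b := b) (K := fun i => {q | h (z i) q ≤ 0})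
      (J := J) (ρ := ρ) hnq (hKc z) hJ
      (hsolv z) (A := Finset.univ.map Function.Embedding.inl)
      (T := Finset.univ.map Function.Embedding.inr) (by simp)
      (by rw [Finset.disjoint_left]; simp) ⟨Sum.inr ⟨0, hk⟩, by simp⟩ hz (by
        rw [univ_map_inl_union_inr]
        intro j hj i hi B _ hiB hdis hBc
        rw [hrem j, essential_map] at hi
        obtain ⟨i, hi', rfl⟩ := Finset.mem_map.1 hi
        have hBm : B = (B.map e').map e := by
          ext l
          simp only [Finset.mem_map, exists_exists_and_eq_and, hee', exists_eq_right]
        rw [hBm, argmin_map]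
        refine hv j hj i hi' (B.map e') (fun hcon => hiB ?_) (fun l hl => ?_) (by simpa using hBc)
        · rw [hBm]; exact Finset.mem_map_of_mem e hcon
        · have := hdis l hl
          rw [hrem l, essential_map, hBm, Finset.disjoint_map] at this
          exact this)
    rw [univ_map_inl_union_inr] at hiff
    have hfull := removed_fullSupport (b := b) (b' := fun _ _ => False) (k := ρ + 1) hz
      (A := Finset.univ) (by simp; omega)
    rw [hfull.2, Finset.disjoint_left] at hiff
    simp only [Finset.mem_map, Finset.mem_univ, true_and, Function.Embedding.inr_apply,
      forall_exists_index, forall_apply_eq_imp_iff] at hiff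
    refine Iff.trans (forall_congr' fun j => ?_) hiff
    have hza : ∀ B : Finset (Fin n), nq < B.card →
        (essential (fun i => {q | h (z (Sum.inl i)) q ≤ 0}) J B).card = nq := by
      intro B hB
      have := hz (B.map Function.Embedding.inl) (by simpa using hB)
      rwa [essential_map, Finset.card_map] at this
    rw [removed_map, ← map_sdiff', argmin_map]
    -- Again by full support, the transported order may be exchanged for the one of the calibration
    -- data.
    have := (removed_fullSupport (b := fun i j : Fin n => b (Sum.inl i) (Sum.inl j))
      (b' := tb.Before fun i => z (Sum.inl i)) (k := ρ) (A := Finset.univ) hza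
      (by simp; omega)).2
    simp only [Function.Embedding.inl_apply]
    rw [this]
    rfl

end ExactLaw

/-! ### The leave-one-out bound for exchangeable data. -/

section Exchangeable

variable {nx ny nq : ℕ} {h : Sample nx ny → (Fin nq → ℝ) → ℝ} {J : (Fin nq → ℝ) → ℝ}
  (tb : TieBreak nx ny)

/-- The permutation that moves the last index to position `i`. -/
def moveLast {n : ℕ} (i : Fin (n + 1)) : Equiv.Perm (Fin (n + 1)) :=
  finSuccEquivLast.trans (finSuccEquiv' i).symm

lemma moveLast_castSucc {n : ℕ} (i : Fin (n + 1)) (j : Fin n) :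
    moveLast i j.castSucc = i.succAbove j := by
  simp [moveLast]

lemma moveLast_last {n : ℕ} (i : Fin (n + 1)) : moveLast i (Fin.last n) = i := by
  simp [moveLast]

/-- The map `i.succAbove` is increasing and so preserves ties broken by the index; the run without
sample `i` is thus a genuine run on `n` samples. -/
lemma sdiff_removed_succAbove {n : ℕ} (z : Fin (n + 1) → Sample nx ny) (i : Fin (n + 1)) (k : ℕ) :
    Finset.univ.erase i \ removed (fun i => {q | h (z i) q ≤ 0}) J (tb.Before z)
      (Finset.univ.erase i) k =
    (Finset.univ \ removed (fun j => {q | h (z (i.succAbove j)) q ≤ 0}) J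
      (tb.Before fun j => z (i.succAbove j)) Finset.univ k).map i.succAboveEmb := by
  have hb : (fun j l => tb.Before z (i.succAboveEmb j) (i.succAboveEmb l)) =
      tb.Before fun j => z (i.succAbove j) := by
    funext j l
    simp [TieBreak.Before]
  have huniv : Finset.univ.map i.succAboveEmb = Finset.univ.erase i := by
    ext l
    simp [Fin.exists_succAbove_eq_iff]
  rw [map_sdiff', ← hb]
  have := removed_map (fun i => {q | h (z i) q ≤ 0}) J (tb.Before z) i.succAboveEmb Finset.univ k
  rw [huniv] at this ⊢
  rw [this]
  rfl

/-- The expected coverage bound for exchangeable data. -/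
lemma mul_measure_violated_le (hmeas : ∀ q, Measurable fun p => h p q)
    (hconv : ∀ p, ConvexOn ℝ Set.univ (h p)) (hJ : ConvexOn ℝ Set.univ J)
    (hsolv : ∀ {κ : Type} (z : κ → Sample nx ny), Solvable (fun i => {q | h (z i) q ≤ 0}) J)
    {n ρ : ℕ} (hnq : 1 ≤ nq) (hn : (ρ + 1) * nq ≤ n)
    (M : Measure (Fin (n + 1) → Sample nx ny)) [IsProbabilityMeasure M]
    (hM : ∀ τ : Equiv.Perm (Fin (n + 1)), M.map (fun z i => z (τ i)) = M)
    (hnd : ∀ k < ρ, ∀ᵐ z ∂M,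
      NondegenerateOn (fun i : Fin n => {q | h (z i.castSucc) q ≤ 0}) J
        (Finset.univ \ removed (fun i : Fin n => {q | h (z i.castSucc) q ≤ 0}) J
          (tb.Before fun i : Fin n => z i.castSucc) Finset.univ k)) :
    ((n : ENNReal) + 1) * M {z | ¬ h (z (Fin.last n))
      (finalParam h J tb ρ fun i : Fin n => z i.castSucc) ≤ 0} ≤ ((ρ + 1) * nq : ℕ) := by
  classical
  have hmp : ∀ τ : Equiv.Perm (Fin (n + 1)), MeasurePreserving
      (fun (z : Fin (n + 1) → Sample nx ny) i => z (τ i)) M M := fun τ => ⟨by fun_prop, hM τ⟩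
  set V : Set (Fin (n + 1) → Sample nx ny) := {z | ¬ h (z (Fin.last n))
      (finalParam h J tb ρ fun i : Fin n => z i.castSucc) ≤ 0} with hVdef
  have hV : MeasurableSet V := by
    refine MeasurableSet.compl (s := {z : Fin (n + 1) → Sample nx ny | h (z (Fin.last n))
      (finalParam h J tb ρ fun i : Fin n => z i.castSucc) ≤ 0}) ?_
    exact (Measurable.prodMk (by fun_prop) (by fun_prop) :
      Measurable fun z : Fin (n + 1) → Sample nx ny =>
        ((fun i : Fin n => z i.castSucc), z (Fin.last n)))
        (measurableSet_finalParam_le tb hmeas hconv hJ hsolv ρ n)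
  -- In `W i` the sample `i` plays the test point. These events are equally likely, and their sum is
  -- bounded pointwise by the leave-one-out count.
  let W : Fin (n + 1) → Set (Fin (n + 1) → Sample nx ny) := fun i =>
    (fun z j => z (moveLast i j)) ⁻¹' V
  have hW : ∀ i, MeasurableSet (W i) := fun i => (hmp (moveLast i)).measurable hV
  have hsum : ((n : ENNReal) + 1) * M V = ∑ i, M (W i) := by
    have : ∀ i, M (W i) = M V := fun i => (hmp (moveLast i)).measure_preimage hV.nullMeasurableSet
    simp only [this, Finset.sum_const, Finset.card_univ, Fintype.card_fin, nsmul_eq_mul]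
    push_cast; rfl
  have hall : ∀ᵐ z ∂M, ∀ i : Fin (n + 1), ∀ k < ρ,
      NondegenerateOn (fun i => {q | h (z i) q ≤ 0}) J (Finset.univ.erase i \
        removed (fun i => {q | h (z i) q ≤ 0}) J (tb.Before z) (Finset.univ.erase i) k) := by
    simp only [ae_all_iff]
    intro i k hk
    filter_upwards [(hmp (moveLast i)).quasiMeasurePreserving.ae (hnd k hk)] with z hz
    rw [sdiff_removed_succAbove, nondegenerateOn_map]
    simp only [moveLast_castSucc] at hz
    exact hz
  rw [hsum]
  have h2 : ∀ i, M (W i) = ∫⁻ z, (W i).indicator 1 z ∂M := fun i =>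
    (lintegral_indicator_one (hW i)).symm
  simp only [h2]
  rw [← lintegral_finsetSum _ fun i _ => measurable_one.indicator (hW i)]
  have h3 : ∀ᵐ z ∂M, ∑ i, (W i).indicator (1 : (Fin (n + 1) → Sample nx ny) → ENNReal) z ≤
      ((ρ + 1) * nq : ℕ) := by
    filter_upwards [hall] with z hz
    have := isStrictTotalOrder_before tb z
    have hcard := card_violated_le (b := tb.Before z) hnq
      (convex_sublevel (g := fun i => h (z i)) fun i => hconv _) hJ (hsolv z)
      (ρ := ρ) (by simp; omega) hz
    simp only [Set.indicator_apply, Pi.one_apply]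
    rw [Finset.sum_boole]
    refine Nat.cast_le.2 (le_trans (Finset.card_le_card fun i hi => ?_) hcard)
    rw [Finset.mem_filter] at hi ⊢
    refine ⟨hi.1, ?_⟩
    rw [sdiff_removed_succAbove, argmin_map]
    have h4 := hi.2
    simp only [W, hVdef, Set.mem_preimage, Set.mem_ofPred_eq, moveLast_last,
      moveLast_castSucc] at h4
    exact h4
  calc ∫⁻ z, ∑ i, (W i).indicator 1 z ∂M ≤ ∫⁻ z, (((ρ + 1) * nq : ℕ) : ENNReal) ∂M :=
        lintegral_mono_ae h3
    _ = _ := by rw [lintegral_const, measure_univ, mul_one]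

end Exchangeable

/-! ### Reduction to one real-valued convex constraint per sample, defined off the data space as
well. -/

section Scalarization

variable {nx ny nq ns N : ℕ} (s : Score nx ny nq ns) (Δ : Set (Sample nx ny)) (p₀ : Sample nx ny)

open Classical in
/-- The total violation of the constraint of a sample, extended to all samples by the value at a
fixed one outside of `Δ`. -/
noncomputable def violation (p : Sample nx ny) (q : Fin nq → ℝ) : ℝ :=
  ∑ j, max (s (if p ∈ Δ then p else p₀).1 (if p ∈ Δ then p else p₀).2 q j) 0

variable {s Δ p₀} {J : (Fin nq → ℝ) → ℝ}

lemma sum_max_zero_nonpos_iff {v : Fin ns → ℝ} : ∑ j, max (v j) 0 ≤ 0 ↔ v ≤ 0 := by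
  have h := fun j (_ : j ∈ Finset.univ) => le_max_right (v j) 0
  rw [(Finset.sum_nonneg h).ge_iff_eq', Finset.sum_eq_zero_iff_of_nonneg h]
  simp [Pi.le_def]

lemma violation_nonpos_iff {p : Sample nx ny} (hp : p ∈ Δ) {q : Fin nq → ℝ} :
    violation s Δ p₀ p q ≤ 0 ↔ s p.1 p.2 q ≤ 0 := by
  rw [violation, sum_max_zero_nonpos_iff, if_pos hp]

lemma setOf_violation {d : Fin N → Sample nx ny} (hd : ∀ i, d i ∈ Δ) :
    (fun i => {q | violation s Δ p₀ (d i) q ≤ 0}) = fun i => feasibleSet s (d i) := by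
  funext i
  ext q
  exact violation_nonpos_iff (hd i)

lemma measurable_violation (hΔ : MeasurableSet Δ)
    (hs : ∀ q, Measurable fun p : Sample nx ny => s p.1 p.2 q) (q : Fin nq → ℝ) :
    Measurable fun p => violation s Δ p₀ p q := by
  classical
  have hr : Measurable fun p => if p ∈ Δ then p else p₀ :=
    Measurable.ite hΔ measurable_id measurable_const
  refine Finset.measurable_sum _ fun j _ => Measurable.max ?_ measurable_const
  convert (measurable_pi_apply j).comp ((hs q).comp hr)
  rfl

lemma convexOn_violation (hp₀ : p₀ ∈ Δ)
    (hs : ∀ p ∈ Δ, ∀ j, ConvexOn ℝ Set.univ fun q => s p.1 p.2 q j) (p : Sample nx ny) :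
    ConvexOn ℝ Set.univ (violation s Δ p₀ p) := by
  refine convexOn_finset_sum _ fun j _ => convexOn_max_zero (hs _ ?_ j)
  split_ifs with h
  exacts [h, hp₀]

/-- Samples outside `Δ` are treated as copies of `p₀`, so uniqueness holds for all families of
samples and not only almost surely. -/
lemma solvable_violation (hp₀ : p₀ ∈ Δ) (huniq : ExistsUniqueSolution s J Δ) {κ : Type*}
    (z : κ → Sample nx ny) : Solvable (fun i => {q | violation s Δ p₀ (z i) q ≤ 0}) J := by
  classical
  refine solvable_of_fin (fun N hN d => ?_) z
  obtain ⟨q, hq⟩ := huniq N hN (fun i => if d i ∈ Δ then d i else p₀) fun i => by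
    split_ifs with h
    exacts [h, hp₀]
  refine ⟨q, ?_⟩
  rw [isSolution_iff] at hq
  convert hq using 2
  ext q
  rw [Set.mem_ofPred_eq, violation, sum_max_zero_nonpos_iff]
  rfl

variable (tb : TieBreak nx ny) {d : Fin N → Sample nx ny}

lemma stageParam_eq_finalParam (hd : ∀ i, d i ∈ Δ) (k : ℕ) :
    stageParam s J tb k d = finalParam (violation s Δ p₀) J tb k d := by
  rw [stageParam, finalParam, remaining, optimizer_eq, discarded_eq, setOf_violation hd]

lemma nondegenerate_iff (hd : ∀ i, d i ∈ Δ) (k : ℕ) :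
    Nondegenerate s J tb d k ↔
      NondegenerateOn (fun i => {q | violation s Δ p₀ (d i) q ≤ 0}) J (Finset.univ \
        removed (fun i => {q | violation s Δ p₀ (d i) q ≤ 0}) J (tb.Before d) Finset.univ k) := by
  rw [setOf_violation hd, Nondegenerate, stageParam, stageSupport, remaining, isSolution_iff,
    optimizer_eq, discarded_eq, support_eq, NondegenerateOn]

lemma stageSupport_eq (hd : ∀ i, d i ∈ Δ) (k : ℕ) (A : Finset (Fin N)) :
    stageSupport s J tb d A k =
      essential (fun i => {q | violation s Δ p₀ (d i) q ≤ 0}) J (A \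
        removed (fun i => {q | violation s Δ p₀ (d i) q ≤ 0}) J (tb.Before d) A k) := by
  rw [setOf_violation hd, stageSupport, remaining, discarded_eq, support_eq]

end Scalarization

/-! ### Coverage as a conditional probability of the scalar constraint. -/

section Coverage

variable {Ω : Type*} [MeasurableSpace Ω] {nx ny nq ns n : ℕ} {s : Score nx ny nq ns}
  {Δ : Set (Sample nx ny)} {p₀ : Sample nx ny} {J : (Fin nq → ℝ) → ℝ} (tb : TieBreak nx ny)
  {μ : Measure Ω} [IsProbabilityMeasure μ] {Z : Fin (n + 1) → Ω → Sample nx ny}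

lemma measurable_calibration (hZ : ∀ i, Measurable (Z i)) : Measurable (calibration Z) :=
  measurable_pi_lambda _ fun i => hZ i.castSucc

/-- Off the data space, the scalarization does not matter for the coverage. -/
lemma coverage_ae_eq (hZ : ∀ i, Measurable (Z i)) (hΔ : MeasurableSet Δ)
    (hZΔ : ∀ i, ∀ᵐ ω ∂μ, Z i ω ∈ Δ) (ρ : ℕ) :
    coverage s J tb ρ μ Z =ᵐ[μ] fun ω =>
      (condDistrib (Z (Fin.last n)) (calibration Z) μ (calibration Z ω)).real
        {p | violation s Δ p₀ p (finalParam (violation s Δ p₀) J tb ρ (calibration Z ω)) ≤ 0} := by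
  have hc := measurable_calibration hZ
  -- Since the test point lies in `Δ` almost surely, so does almost every point of its conditional
  -- law, for almost all calibration data.
  have h1 : ∀ᵐ x ∂((μ.map (calibration Z)) ⊗ₘ
      condDistrib (Z (Fin.last n)) (calibration Z) μ), x.2 ∈ Δ := by
    rw [compProd_map_condDistrib (hZ _).aemeasurable,
      ae_map_iff (hc.prodMk (hZ _)).aemeasurable (measurable_snd hΔ)]
    exact hZΔ _
  have h2 := ae_of_ae_map hc.aemeasurable (Measure.ae_ae_of_ae_compProd h1)
  have h3 : ∀ᵐ ω ∂μ, ∀ i, calibration Z ω i ∈ Δ := ae_all_iff.2 fun i => hZΔ _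
  filter_upwards [h2, h3] with ω hω hω'
  rw [coverage, stageParam_eq_finalParam tb hω']
  refine measureReal_congr ?_
  filter_upwards [hω] with p hp
  exact propext (violation_nonpos_iff hp).symm

lemma IsIID.map_eq_pi (h : IsIID Z μ) (hZ : ∀ i, Measurable (Z i)) :
    μ.map (calibration Z) = Measure.pi fun _ => μ.map (Z 0) := by
  have := (iIndepFun_iff_map_fun_eq_pi_map fun i => (hZ (Fin.castSucc i)).aemeasurable).1
    (h.1.precomp (Fin.castSucc_injective n))
  refine this.trans ?_
  simp only [(h.2 _ 0).map_eq]

lemma IsIID.condDistrib_ae_eq (h : IsIID Z μ) (hZ : ∀ i, Measurable (Z i)) :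
    ∀ᵐ ω ∂μ, condDistrib (Z (Fin.last n)) (calibration Z) μ (calibration Z ω) = μ.map (Z 0) := by
  have hc := measurable_calibration hZ
  have hind : IndepFun (calibration Z) (Z (Fin.last n)) μ := by
    have := h.1.indepFun_finset (Finset.univ.map Fin.castSuccEmb) {Fin.last n}
      (by simp [Finset.disjoint_singleton_right, Fin.castSucc_ne_last]) hZ
    exact this.comp
      (φ := fun (z : (Finset.univ.map (Fin.castSuccEmb (n := n)) : Finset _) → Sample nx ny) i =>
        z ⟨Fin.castSucc i, by simp⟩)
      (ψ := fun (z : ({Fin.last n} : Finset (Fin (n + 1))) → Sample nx ny) =>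
        z ⟨Fin.last n, by simp⟩) (by fun_prop) (by fun_prop)
  have := Measure.isProbabilityMeasure_map (μ := μ) (hZ 0).aemeasurable
  refine ae_of_ae_map hc.aemeasurable (condDistrib_ae_eq_of_measure_eq_compProd
    (κ := Kernel.const _ (μ.map (Z 0))) (calibration Z) (hZ _).aemeasurable ?_)
  rw [(indepFun_iff_map_prod_eq_prod_map_map hc.aemeasurable (hZ _).aemeasurable).1 hind,
    Measure.compProd_const, (h.2 _ 0).map_eq]

end Coverage

/-! ### Expectation of the coverage, and its form for independent data. -/

section Coverage

variable {Ω : Type*} [MeasurableSpace Ω] {nx ny nq ns n : ℕ} {s : Score nx ny nq ns}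
  {h : Sample nx ny → (Fin nq → ℝ) → ℝ}
  {Δ : Set (Sample nx ny)} {p₀ : Sample nx ny} {J : (Fin nq → ℝ) → ℝ} (tb : TieBreak nx ny)
  {μ : Measure Ω} [IsProbabilityMeasure μ] {Z : Fin (n + 1) → Ω → Sample nx ny}

/-- The conditional probability of satisfying the constraint has the right expectation. -/
lemma integral_condDistrib_real {S : Set ((Fin n → Sample nx ny) × Sample nx ny)}
    (hS : MeasurableSet S) (hZ : ∀ i, Measurable (Z i)) :
    Integrable (fun ω => (condDistrib (Z (Fin.last n)) (calibration Z) μ (calibration Z ω)).real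
      {p | (calibration Z ω, p) ∈ S}) μ ∧
    ∫ ω, (condDistrib (Z (Fin.last n)) (calibration Z) μ (calibration Z ω)).real
      {p | (calibration Z ω, p) ∈ S} ∂μ =
      μ.real {ω | (calibration Z ω, Z (Fin.last n) ω) ∈ S} := by
  have hc := measurable_calibration hZ
  set κ := condDistrib (Z (Fin.last n)) (calibration Z) μ
  have hm : Measurable fun c => κ c (Prod.mk c ⁻¹' S) := Kernel.measurable_kernel_prodMk_left hS
  have hm' := hm.comp hc
  constructor
  · refine Integrable.of_bound hm'.ennreal_toReal.aestronglyMeasurable 1 ?_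
    refine Filter.Eventually.of_forall fun ω => ?_
    rw [Real.norm_of_nonneg measureReal_nonneg]
    exact measureReal_le_one
  · have h1 : ∫ ω, (κ (calibration Z ω) (Prod.mk (calibration Z ω) ⁻¹' S)).toReal ∂μ =
        (∫⁻ ω, κ (calibration Z ω) (Prod.mk (calibration Z ω) ⁻¹' S) ∂μ).toReal :=
      integral_toReal hm'.aemeasurable (Filter.Eventually.of_forall fun ω => measure_lt_top _ _)
    refine h1.trans ?_
    rw [← lintegral_map hm hc, ← Measure.compProd_apply hS,
      compProd_map_condDistrib (hZ _).aemeasurable, Measure.map_apply (hc.prodMk (hZ _)) hS]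
    rfl

lemma ae_pi_map_mem (hZ : ∀ i, Measurable (Z i)) (hΔ : MeasurableSet Δ)
    (hZΔ : ∀ i, ∀ᵐ ω ∂μ, Z i ω ∈ Δ) (N : ℕ) :
    ∀ᵐ d ∂(Measure.pi fun _ : Fin N => μ.map (Z 0)), ∀ i, d i ∈ Δ := by
  have := Measure.isProbabilityMeasure_map (μ := μ) (hZ 0).aemeasurable
  rw [ae_all_iff]
  intro i
  refine (measurePreserving_eval (fun _ : Fin N => μ.map (Z 0)) i).quasiMeasurePreserving.ae
    (p := fun p => p ∈ Δ) ?_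
  rw [ae_map_iff (p := fun p => p ∈ Δ) (hZ 0).aemeasurable hΔ]
  exact hZΔ 0

/-- For independent samples, the coverage is a function of the calibration data. -/
lemma IsIID.coverage_ae_eq (hi : IsIID Z μ) (hZ : ∀ i, Measurable (Z i)) (hΔ : MeasurableSet Δ)
    (hZΔ : ∀ i, ∀ᵐ ω ∂μ, Z i ω ∈ Δ) (ρ : ℕ) :
    coverage s J tb ρ μ Z =ᵐ[μ] fun ω => (μ.map (Z 0)).real
      {p | violation s Δ p₀ p (finalParam (violation s Δ p₀) J tb ρ (calibration Z ω)) ≤ 0} := by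
  filter_upwards [RemMCP.coverage_ae_eq (p₀ := p₀) tb hZ hΔ hZΔ ρ, hi.condDistrib_ae_eq hZ]
    with ω h1 h2
  rw [h1, h2]

/-- Nondegeneracy in terms of the law of the calibration data. -/
lemma ae_map_nondegenerateOn (hZ : ∀ i, Measurable (Z i)) (hZΔ : ∀ i, ∀ᵐ ω ∂μ, Z i ω ∈ Δ)
    (hmeas : ∀ q, Measurable fun p => violation s Δ p₀ p q)
    (hconv : ∀ p, ConvexOn ℝ Set.univ (violation s Δ p₀ p)) (hJ : ConvexOn ℝ Set.univ J)
    (hsolv : ∀ {κ : Type} (z : κ → Sample nx ny),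
      Solvable (fun i => {q | violation s Δ p₀ (z i) q ≤ 0}) J) {k : ℕ}
    (hnondeg : ∀ᵐ ω ∂μ, Nondegenerate s J tb (calibration Z ω) k) :
    ∀ᵐ d ∂(μ.map (calibration Z)), NondegenerateOn
      (fun i => {q | violation s Δ p₀ (d i) q ≤ 0}) J (Finset.univ \
        removed (fun i => {q | violation s Δ p₀ (d i) q ≤ 0}) J (tb.Before d) Finset.univ k) := by
  have hG : ∀ (i : Fin n) q, Measurable fun d : Fin n → Sample nx ny =>
      violation s Δ p₀ (d i) q := fun i q => (hmeas q).comp (measurable_pi_apply i)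
  have hGc : ∀ (d : Fin n → Sample nx ny) i, Continuous (violation s Δ p₀ (d i)) :=
    fun d i => (hconv _).locallyLipschitz.continuous
  have hJc := hJ.locallyLipschitz.continuous
  rw [ae_map_iff (measurable_calibration hZ).aemeasurable]
  · filter_upwards [hnondeg, ae_all_iff.2 fun i : Fin n => hZΔ i.castSucc] with ω h1 h2
    exact (nondegenerate_iff tb h2 k).1 h1
  -- Passing from `μ` to the image law requires the nondegeneracy event to be measurable.
  · exact (measurableFinset_removed hG hGc hJc (fun d => hsolv d)
      (fun i j => measurableSet_before tb i j) Finset.univ k).bind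
      (p := fun R d => NondegenerateOn (fun i => {q | violation s Δ p₀ (d i) q ≤ 0}) J
        (Finset.univ \ R))
      fun R => measurableSet_nondegenerateOn hG hGc hJc (fun d => hsolv d) _

end Coverage

/-! ### The guarantees in terms of the original procedure. -/

/-- The expected coverage for exchangeable data. -/
lemma le_integral_coverage {Ω : Type*} [MeasurableSpace Ω] {nx ny nq ns n : ℕ}
    {s : Score nx ny nq ns} {Δ : Set (Sample nx ny)} {p₀ : Sample nx ny}
    {J : (Fin nq → ℝ) → ℝ} (tb : TieBreak nx ny) {μ : Measure Ω} [IsProbabilityMeasure μ]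
    {Z : Fin (n + 1) → Ω → Sample nx ny} (hZ : ∀ i, Measurable (Z i)) (hΔ : MeasurableSet Δ)
    (hZΔ : ∀ i, ∀ᵐ ω ∂μ, Z i ω ∈ Δ) (hp₀ : p₀ ∈ Δ)
    (hs_meas : ∀ q, Measurable fun p : Sample nx ny => s p.1 p.2 q)
    (hs_conv : ∀ p ∈ Δ, ∀ j, ConvexOn ℝ Set.univ fun q => s p.1 p.2 q j)
    (hJ : ConvexOn ℝ Set.univ J) (huniq : ExistsUniqueSolution s J Δ) {ρ : ℕ} (hnq : 1 ≤ nq)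
    (hn : (ρ + 1) * nq ≤ n)
    (hnondeg : ∀ k ≤ ρ, ∀ᵐ ω ∂μ, Nondegenerate s J tb (calibration Z ω) k)
    (hexch : Exchangeable Z μ) :
    Integrable (coverage s J tb ρ μ Z) μ ∧
      1 - ((ρ + 1) * nq : ℕ) / ((n : ℝ) + 1) ≤ ∫ ω, coverage s J tb ρ μ Z ω ∂μ := by
  have hmeas := measurable_violation (p₀ := p₀) hΔ hs_meas
  have hconv := convexOn_violation hp₀ hs_conv
  have hsolv : ∀ {κ : Type} (z : κ → Sample nx ny),
      Solvable (fun i => {q | violation s Δ p₀ (z i) q ≤ 0}) J :=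
    fun z => solvable_violation hp₀ huniq z
  have hS := measurableSet_finalParam_le tb hmeas hconv hJ hsolv ρ n
  have hcov := coverage_ae_eq (s := s) (J := J) (p₀ := p₀) tb hZ hΔ hZΔ ρ
  obtain ⟨hint, hval⟩ := integral_condDistrib_real (μ := μ) hS hZ
  refine ⟨hint.congr hcov.symm, ?_⟩
  rw [integral_congr_ae hcov]
  refine le_of_le_of_eq ?_ hval.symm
  have hZm : Measurable fun ω i => Z i ω := measurable_pi_lambda _ hZ
  set M := μ.map fun ω i => Z i ω with hMdef
  have hM1 : IsProbabilityMeasure M := Measure.isProbabilityMeasure_map hZm.aemeasurable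
  have hM : ∀ τ : Equiv.Perm (Fin (n + 1)), M.map (fun z i => z (τ i)) = M := fun τ => by
    rw [hMdef, Measure.map_map (by fun_prop) hZm]
    exact hexch τ
  have hnd : ∀ k < ρ, ∀ᵐ z ∂M, NondegenerateOn
      (fun i : Fin n => {q | violation s Δ p₀ (z i.castSucc) q ≤ 0}) J
        (Finset.univ \ removed (fun i : Fin n => {q | violation s Δ p₀ (z i.castSucc) q ≤ 0}) J
          (tb.Before fun i : Fin n => z i.castSucc) Finset.univ k) := by
    intro k hk
    have := ae_map_nondegenerateOn (Z := Z) (p₀ := p₀) tb hZ hZΔ hmeas hconv hJ hsolv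
      (hnondeg k hk.le)
    have hMc : M.map (fun z (i : Fin n) => z i.castSucc) = μ.map (calibration Z) := by
      rw [hMdef, Measure.map_map (by fun_prop) hZm]
      rfl
    rw [← hMc] at this
    exact ae_of_ae_map (Measurable.aemeasurable (by fun_prop)) this
  have key := mul_measure_violated_le tb hmeas hconv hJ hsolv hnq hn M hM hnd
  have hV : MeasurableSet {z : Fin (n + 1) → Sample nx ny | ¬ violation s Δ p₀ (z (Fin.last n))
      (finalParam (violation s Δ p₀) J tb ρ fun i : Fin n => z i.castSucc) ≤ 0} :=
    ((Measurable.prodMk (by fun_prop) (by fun_prop) :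
      Measurable fun z : Fin (n + 1) → Sample nx ny =>
        ((fun i : Fin n => z i.castSucc), z (Fin.last n))) hS).compl
  rw [hMdef, Measure.map_apply hZm hV] at key
  have hS' : MeasurableSet {ω | (calibration Z ω, Z (Fin.last n) ω) ∈
      {p : (Fin n → Sample nx ny) × Sample nx ny |
        violation s Δ p₀ p.2 (finalParam (violation s Δ p₀) J tb ρ p.1) ≤ 0}} :=
    ((measurable_calibration hZ).prodMk (hZ _)) hS
  have key' : ((n : ENNReal) + 1) * μ {ω | (calibration Z ω, Z (Fin.last n) ω) ∈
      {p : (Fin n → Sample nx ny) × Sample nx ny |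
        violation s Δ p₀ p.2 (finalParam (violation s Δ p₀) J tb ρ p.1) ≤ 0}}ᶜ ≤
      ((ρ + 1) * nq : ℕ) := key
  have hreal := ENNReal.toReal_mono (ENNReal.natCast_ne_top _) key'
  rw [ENNReal.toReal_mul, ENNReal.toReal_natCast, ENNReal.toReal_add (by simp) (by simp),
    ENNReal.toReal_natCast, ENNReal.toReal_one, ← measureReal_def,
    probReal_compl_eq_one_sub hS'] at hreal
  have hpos : (0 : ℝ) < (n : ℝ) + 1 := by positivity
  rw [sub_le_comm, le_div_iff₀ hpos, mul_comm]
  exact hreal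

/-- Nondegenerate programs and independent data: the coverage dominates a beta distribution. -/
lemma betaMeasure_Ici_le_measure_coverage {Ω : Type*} [MeasurableSpace Ω] {nx ny nq ns m ρ : ℕ}
    {s : Score nx ny nq ns} {Δ : Set (Sample nx ny)} {p₀ : Sample nx ny}
    {J : (Fin nq → ℝ) → ℝ} (tb : TieBreak nx ny) {μ : Measure Ω} [IsProbabilityMeasure μ]
    {Z : Fin (m + (ρ + 1) * nq + 1) → Ω → Sample nx ny} (hZ : ∀ i, Measurable (Z i))
    (hΔ : MeasurableSet Δ) (hZΔ : ∀ i, ∀ᵐ ω ∂μ, Z i ω ∈ Δ) (hp₀ : p₀ ∈ Δ)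
    (hs_meas : ∀ q, Measurable fun p : Sample nx ny => s p.1 p.2 q)
    (hs_conv : ∀ p ∈ Δ, ∀ j, ConvexOn ℝ Set.univ fun q => s p.1 p.2 q j)
    (hJ : ConvexOn ℝ Set.univ J) (huniq : ExistsUniqueSolution s J Δ) (hnq : 1 ≤ nq)
    (hnondeg : ∀ k ≤ ρ, ∀ᵐ ω ∂μ, Nondegenerate s J tb (calibration Z ω) k)
    (hiid : IsIID Z μ) (c : ℝ) :
    betaMeasure ((m : ℝ) + 1) (((ρ + 1) * nq : ℕ) : ℝ) (Set.Ici c) ≤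
      μ {ω | c ≤ coverage s J tb ρ μ Z ω} := by
  have hmeas := measurable_violation (p₀ := p₀) hΔ hs_meas
  have hconv := convexOn_violation hp₀ hs_conv
  have hsolv : ∀ {κ : Type} (z : κ → Sample nx ny),
      Solvable (fun i => {q | violation s Δ p₀ (z i) q ≤ 0}) J :=
    fun z => solvable_violation hp₀ huniq z
  have := Measure.isProbabilityMeasure_map (μ := μ) (hZ 0).aemeasurable
  have hc := measurable_calibration hZ
  have hlaw := hiid.map_eq_pi hZ
  refine (le_measure_finalParam (μ.map (Z 0)) tb hmeas hconv hJ hsolv (ρ := ρ) hnq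
    (fun k hk => ?_) c).trans ?_
  · rw [← hlaw]
    exact ae_map_nondegenerateOn tb hZ hZΔ hmeas hconv hJ hsolv (hnondeg k hk.le)
  · have hB : MeasurableSet {d : Fin (m + (ρ + 1) * nq) → Sample nx ny | c ≤ (μ.map (Z 0)).real
        {p | violation s Δ p₀ p (finalParam (violation s Δ p₀) J tb ρ d) ≤ 0}} :=
      measurableSet_le measurable_const (measurable_measure_prodMk_left
        (measurableSet_finalParam_le tb hmeas hconv hJ hsolv ρ _)).ennreal_toReal
    rw [← hlaw, Measure.map_apply hc hB]
    refine measure_mono_ae ?_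
    filter_upwards [hiid.coverage_ae_eq (J := J) (s := s) (p₀ := p₀) tb hZ hΔ hZΔ ρ] with ω h1 h2
    exact le_of_le_of_eq h2 h1.symm

/-- The exact law of the coverage under full support and the violation condition. -/
lemma hasLaw_coverage {Ω : Type*} [MeasurableSpace Ω] {nx ny nq ns m ρ : ℕ}
    {s : Score nx ny nq ns} {Δ : Set (Sample nx ny)} {p₀ : Sample nx ny}
    {J : (Fin nq → ℝ) → ℝ} (tb : TieBreak nx ny) {μ : Measure Ω} [IsProbabilityMeasure μ]
    {Z : Fin (m + (ρ + 1) * nq + 1) → Ω → Sample nx ny} (hZ : ∀ i, Measurable (Z i))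
    (hΔ : MeasurableSet Δ) (hZΔ : ∀ i, ∀ᵐ ω ∂μ, Z i ω ∈ Δ) (hp₀ : p₀ ∈ Δ)
    (hs_meas : ∀ q, Measurable fun p : Sample nx ny => s p.1 p.2 q)
    (hs_conv : ∀ p ∈ Δ, ∀ j, ConvexOn ℝ Set.univ fun q => s p.1 p.2 q j)
    (hJ : ConvexOn ℝ Set.univ J) (huniq : ExistsUniqueSolution s J Δ) (hnq : 1 ≤ nq)
    (hiid : IsIID Z μ) (hF : FullySupported s J (μ.map (Z 0)))
    (hV : ViolationCondition s J tb ρ (μ.map (Z 0))) :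
    HasLaw (coverage s J tb ρ μ Z) (betaMeasure ((m : ℝ) + 1) (((ρ + 1) * nq : ℕ) : ℝ)) μ := by
  have hmeas := measurable_violation (p₀ := p₀) hΔ hs_meas
  have hconv := convexOn_violation hp₀ hs_conv
  have hsolv : ∀ {κ : Type} (z : κ → Sample nx ny),
      Solvable (fun i => {q | violation s Δ p₀ (z i) q ≤ 0}) J :=
    fun z => solvable_violation hp₀ huniq z
  have := Measure.isProbabilityMeasure_map (μ := μ) (hZ 0).aemeasurable
  have hc := measurable_calibration hZ
  have hg : Measurable fun d : Fin (m + (ρ + 1) * nq) → Sample nx ny => (μ.map (Z 0)).real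
      {p | violation s Δ p₀ p (finalParam (violation s Δ p₀) J tb ρ d) ≤ 0} :=
    (measurable_measure_prodMk_left
      (measurableSet_finalParam_le tb hmeas hconv hJ hsolv ρ _)).ennreal_toReal
  have hcov := hiid.coverage_ae_eq (J := J) (s := s) (p₀ := p₀) tb hZ hΔ hZΔ ρ
  refine HasLaw.congr (X := fun ω => (μ.map (Z 0)).real {p | violation s Δ p₀ p
    (finalParam (violation s Δ p₀) J tb ρ (calibration Z ω)) ≤ 0})
    ⟨(hg.comp hc).aemeasurable, ?_⟩ hcov
  refine (Measure.map_map hg hc).symm.trans ?_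
  rw [hiid.map_eq_pi hZ]
  refine map_real_finalParam (μ.map (Z 0)) tb hmeas hconv hJ hsolv hnq (fun N hN => ?_)
    fun N => ?_
  · filter_upwards [hF N hN, ae_pi_map_mem hZ hΔ hZΔ N] with d h1 hd
    rw [setOf_violation hd]
    exact h1
  · filter_upwards [hV N, ae_pi_map_mem hZ hΔ hZΔ N] with d h1 hd k hk i hi B hiB hdis hcard
    rw [← stageSupport_eq tb hd] at hi
    simp only [← stageSupport_eq tb hd] at hdis
    have := h1 Finset.univ k hk i hi B (Finset.subset_univ _) hiB hdis hcard
    rw [setOf_violation hd, ← optimizer_eq]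
    change ¬ violation s Δ p₀ (d i) _ ≤ 0
    rw [violation_nonpos_iff (hd i)]
    exact this

end RemMCP

theorem theorem1 {nx ny nq ns n : ℕ} (hnq : 1 ≤ nq)
    -- the data space
    (Δ : Set (RemMCP.Sample nx ny)) (hΔ : MeasurableSet Δ)
    -- convex score and cost
    (s : RemMCP.Score nx ny nq ns)
    (hs_meas : ∀ q, Measurable fun p : RemMCP.Sample nx ny => s p.1 p.2 q)
    (hs_conv : ∀ p ∈ Δ, ∀ j, ConvexOn ℝ Set.univ fun q => s p.1 p.2 q j)
    (J : (Fin nq → ℝ) → ℝ) (hJ : ConvexOn ℝ Set.univ J)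
    (tb : RemMCP.TieBreak nx ny)
    -- target miscoverage and removal budget
    (ε : ℝ) (hε0 : 0 < ε) (hε1 : ε < 1)
    (ρ : ℕ) (hρ : (ρ : ℤ) = ⌊ε * ((n : ℝ) + 1) / (nq : ℝ)⌋ - 1)
    -- calibration data and test point
    {Ω : Type*} [MeasurableSpace Ω] (μ : MeasureTheory.Measure Ω)
    [MeasureTheory.IsProbabilityMeasure μ]
    (Z : Fin (n + 1) → Ω → RemMCP.Sample nx ny) (hZ : ∀ i, Measurable (Z i))
    (hZΔ : ∀ i, ∀ᵐ ω ∂μ, Z i ω ∈ Δ)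
    -- uniqueness and nondegeneracy
    (huniq : RemMCP.ExistsUniqueSolution s J Δ)
    (hnondeg : ∀ k ≤ ρ, ∀ᵐ ω ∂μ, RemMCP.Nondegenerate s J tb (RemMCP.calibration Z ω) k) :
    -- exchangeable data: expected coverage
    (RemMCP.Exchangeable Z μ →
      MeasureTheory.Integrable (RemMCP.coverage s J tb ρ μ Z) μ ∧
        1 - ε ≤ ∫ ω, RemMCP.coverage s J tb ρ μ Z ω ∂μ) ∧
    -- independent and identically distributed data: coverage with high confidence
    (RemMCP.IsIID Z μ →
      1 - RemMCP.binomialTail n (nq * (ρ + 1)) ε ≤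
        μ.real {ω | 1 - ε ≤ RemMCP.coverage s J tb ρ μ Z ω}) ∧
    -- the binomial tail is a value of the distribution function of a beta distribution
    RemMCP.binomialTail n (nq * (ρ + 1)) ε =
      (ProbabilityTheory.betaMeasure ((n : ℝ) - nq * (ρ + 1) + 1) (nq * (ρ + 1))).real
        (Set.Iic (1 - ε)) ∧
    -- the exact law of the coverage
    (RemMCP.IsIID Z μ → RemMCP.FullySupported s J (μ.map (Z 0)) →
      RemMCP.ViolationCondition s J tb ρ (μ.map (Z 0)) →
        ProbabilityTheory.HasLaw (RemMCP.coverage s J tb ρ μ Z)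
          (ProbabilityTheory.betaMeasure ((n : ℝ) - nq * (ρ + 1) + 1) (nq * (ρ + 1))) μ) := by
  have hnq0 : (0 : ℝ) < nq := by exact_mod_cast hnq
  have hbudget : (((ρ + 1) * nq : ℕ) : ℝ) ≤ ε * ((n : ℝ) + 1) := by
    have h1 : ((ρ : ℤ) + 1) ≤ ⌊ε * ((n : ℝ) + 1) / (nq : ℝ)⌋ := by omega
    have h2 := Int.le_floor.1 h1
    rw [le_div_iff₀ hnq0] at h2
    push_cast at h2 ⊢
    exact h2
  -- As `ε < 1`, the budget is strictly below `n + 1`, so enough samples remain for the last stage.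
  have hle : (ρ + 1) * nq ≤ n := by
    have h1 : (((ρ + 1) * nq : ℕ) : ℝ) < ((n + 1 : ℕ) : ℝ) := by
      push_cast at hbudget ⊢
      nlinarith
    exact Nat.lt_succ_iff.1 (Nat.cast_lt.1 h1)
  obtain ⟨m, rfl⟩ : ∃ m, n = m + (ρ + 1) * nq := ⟨n - (ρ + 1) * nq, by omega⟩
  -- A realized data point serves as the reference point `p₀` of the scalarization.
  obtain ⟨ω₀, hω₀⟩ := (hZΔ 0).exists
  have ha : ((m + (ρ + 1) * nq : ℕ) : ℝ) - nq * (ρ + 1) + 1 = m + 1 := by push_cast; ring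
  have hb : (nq : ℝ) * (ρ + 1) = (((ρ + 1) * nq : ℕ) : ℝ) := by push_cast; ring
  have htail : RemMCP.binomialTail (m + (ρ + 1) * nq) (nq * (ρ + 1)) ε =
      (ProbabilityTheory.betaMeasure ((m : ℝ) + 1) (((ρ + 1) * nq : ℕ) : ℝ)).real
        (Set.Iic (1 - ε)) := by
    rw [mul_comm nq]
    exact RemMCP.binomialTail_eq_betaMeasure m _ (Nat.mul_pos (Nat.succ_pos ρ) hnq) hε0 hε1
  rw [ha, hb]
  refine ⟨fun hexch => ?_, fun hiid => ?_, htail, fun hiid hF hV => ?_⟩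
  · obtain ⟨hint, hval⟩ := RemMCP.le_integral_coverage tb hZ hΔ hZΔ hω₀ hs_meas hs_conv hJ huniq
      hnq hle hnondeg hexch
    refine ⟨hint, le_trans (sub_le_sub_left ?_ _) hval⟩
    rw [div_le_iff₀ (by positivity)]
    exact hbudget
  · have := ProbabilityTheory.isProbabilityMeasureBeta (α := (m : ℝ) + 1)
      (β := (((ρ + 1) * nq : ℕ) : ℝ)) (by positivity)
      (Nat.cast_pos.2 (Nat.mul_pos (Nat.succ_pos ρ) hnq))
    have hdom := RemMCP.betaMeasure_Ici_le_measure_coverage tb hZ hΔ hZΔ hω₀ hs_meas hs_conv hJ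
      huniq hnq hnondeg hiid (1 - ε)
    -- One minus the distribution function is the mass of the open ray, which is at most that of the
    -- closed ray in the domination bound.
    rw [htail, ← MeasureTheory.probReal_compl_eq_one_sub measurableSet_Iic, Set.compl_Iic]
    exact ENNReal.toReal_mono (MeasureTheory.measure_ne_top _ _)
      ((MeasureTheory.measure_mono Set.Ioi_subset_Ici_self).trans hdom)
  · exact RemMCP.hasLaw_coverage tb hZ hΔ hZΔ hω₀ hs_meas hs_conv hJ huniq hnq hiid hF hV
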